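/- Complex spaces are Hausdorff and locally isomorphic to zero loci $V(f_1,\dots,f_k)$, with structure sheaf $\mathcal O_D/(f_1,\dots,f_k)$, of finitely many holomorphic functions on open sets $D\subseteq\mathbb C^n$. For a closed complex subspace $W\subseteq P$ with ideal sheaf $I$, let $\operatorname{Res}_W P=\operatorname{Proj}_P S(I)$ be the residual space, where $S(I)$ is the symmetric algebra of the $\mathcal O_P$-module $I$. For a holomorphic map $f\colon X\to Y$ of complex spaces, put $K_0(f)=Y$, $K_1(f)=X$ and, for $r\ge 2$, $$K_r(f)=\operatorname{Res}_{\Delta K_{r-1}(f)}\bigl(K_{r-1}(f)\times_{K_{r-2}(f)}K_{r-1}(f)\bigr),$$ with the map $K_r(f)\to K_{r-1}(f)$ induced by the first projection. Let $B_r(X)=K_r(X\to *)$, where $*$ is the one-point complex manifold. A commutative square from $f\colon X\to Y$ to $f'\colon X'\to Y'$ in which $X\to X'$ is a closed embedding induces canonical closed embeddings $K_r(f)\hookrightarrow K_r(f')$ for all $r\ge 1$, starting from the given $X\hookrightarrow X'$. Inductively, $K_r(f)\hookrightarrow K_r(f')$ is the morphism of $\operatorname{Proj}$'s over the induced morphism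 of fibred products $K_{r-1}(f)\times_{K_{r-2}(f)}K_{r-1}(f)\to K_{r-1}(f')\times_{K_{r-2}(f')}K_{r-1}(f')$ that is defined by the pullback of functions $I_{\Delta K_{r-1}(f')}\to I_{\Delta K_{r-1}(f)}$ between the ideals of the diagonals. **Theorem.** Let $$\begin{array}{ccc}X&\xrightarrow{\ f\ }&Y\\ \downarrow&&\downarrow\\ X'&\xrightarrow{\ f'\ }&Y'\end{array}$$ be a commutative diagram of complex spaces in which both vertical maps $X\hookrightarrow X'$ and $Y\hookrightarrow Y'$ are closed embeddings. Write $K_r=K_r(f)$, $K'_r=K_r(f')$, $B_r=B_r(X)$ and $B'_r=B_r(X')$. Then the canonical morphisms $K_r\to K'_r$, $B_r\to B'_r$, $K_r\to B_r$ and $K'_r\to B'_r$, that is, those induced by the given square and by the squares from $X\to *$ to $X'\to *$, from $f$ to $X\to *$, and from $f'$ to $X'\to *$, exist and are unique, they are closed embeddings for $r\ge 1$, and for every $r\ge1$ $$K_r=K'_r\cap B_r\quad\text{inside } B'_r,$$ that is, the canonical square formed by $K_r$, $K'_r$, $B_r$ and $B'_r$ is cartesian in the category of complex spaces. -/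

import Mathlib

open CategoryTheory AlgebraicGeometry TopologicalSpace Opposite Manifold ContDiff

/-! ## Complex spaces

Complex spaces are Hausdorff locally ringed spaces over `Spec ℂ` that are locally isomorphic to a
zero locus `V(f₁, …, f_k)` of holomorphic functions on an open subset `D` of `ℂⁿ`, with structure
sheaf `𝒪_D / (f₁, …, f_k)`.  Morphisms are morphisms of locally ringed spaces over `Spec ℂ`, that
is, morphisms of locally `ℂ`-ringed spaces. -/

namespace IteratedMultiplePoints

noncomputable section

/-- `Spec ℂ` as a locally ringed space. -/
abbrev specC : LocallyRingedSpace.{0} := Spec.locallyRingedSpaceObj (CommRingCat.of ℂ)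

/-- The morphism `X ⟶ Spec ℂ` given by a ring homomorphism from `ℂ` to the global functions. -/
def toSpecC (X : LocallyRingedSpace.{0}) (φ : ℂ →+* X.presheaf.obj (op ⊤)) : X ⟶ specC :=
  X.toΓSpec ≫ Spec.locallyRingedSpaceMap (CommRingCat.ofHom φ)

/-- `ℂⁿ` with its sheaf of holomorphic functions. -/
abbrev affineLRS (n : ℕ) : LocallyRingedSpace.{0} :=
  ChartedSpace.locallyRingedSpace 𝓘(ℂ, Fin n → ℂ) (Fin n → ℂ)

/-- Holomorphic functions on the open subset `D` of `ℂⁿ`. -/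
abbrev HolFun (n : ℕ) (D : Opens (Fin n → ℂ)) : Type :=
  C^∞⟮𝓘(ℂ, Fin n → ℂ), D; 𝓘(ℂ), ℂ⟯

/-- Constant functions on `ℂⁿ`. -/
def affineConst (n : ℕ) : ℂ →+* (affineLRS n).presheaf.obj (op ⊤) :=
  algebraMap ℂ (HolFun n ⊤)

/-- `ℂⁿ` as a locally ringed space over `Spec ℂ`. -/
def affineOver (n : ℕ) : Over specC := Over.mk (toSpecC _ (affineConst n))

/-- The germ at `z` of a holomorphic function on `D ⊆ ℂⁿ`. -/
def holGerm {n : ℕ} {D : Opens (Fin n → ℂ)} (f : HolFun n D) (z : affineLRS n)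
    (hz : z ∈ (D : Set (Fin n → ℂ))) : (affineLRS n).presheaf.stalk z :=
  (affineLRS n).presheaf.germ D z hz f

/-- `i : Z ⟶ ℂⁿ` identifies `Z` with the closed subspace `V(f₁, …, f_k)` of the open set `D ⊆ ℂⁿ`:
it is a homeomorphism onto `{z ∈ D | f₁ z = ⋯ = f_k z = 0}`, and on stalks it identifies `𝒪_Z` with
`𝒪_D / (f₁, …, f_k)`. -/
structure IsLocalModel {Z : Over specC} {n k : ℕ} (i : Z ⟶ affineOver n)
    (D : Opens (Fin n → ℂ)) (f : Fin k → HolFun n D) : Prop where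
  isEmbedding : Topology.IsEmbedding i.left.base
  range_eq : Set.range i.left.base = {z : Fin n → ℂ | ∃ hz : z ∈ D, ∀ j, f j ⟨z, hz⟩ = 0}
  stalk_surjective : ∀ x : Z.left, Function.Surjective (i.left.stalkMap x)
  stalk_ker : ∀ (x : Z.left) (hx : i.left.base x ∈ (D : Set (Fin n → ℂ))),
    RingHom.ker (i.left.stalkMap x).hom =
      Ideal.span (Set.range fun j => holGerm (f j) (i.left.base x) hx)

/-- The open subspace of `X` on the open set `U`. -/
def restrictOver (X : Over specC) (U : Opens X.left) : Over specC :=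
  Over.mk (X.left.ofRestrict U.isOpenEmbedding ≫ X.hom)

/-- Complex spaces: Hausdorff and locally isomorphic to local models. -/
def IsComplexSpace : ObjectProperty (Over specC) := fun X =>
  T2Space X.left ∧ ∀ x : X.left, ∃ U : Opens X.left, x ∈ U ∧
    ∃ (n k : ℕ) (D : Opens (Fin n → ℂ)) (f : Fin k → HolFun n D)
      (i : restrictOver X U ⟶ affineOver n), IsLocalModel i D f

/-- The category of complex spaces and holomorphic maps. -/
abbrev ComplexSpace : Type 1 := IsComplexSpace.FullSubcategory

namespace ComplexSpace

/-- The underlying locally ringed space. -/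
abbrev lrs (X : ComplexSpace) : LocallyRingedSpace.{0} := X.obj.left

/-- The open subsets of a complex space. -/
abbrev Open (X : ComplexSpace) : Type := Opens X.lrs

/-- The ring `𝒪_X(U)` of holomorphic functions on the open subset `U` of `X`. -/
abbrev Sec (X : ComplexSpace) (U : X.Open) : Type := X.lrs.presheaf.obj (op U)

/-- Restriction of functions to a smaller open subset. -/
def res (X : ComplexSpace) {U V : X.Open} (h : V ≤ U) : X.Sec U →+* X.Sec V :=
  (X.lrs.presheaf.map (homOfLE h).op).hom

/-- The germ of a function at a point. -/
def germ (X : ComplexSpace) {U : X.Open} (x : X.lrs) (hx : x ∈ U) :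
    X.Sec U →+* X.lrs.presheaf.stalk x :=
  (X.lrs.presheaf.germ U x hx).hom

variable {X Y Z : ComplexSpace}

/-- The morphism of locally ringed spaces underlying a morphism of complex spaces. -/
abbrev lrsHom (f : X ⟶ Y) : X.lrs ⟶ Y.lrs := f.hom.left

/-- The preimage of an open subset. -/
abbrev preim (f : X ⟶ Y) (U : Y.Open) : X.Open := (Opens.map (lrsHom f).base).obj U

/-- Pullback of functions along a morphism, `𝒪_Y(U) → 𝒪_X(f⁻¹ U)`. -/
def app (f : X ⟶ Y) (U : Y.Open) : Y.Sec U →+* X.Sec (preim f U) :=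
  ((lrsHom f).c.app (op U)).hom

/-- Pullback of functions followed by restriction, `𝒪_Y(U) → 𝒪_X(V)` for `V ⊆ f⁻¹ U`. -/
def appLE (f : X ⟶ Y) (U : Y.Open) (V : X.Open) (h : V ≤ preim f U) : Y.Sec U →+* X.Sec V :=
  (X.res h).comp (app f U)

/-- Closed embeddings of complex spaces: homeomorphisms onto a closed subset such that the maps on
stalks are surjective. -/
structure IsClosedEmbedding (f : X ⟶ Y) : Prop where
  base : Topology.IsClosedEmbedding (lrsHom f).base
  stalk_surjective : ∀ x : X.lrs, Function.Surjective ((lrsHom f).stalkMap x)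

/-- `ℂⁿ` as a complex space. -/
theorem isComplexSpace_affineOver (n : ℕ) : IsComplexSpace (affineOver n) := by
  refine ⟨inferInstanceAs (T2Space (Fin n → ℂ)), fun x => ⟨⊤, trivial, n, 0, ⊤, Fin.elim0,
    Over.homMk ((affineLRS n).ofRestrict (Opens.isOpenEmbedding ⊤)) rfl, ?_, ?_, ?_, ?_⟩⟩
  · exact (Opens.isOpenEmbedding (⊤ : Opens (affineLRS n))).isEmbedding
  · ext z
    exact ⟨fun _ => ⟨trivial, fun j => j.elim0⟩, fun _ => ⟨⟨z, trivial⟩, rfl⟩⟩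
  · intro y
    have h := LocallyRingedSpace.ofRestrict_stalkMap_isIso (affineLRS n)
      (Opens.isOpenEmbedding (⊤ : Opens (affineLRS n))) y
    exact ((ConcreteCategory.isIso_iff_bijective _).1 h).2
  · intro y hy
    have h := LocallyRingedSpace.ofRestrict_stalkMap_isIso (affineLRS n)
      (Opens.isOpenEmbedding (⊤ : Opens (affineLRS n))) y
    have hi := ((ConcreteCategory.isIso_iff_bijective _).1 h).1
    rw [Set.range_eq_empty, Ideal.span_empty]
    exact (RingHom.injective_iff_ker_eq_bot _).1 hi

end ComplexSpace

/-! ## The one-point space -/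

theorem toStalk_toSpecC (X : LocallyRingedSpace.{0}) (φ : ℂ →+* X.presheaf.obj (op ⊤)) (x : X) :
    StructureSheaf.toStalk ℂ ((toSpecC X φ).base x) ≫ (toSpecC X φ).stalkMap x =
      CommRingCat.ofHom φ ≫ X.presheaf.Γgerm x := by
  have h1 := AlgebraicGeometry.stalkMap_toStalk (CommRingCat.ofHom φ) (X.toΓSpec.base x)
  have h2 := X.toStalk_stalkMap_toΓSpec x
  have h3 := LocallyRingedSpace.stalkMap_comp X.toΓSpec
    (Spec.locallyRingedSpaceMap (CommRingCat.ofHom φ)) x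
  refine (congrArg (fun t => StructureSheaf.toStalk ℂ _ ≫ t) h3).trans ?_
  refine (Category.assoc _ _ _).symm.trans ?_
  refine (congrArg (fun t => t ≫ X.toΓSpec.stalkMap x) h1).trans ?_
  refine (Category.assoc _ _ _).trans ?_
  exact congrArg (fun t => CommRingCat.ofHom φ ≫ t) h2

theorem toStalk_surjective (y : PrimeSpectrum ℂ) :
    Function.Surjective (StructureSheaf.toStalk ℂ y) := by
  let A := (Spec.structureSheaf ℂ).presheaf.stalk y
  suffices h : ∀ z : A, ∃ a : ℂ, algebraMap ℂ A a = z from h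
  intro z
  obtain ⟨⟨a, s⟩, hz⟩ := IsLocalization.surj (M := y.asIdeal.primeCompl) (S := A) z
  have hs0 : (s : ℂ) ≠ 0 := fun h0 => s.2 (by rw [h0]; exact Ideal.zero_mem _)
  have hu : algebraMap ℂ A (s : ℂ) * algebraMap ℂ A (s : ℂ)⁻¹ = 1 := by
    rw [← map_mul, mul_inv_cancel₀ hs0, map_one]
  refine ⟨a * (s : ℂ)⁻¹, ?_⟩
  rw [map_mul]
  dsimp only at hz
  rw [← hz, mul_assoc, hu, mul_one]

theorem affineConst_zero_germ_surjective (x : affineLRS 0) :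
    Function.Surjective (CommRingCat.ofHom (affineConst 0) ≫ (affineLRS 0).presheaf.Γgerm x) := by
  intro z
  obtain ⟨U, hx, f, rfl⟩ := (affineLRS 0).presheaf.exists_germ_eq z
  have hsub : Subsingleton (affineLRS 0).carrier := inferInstanceAs (Subsingleton (Fin 0 → ℂ))
  obtain rfl : U = ⊤ := by
    ext y
    obtain rfl : y = x := hsub.elim _ _
    exact ⟨fun _ => trivial, fun _ => hx⟩
  let F : C^∞⟮𝓘(ℂ, Fin 0 → ℂ), (⊤ : Opens (Fin 0 → ℂ)); 𝓘(ℂ), ℂ⟯ := f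
  refine ⟨F ⟨x, hx⟩, ?_⟩
  refine congrArg ((affineLRS 0).presheaf.germ ⊤ x trivial) ?_
  refine ContMDiffMap.ext
    (f := (affineConst 0 _ : C^∞⟮𝓘(ℂ, Fin 0 → ℂ), (⊤ : Opens (Fin 0 → ℂ)); 𝓘(ℂ), ℂ⟯))
    (g := F) fun y => ?_
  exact congrArg F (Subsingleton.elim _ _)

instance isIso_toSpecC_affine_zero : IsIso (toSpecC (affineLRS 0) (affineConst 0)) := by
  let φ := toSpecC (affineLRS 0) (affineConst 0)
  have hX : Unique (affineLRS 0).carrier := inferInstanceAs (Unique (Fin 0 → ℂ))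
  have hY : Unique specC.carrier := inferInstanceAs (Unique (PrimeSpectrum ℂ))
  have hst : ∀ x : affineLRS 0, IsIso (φ.stalkMap x) := by
    intro x
    have h := toStalk_toSpecC (affineLRS 0) (affineConst 0) x
    have hinj : Function.Injective
        (CommRingCat.ofHom (affineConst 0) ≫ (affineLRS 0).presheaf.Γgerm x).hom :=
      RingHom.injective _
    have hsurj := affineConst_zero_germ_surjective x
    have hs := toStalk_surjective (φ.base x)
    rw [ConcreteCategory.isIso_iff_bijective]
    have hc : ∀ a : ℂ, φ.stalkMap x (StructureSheaf.toStalk ℂ _ a) =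
        (CommRingCat.ofHom (affineConst 0) ≫ (affineLRS 0).presheaf.Γgerm x).hom a :=
      fun a => congrArg (fun t => t.hom a) h
    constructor
    · intro z w hzw
      obtain ⟨a, rfl⟩ := hs z
      obtain ⟨b, rfl⟩ := hs w
      have hzw' := (hc a).symm.trans (hzw.trans (hc b))
      rw [hinj hzw']
    · intro z
      obtain ⟨a, ha⟩ := hsurj z
      exact ⟨_, (hc a).trans ha⟩
  have hopen : Topology.IsOpenEmbedding φ.base := by
    have h := (Homeomorph.homeomorphOfUnique (affineLRS 0).carrier specC.carrier).isOpenEmbedding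
    have he : (φ.base : (affineLRS 0).carrier → specC.carrier) =
      Homeomorph.homeomorphOfUnique (affineLRS 0).carrier specC.carrier :=
        funext fun x => Subsingleton.elim _ _
    exact he ▸ h
  have := LocallyRingedSpace.IsOpenImmersion.of_stalk_iso _ hopen
  have : Epi φ.base := by
    rw [TopCat.epi_iff_surjective]
    intro y
    exact ⟨hX.default, hY.instSubsingleton.elim _ _⟩
  exact LocallyRingedSpace.IsOpenImmersion.to_iso φ

/-- The complex manifold `∗ = ℂ⁰` consisting of a single point. -/
def point : ComplexSpace := ⟨affineOver 0, ComplexSpace.isComplexSpace_affineOver 0⟩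

instance isIso_point_hom : IsIso point.obj.hom := isIso_toSpecC_affine_zero

/-- The constant map `X ⟶ ∗`. -/
def toPoint (X : ComplexSpace) : X ⟶ point :=
  ObjectProperty.homMk (Over.homMk (X.obj.hom ≫ inv point.obj.hom) (by simp))

theorem toPoint_unique {X : ComplexSpace} (f : X ⟶ point) : f = toPoint X := by
  apply ObjectProperty.hom_ext
  apply Over.OverMorphism.ext
  rw [← cancel_mono point.obj.hom]
  exact (Over.w f.hom).trans (Over.w (toPoint X).hom).symm

/-! ## Residual spaces

For a closed subspace `i : W ⟶ X` with ideal sheaf `I`, the residual space is `Proj_X S(I)`, where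
`S(I)` is the symmetric algebra of the `𝒪_X`-module `I`. -/

namespace ComplexSpace

theorem app_res {X Y : ComplexSpace} (f : X ⟶ Y) {U V : Y.Open} (h : V ≤ U) (s : Y.Sec U) :
    app f V (Y.res h s) = X.res ((Opens.map (lrsHom f).base).monotone h) (app f U s) :=
  congrArg (fun t => t.hom s) ((lrsHom f).c.naturality (homOfLE h).op)

end ComplexSpace

open ComplexSpace

variable {W X T R : ComplexSpace}

/-- The ideal `I(U) ⊆ 𝒪_X(U)` of the functions on `U` that vanish on the subspace `i : W ⟶ X`. -/
def idealOf (i : W ⟶ X) (U : X.Open) : Ideal (X.Sec U) := RingHom.ker (app i U)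

/-- Restriction `I(U) → I(V)`. -/
def idealRes (i : W ⟶ X) {U V : X.Open} (h : V ≤ U) (s : idealOf i U) : idealOf i V :=
  ⟨X.res h s, by
    have hs : app i U s = 0 := s.2
    change app i V (X.res h s) = 0
    rw [app_res, hs, map_zero]⟩

/-- Pullback `I'(U) → I(e⁻¹ U)` along a commutative square from `i : W ⟶ X` to `i' : W' ⟶ X'`. -/
def idealPull {W' X' : ComplexSpace} {i : W ⟶ X} {i' : W' ⟶ X'} {e : X ⟶ X'} {w : W ⟶ W'}
    (sq : i ≫ e = w ≫ i') (U : X'.Open) (s : idealOf i' U) : idealOf i (preim e U) :=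
  ⟨app e U s, by
    have hs : app i' U s = 0 := s.2
    have h : ∀ j : W ⟶ X', j = w ≫ i' → app j U s = 0 := by
      rintro _ rfl
      change app w (preim i' U) (app i' U s) = 0
      rw [hs, map_zero]
    exact h (i ≫ e) sq⟩

/-- The symmetric algebra of the `𝒪_X(V)`-module `I(V)`. -/
abbrev SymIdeal (i : W ⟶ X) (V : X.Open) : Type :=
  SymmetricAlgebra (X.Sec V) (idealOf i V)

/-- The element of degree one of the symmetric algebra given by an element of `I(V)`. -/
def symι (i : W ⟶ X) {V : X.Open} (s : idealOf i V) : SymIdeal i V :=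
  SymmetricAlgebra.ι (X.Sec V) (idealOf i V) s

/-- For `g : T ⟶ X` and open sets `U ⊆ X` and `O ⊆ T`, a morphism of sheaves of `𝒪_U`-algebras from
`S(I)|_U` to the direct image of `𝒪_T|_O`.  As the target is a sheaf, it is given on the presheaf
`V ↦ S(I(V))`. -/
structure SymAlgHom (i : W ⟶ X) (g : T ⟶ X) (U : X.Open) (O : T.Open) where
  /-- the components of the morphism -/
  hom (V : X.Open) (hV : V ≤ U) : SymIdeal i V →+* T.Sec (O ⊓ preim g V)
  hom_algebraMap (V : X.Open) (hV : V ≤ U) (a : X.Sec V) :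
    hom V hV (algebraMap _ _ a) = appLE g V (O ⊓ preim g V) inf_le_right a
  hom_res (V V' : X.Open) (hV : V ≤ U) (h : V' ≤ V) (x : idealOf i V) :
    hom V' (h.trans hV) (symι i (idealRes i h x)) =
      T.res (inf_le_inf_left O ((Opens.map (lrsHom g).base).monotone h)) (hom V hV (symι i x))

/-- The structure on `r : R ⟶ X` of a residual space of `X` along `i : W ⟶ X`, that is, of the
relative homogeneous spectrum `Proj_X S(I)`.

As for any algebra generated in degree one, `Proj` is glued from the pieces `D₊(s)`, for the local
sections `s` of `I`.  Over the domain `U` of `s`, the piece `D₊(s)` is the analytic spectrum of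
`S(I)[s⁻¹]₀ = S(I) / (s - 1)`; that is, it carries a universal algebra homomorphism
`S(I)|_U / (s - 1) → 𝒪`, which we write as `x ↦ x / s`.  The piece `D₊(t)` meets `D₊(s)` in the
locus where `t / s` is invertible, and there `x / t = (x / s) / (t / s)`. -/
structure ResidualSpace (i : W ⟶ X) (r : R ⟶ X) where
  /-- the open piece `D₊(s)` of `R` -/
  D (U : X.Open) (s : idealOf i U) : R.Open
  D_le (U : X.Open) (s : idealOf i U) : D U s ≤ preim r U
  /-- the homomorphism `x ↦ x / s` on `D₊(s)` -/
  coord (U : X.Open) (s : idealOf i U) : SymAlgHom i r U (D U s)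
  coord_self (U : X.Open) (s : idealOf i U) : (coord U s).hom U le_rfl (symι i s) = 1
  /-- `D₊(s)` is the analytic spectrum of `S(I)|_U / (s - 1)` over `U` -/
  universal (U : X.Open) (s : idealOf i U) (T : ComplexSpace) (g : T ⟶ X) (_ : ⊤ ≤ preim g U)
    (α : SymAlgHom i g U ⊤) (_ : α.hom U le_rfl (symι i s) = 1) :
    ∃! h : T ⟶ R, ∃ (hr : h ≫ r = g) (hD : ⊤ ≤ preim h (D U s)),
      ∀ (V : X.Open) (hV : V ≤ U) (x : SymIdeal i V),
        α.hom V hV x = appLE h (D U s ⊓ preim r V) (⊤ ⊓ preim g V)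
          (by subst hr; exact inf_le_inf_right _ hD) ((coord U s).hom V hV x)
  cover (y : R.lrs) : ∃ (U : X.Open) (s : idealOf i U), y ∈ D U s
  mem_D_iff (U V : X.Open) (s : idealOf i U) (t : idealOf i V) (y : R.lrs) (hy : y ∈ D U s)
    (hyV : y ∈ preim r V) :
    y ∈ D V t ↔ IsUnit (R.germ y (U := D U s ⊓ preim r (U ⊓ V)) ⟨hy, D_le U s hy, hyV⟩
      ((coord U s).hom (U ⊓ V) inf_le_left (symι i (idealRes i inf_le_right t))))
  coord_mul (U V V' : X.Open) (s : idealOf i U) (t : idealOf i V) (hU : V' ≤ U) (hV : V' ≤ V)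
    (x : idealOf i V') :
    R.res (V := (D U s ⊓ D V t) ⊓ preim r V') (inf_le_inf_right _ inf_le_right)
        ((coord V t).hom V' hV (symι i x)) *
      R.res (V := (D U s ⊓ D V t) ⊓ preim r V') (inf_le_inf_right _ inf_le_left)
        ((coord U s).hom V' hU (symι i (idealRes i hV t))) =
      R.res (V := (D U s ⊓ D V t) ⊓ preim r V') (inf_le_inf_right _ inf_le_left)
        ((coord U s).hom V' hU (symι i x))

/-- The canonical morphism `Proj_X S(I) ⟶ Proj_X' S(I')` over `e : X ⟶ X'`, for a commutative square
from `i : W ⟶ X` to `i' : W' ⟶ X'`: the morphism `h` induced by the graded homomorphism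
`S(I') → S(I)` that extends the pullback of functions `e^* : I' → I`.  It satisfies
`h⁻¹ D₊(s) = D₊(e^* s)`, and `h^* (x / s) = e^* x / e^* s`. -/
structure IsResidualMap {W' X' R' : ComplexSpace} {i : W ⟶ X} {i' : W' ⟶ X'} {r : R ⟶ X}
    {r' : R' ⟶ X'} (S : ResidualSpace i r) (S' : ResidualSpace i' r') {e : X ⟶ X'} {w : W ⟶ W'}
    (sq : i ≫ e = w ≫ i') (h : R ⟶ R') : Prop where
  comm : h ≫ r' = r ≫ e
  preim_D (U : X'.Open) (s : idealOf i' U) :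
    preim h (S'.D U s) = S.D (preim e U) (idealPull sq U s)
  coord (U V : X'.Open) (hV : V ≤ U) (s : idealOf i' U) (x : idealOf i' V) :
    appLE h (S'.D U s ⊓ preim r' V)
        (S.D (preim e U) (idealPull sq U s) ⊓ preim r (preim e V))
        (by
          rw [← preim_D]
          have hc : preim (h ≫ r') V = preim (r ≫ e) V := by rw [comm]
          exact inf_le_inf_left _ (le_of_eq hc.symm))
        ((S'.coord U s).hom V hV (symι i' x)) =
      (S.coord (preim e U) (idealPull sq U s)).hom (preim e V)
        ((Opens.map (lrsHom e).base).monotone hV) (symι i (idealPull sq V x))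

/-! ## Iterated multiple point spaces -/

/-- The sequence `K₀ = Y`, `K₁ = X`, `K_{r + 2} = H_r`. -/
def level (X Y : ComplexSpace) (H : ℕ → ComplexSpace) : ℕ → ComplexSpace
  | 0 => Y
  | 1 => X
  | r + 2 => H r

/-- The iterated multiple point spaces of `f : X ⟶ Y`: the spaces `K₀ = Y`, `K₁ = X` and
`K_{r + 2} = Res_{Δ K_{r + 1}} (K_{r + 1} ×_{K_r} K_{r + 1})`, with the maps `K_{r + 1} ⟶ K_r`.
The fibred products and the residual spaces, which are only determined up to canonical isomorphism,
are part of the data. -/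
structure MultiplePoints {X Y : ComplexSpace} (f : X ⟶ Y) where
  /-- the spaces `K₂, K₃, …` -/
  higher : ℕ → ComplexSpace
  /-- the maps `K_{r + 1} ⟶ K_r` -/
  π (r : ℕ) : level X Y higher (r + 1) ⟶ level X Y higher r
  π_zero : π 0 = f
  /-- the fibred products `K_{r + 1} ×_{K_r} K_{r + 1}` -/
  fib : ℕ → ComplexSpace
  /-- the first projection -/
  p₁ (r : ℕ) : fib r ⟶ level X Y higher (r + 1)
  /-- the second projection -/
  p₂ (r : ℕ) : fib r ⟶ level X Y higher (r + 1)
  isPullback (r : ℕ) : IsPullback (p₁ r) (p₂ r) (π r) (π r)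
  /-- the structure map `K_{r + 2} ⟶ K_{r + 1} ×_{K_r} K_{r + 1}` -/
  q (r : ℕ) : higher r ⟶ fib r
  /-- `K_{r + 2}` is the residual space along the diagonal -/
  residual (r : ℕ) : ResidualSpace ((isPullback r).lift (𝟙 _) (𝟙 _) rfl) (q r)
  π_succ (r : ℕ) : π (r + 1) = q r ≫ p₁ r

namespace MultiplePoints

variable {X Y X' Y' : ComplexSpace} {f : X ⟶ Y} {f' : X' ⟶ Y'}

/-- The space `K_r(f)`. -/
abbrev K (M : MultiplePoints f) (r : ℕ) : ComplexSpace := level X Y M.higher r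

/-- The diagonal `K_{r + 1} ⟶ K_{r + 1} ×_{K_r} K_{r + 1}`. -/
def diag (M : MultiplePoints f) (r : ℕ) : M.K (r + 1) ⟶ M.fib r :=
  (M.isPullback r).lift (𝟙 _) (𝟙 _) rfl

/-- The morphism between the fibred products induced by morphisms between the factors. -/
def fibMap (M : MultiplePoints f) (M' : MultiplePoints f') (κ : ∀ r, M.K r ⟶ M'.K r)
    (comm : ∀ r, κ (r + 1) ≫ M'.π r = M.π r ≫ κ r) (r : ℕ) : M.fib r ⟶ M'.fib r :=
  (M'.isPullback r).lift (M.p₁ r ≫ κ (r + 1)) (M.p₂ r ≫ κ (r + 1)) (by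
    rw [Category.assoc, Category.assoc, comm r]
    exact (M.isPullback r).w_assoc _)

theorem diag_fibMap (M : MultiplePoints f) (M' : MultiplePoints f') (κ : ∀ r, M.K r ⟶ M'.K r)
    (comm : ∀ r, κ (r + 1) ≫ M'.π r = M.π r ≫ κ r) (r : ℕ) :
    M.diag r ≫ fibMap M M' κ comm r = κ (r + 1) ≫ M'.diag r := by
  apply (M'.isPullback r).hom_ext
  · simp [diag, fibMap]
  · simp [diag, fibMap]

/-- The sequence of canonical morphisms `κ_r : K_r(f) ⟶ K_r(f')` extending a commutative square
from `f : X ⟶ Y` to `f' : X' ⟶ Y'` with vertical maps `e : X ⟶ X'` and `g : Y ⟶ Y'`. -/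
structure IsCanonical (M : MultiplePoints f) (M' : MultiplePoints f') (e : X ⟶ X') (g : Y ⟶ Y')
    (κ : ∀ r, M.K r ⟶ M'.K r) : Prop where
  zero : κ 0 = g
  one : κ 1 = e
  comm (r : ℕ) : κ (r + 1) ≫ M'.π r = M.π r ≫ κ r
  residual (r : ℕ) : IsResidualMap (M.residual r) (M'.residual r)
    (diag_fibMap M M' κ comm r) (κ (r + 2))

end MultiplePoints

end

end IteratedMultiplePoints

open IteratedMultiplePoints

/-!
The proof reduces every assertion to maps from *fat points*, the one-point complex spaces whose ring
is an Artinian local quotient of a ring of germs of holomorphic functions.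

Stalks of complex spaces are Noetherian by Weierstrass division (`weierstrass_division`), so by
Krull's intersection theorem a germ vanishes if it vanishes in all fat quotients of the stalk. It
follows that fat points detect equality of holomorphic maps (`hom_ext_of_fat`), and that a map `h`
factors through a closed embedding as soon as its restrictions to fat points do
(`exists_lift_of_fat`). They also detect closed embeddings: it suffices that `h` is injective on fat
points (`FatMono`) and that every fat point annihilating the functions that `h` pulls back to zero
factors through `h` (`FatLift`); see `isClosedEmbedding_of_fat`. Injectivity on the fat points whose
maximal ideal has square zero and the inverse function theorem make `h` surjective on stalks. The
lifting property identifies the image, and it forces `h` to be a topological embedding because the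
coordinates of a chart of the source extend to the target. Coherence of the structure sheaf is not
needed.

A residual space is handled through its fat points as well. Over a point `x` of the base and a
homomorphism `φ` from the stalk at `x` to `A`, they are the `φ`-semilinear forms on the stalk of the
ideal sheaf that take a unit as value, up to multiplication by units of `A`
(`ResidualSpace.exists_rep`, `ResidualSpace.exists_hom_of_form`, `ResidualSpace.Rep.hom_ext`). The
morphism induced by a pullback of functions `I' → I` composes forms with that pullback
(`ResidualSpace.Rep.comp`). If `I' → I` is surjective on stalks, a unit value stays a unit value:
the induced morphism then exists, is unique, and is a closed embedding when the morphism of the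
bases is one.

For the diagonals of `K ×_L K` the surjectivity is automatic. A diagonal `i` is a retract with
retraction `p`, the first projection, so `a ↦ a - p^* i^* a` projects the functions onto the ideal,
compatibly with closed embeddings (`exists_projection`, `idealPullStalk_surjective`). The fibred
products embed into each other even when the map of bases `L → L'` is no embedding, as happens over
a point: functions on `L`, pulled back to `K`, extend locally to `K'`, so the relation over `L` can
be read off from functions on `K' ×_{L'} K'` (`Kills.comp_eq_comp`).

For the cartesian square, a compatible pair of fat points of `K'_r` and `B_r` gives, by induction, a
fat point of the fibred product below `K_r`, together with two forms that agree, up to a unit, on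
the ideal `J` of the diagonal belonging to `B'_r`. By Krull's theorem again, the functions on the
fibred product below `B'_r` whose restriction vanishes below `K_r` are the sum of those vanishing
below `K'_r` and those vanishing below `B_r`; the projection above shows the same for their
intersections with `J`. Both summands are annihilated by the common form, so it descends to the
ideal of the diagonal belonging to `K_r` (`exists_lift_of_cartesian`).
-/

namespace IteratedMultiplePoints

noncomputable section

open Filter Topology Metric Set

section

/-! ### Smooth families of functions on a compact set -/

/-- The function `z ↦ f (z, ·)` with values in the Banach space `C(K, F)`; it takes the value `0`
where `f (z, ·)` is not continuous on `K`. -/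
def curryC {E F : Type} [NormedAddCommGroup F] (K : Set ℂ) (f : E × ℂ → F) (z : E) : C(K, F) :=
  open Classical in
  if h : Continuous fun w : K => f (z, w) then ⟨_, h⟩ else 0

/-- Evaluation of an operator-valued function on a vector, as a bounded operator. -/
def evalOp (E F : Type) [NormedAddCommGroup E] [NormedSpace ℂ E] [NormedAddCommGroup F]
    [NormedSpace ℂ F] (K : Set ℂ) [CompactSpace K] :
    C(K, E →L[ℂ] F) →L[ℂ] E →L[ℂ] C(K, F) :=
  LinearMap.mkContinuous₂ (LinearMap.mk₂ ℂ
      (fun (u : C(K, E →L[ℂ] F)) (e : E) =>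
        (⟨fun w => u w e, (map_continuous u).clm_apply continuous_const⟩ : C(K, F)))
      (fun _ _ _ => by ext; simp) (fun _ _ _ => by ext; simp) (fun _ _ _ => by ext; simp)
      (fun _ _ _ => by ext; simp)) 1 (fun u e => by
    rw [ContinuousMap.norm_le _ (by positivity)]
    intro w
    simpa using ((u w).le_opNorm e).trans
      (mul_le_mul_of_nonneg_right (u.norm_coe_le_norm w) (norm_nonneg e)))

theorem curryC_apply {E F : Type} [NormedAddCommGroup E] [NormedAddCommGroup F] {K : Set ℂ}
    {f : E × ℂ → F} {U : Set (E × ℂ)} (hf : ContinuousOn f U) {z : E}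
    (hz : ∀ w ∈ K, (z, w) ∈ U) (w : K) : curryC K f z w = f (z, w) := by
  have h : Continuous fun w : K => f (z, w) :=
    hf.comp_continuous (by fun_prop) fun w => hz w w.2
  simp [curryC, h]

section

variable {E F : Type} [NormedAddCommGroup E] [NormedSpace ℂ E] [NormedAddCommGroup F]
  [NormedSpace ℂ F] {K : Set ℂ}

/-- The derivative of `z ↦ f (z, ·)` is obtained by currying the partial derivative of `f`. As `K`
is compact, the partial derivative is continuous uniformly on `K`, so that the mean value inequality
bounds the remainder. -/
theorem hasFDerivAt_curryC [CompactSpace K] {f : E × ℂ → F} {U : Set (E × ℂ)} (hU : IsOpen U)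
    (hf : ContDiffOn ℂ 1 f U) {z : E} (hz : ∀ w ∈ K, (z, w) ∈ U) :
    HasFDerivAt (curryC K f)
      (evalOp E F K (curryC K (fun p => (fderiv ℂ f p).comp (.inl ℂ E ℂ)) z)) z := by
  have hK : IsCompact K := isCompact_iff_compactSpace.2 inferInstance
  have hcd : ContinuousOn (fun p => (fderiv ℂ f p).comp (.inl ℂ E ℂ)) U :=
    (hf.continuousOn_fderiv_of_isOpen hU le_rfl).clm_comp continuousOn_const
  rw [hasFDerivAt_iff_isLittleO_nhds_zero, Asymptotics.isLittleO_iff]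
  intro c hc
  have h1 : ∀ w ∈ K, ∀ᶠ q : E × ℂ in 𝓝 (z, w), q ∈ U ∧
      ‖(fderiv ℂ f q).comp (.inl ℂ E ℂ) - (fderiv ℂ f (z, q.2)).comp (.inl ℂ E ℂ)‖ < c := by
    intro w hw
    have hmem : U ∈ 𝓝 (z, w) := hU.mem_nhds (hz w hw)
    refine (eventually_mem_set.2 hmem).and ?_
    have h2 : ContinuousAt (fun p => (fderiv ℂ f p).comp (.inl ℂ E ℂ)) (z, w) :=
      hcd.continuousAt hmem
    have h3 : ContinuousAt (fun q : E × ℂ => (fderiv ℂ f (z, q.2)).comp (.inl ℂ E ℂ)) (z, w) :=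
      ContinuousAt.comp (f := fun q : E × ℂ => (z, q.2)) (x := (z, w)) h2 (by fun_prop)
    have h4 := (h2.sub h3).norm
    refine h4.eventually (gt_mem_nhds ?_)
    simpa using hc
  obtain ⟨δ, hδ, hball⟩ := Metric.eventually_nhds_iff_ball.1
    (hK.eventually_forall_of_forall_eventually (x₀ := z)
      (P := fun x w => (x, w) ∈ U ∧ ‖(fderiv ℂ f (x, w)).comp (.inl ℂ E ℂ) -
        (fderiv ℂ f (z, w)).comp (.inl ℂ E ℂ)‖ < c) h1)
  have hz' : ∀ h ∈ ball (0 : E) δ, z + h ∈ ball z δ := by simp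
  filter_upwards [ball_mem_nhds (0 : E) hδ] with h hh
  rw [ContinuousMap.norm_le _ (by positivity)]
  intro w
  have hin : ∀ x ∈ ball z δ, HasFDerivWithinAt (fun x => f (x, (w : ℂ)))
      ((fderiv ℂ f (x, (w : ℂ))).comp (.inl ℂ E ℂ)) (ball z δ) x := by
    intro x hx
    have hmem : U ∈ 𝓝 (x, (w : ℂ)) := hU.mem_nhds (hball x hx w w.2).1
    have h5 := ((hf.contDiffAt hmem).differentiableAt (by simp)).hasFDerivAt
    exact (h5.comp x (hasFDerivAt_prodMk_left x (w : ℂ))).hasFDerivWithinAt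
  have h6 := (convex_ball z δ).norm_image_sub_le_of_norm_hasFDerivWithin_le' (𝕜 := ℂ)
    (φ := (fderiv ℂ f (z, (w : ℂ))).comp (.inl ℂ E ℂ)) (C := c) hin
    (fun x hx => ((hball x hx w w.2).2).le) (mem_ball_self hδ) (hz' h hh)
  rw [add_sub_cancel_left] at h6
  have h7 := curryC_apply (K := K) hf.continuousOn (z := z + h)
    (fun w hw => (hball _ (hz' h hh) w hw).1) w
  have h8 := curryC_apply (K := K) hf.continuousOn hz w
  have h9 := curryC_apply (K := K) hcd hz w
  simp only [ContinuousMap.sub_apply, h7, h8]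
  have h10 : (evalOp E F K (curryC K (fun p => (fderiv ℂ f p).comp (.inl ℂ E ℂ)) z)) h w =
      (fderiv ℂ f (z, (w : ℂ))).comp (.inl ℂ E ℂ) h := by
    rw [← h9]; rfl
  rw [h10]
  exact h6

end

/-- Currying preserves smoothness: if `f` is smooth near `W × K` with `K` compact, then
`z ↦ f (z, ·)` is a smooth function on `W` with values in the Banach space `C(K, F)`. -/
theorem contDiffOn_curryC {E : Type} [NormedAddCommGroup E] [NormedSpace ℂ E] {K : Set ℂ}
    [CompactSpace K] {F : Type} [NormedAddCommGroup F] [NormedSpace ℂ F] {f : E × ℂ → F}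
    {U : Set (E × ℂ)} (hU : IsOpen U) (hf : ContDiffOn ℂ ∞ f U) {W : Set E} (hW : IsOpen W)
    (hz : ∀ z ∈ W, ∀ w ∈ K, (z, w) ∈ U) : ContDiffOn ℂ ∞ (curryC K f) W := by
  rw [contDiffOn_infty]
  intro n
  induction n generalizing F with
  | zero =>
    refine contDiffOn_zero.2 fun z h => ?_
    exact (hasFDerivAt_curryC hU (hf.of_le (by simp)) (hz z h)).continuousAt.continuousWithinAt
  | succ n ih =>
    have hD : ∀ z ∈ W, HasFDerivAt (curryC K f)
        (evalOp E F K (curryC K (fun p => (fderiv ℂ f p).comp (.inl ℂ E ℂ)) z)) z := fun z h =>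
      hasFDerivAt_curryC hU (hf.of_le (by simp)) (hz z h)
    push_cast
    rw [contDiffOn_succ_iff_fderiv_of_isOpen hW]
    refine ⟨fun z h => (hD z h).differentiableAt.differentiableWithinAt, by simp, ?_⟩
    have h1 : ContDiffOn ℂ ∞ (fun p => (fderiv ℂ f p).comp (.inl ℂ E ℂ)) U :=
      (hf.fderiv_of_isOpen hU (by simp)).clm_comp contDiffOn_const
    refine ((evalOp E F K).contDiff.comp_contDiffOn (ih h1)).congr fun z h => ?_
    exact (hD z h).fderiv

end

section

/-! ### The disc algebra -/

/-- Smoothness of a map into a complete space may be tested after a linear isometric embedding. -/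
theorem contDiffOn_of_isometry_comp {E : Type} [NormedAddCommGroup E] [NormedSpace ℂ E]
    {W : Set E} (hW : IsOpen W) {V X : Type} [NormedAddCommGroup V] [NormedSpace ℂ V]
    [CompleteSpace V] [NormedAddCommGroup X] [NormedSpace ℂ X] (i : V →ₗᵢ[ℂ] X) {f : E → V}
    (hf : ContDiffOn ℂ ∞ (fun z => i (f z)) W) : ContDiffOn ℂ ∞ f W := by
  rw [contDiffOn_infty]
  intro n
  induction n generalizing V X with
  | zero =>
    refine contDiffOn_zero.2 ?_
    exact i.isometry.isUniformInducing.isInducing.continuousOn_iff.2 hf.continuousOn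
  | succ n ih =>
    -- the derivative of `i ∘ f` is a limit of difference quotients in the closed range of `i`
    have hcl : IsClosed (LinearMap.range i.toLinearMap : Set X) := by
      rw [LinearMap.coe_range]
      exact i.isometry.isClosedEmbedding.isClosed_range
    have hd : ∀ z ∈ W, HasFDerivAt f (fderiv ℂ f z) z ∧
        i.toContinuousLinearMap.comp (fderiv ℂ f z) = fderiv ℂ (fun z => i (f z)) z := by
      intro z hz
      have h1 : HasFDerivAt (fun z => i (f z)) (fderiv ℂ (fun z => i (f z)) z) z :=
        ((hf.contDiffAt (hW.mem_nhds hz)).differentiableAt (by simp)).hasFDerivAt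
      have h2 : ∀ e, fderiv ℂ (fun z => i (f z)) z e ∈ LinearMap.range i.toLinearMap := by
        intro e
        have h3 := h1.lim (c := fun n : ℕ => (n : ℂ)) (l := atTop) e (by
          simpa using tendsto_natCast_atTop_atTop)
        refine hcl.mem_of_tendsto h3 (Eventually.of_forall fun n => ?_)
        exact ⟨(n : ℂ) • (f (z + (n : ℂ)⁻¹ • e) - f z), by simp⟩
      let D : E →L[ℂ] V := (i.equivRange.symm.toContinuousLinearEquiv : _ →L[ℂ] V).comp
        ((fderiv ℂ (fun z => i (f z)) z).codRestrict _ h2)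
      have hiD : ∀ e, i (D e) = fderiv ℂ (fun z => i (f z)) z e := fun e => by
        have := congrArg Subtype.val (i.equivRange.apply_symm_apply
          ((fderiv ℂ (fun z => i (f z)) z).codRestrict _ h2 e))
        exact this
      have hD : HasFDerivAt f D z := by
        rw [hasFDerivAt_iff_isLittleO_nhds_zero, ← Asymptotics.isLittleO_norm_left] at h1 ⊢
        refine h1.congr_left fun h => ?_
        rw [← i.norm_map, map_sub, map_sub, hiD]
      rw [hD.fderiv]
      exact ⟨hD, ContinuousLinearMap.ext hiD⟩
    push_cast
    rw [contDiffOn_succ_iff_fderiv_of_isOpen hW]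
    refine ⟨fun z h => (hd z h).1.differentiableAt.differentiableWithinAt, by simp, ?_⟩
    let j : (E →L[ℂ] V) →ₗᵢ[ℂ] (E →L[ℂ] X) :=
      { toLinearMap := (ContinuousLinearMap.compL ℂ E V X i.toContinuousLinearMap).toLinearMap
        norm_map' := fun D => i.norm_toContinuousLinearMap_comp }
    refine ih j ((hf.fderiv_of_isOpen hW (by simp)).congr fun z h => (hd z h).2)

/-- The Cauchy integral `(2πi)⁻¹ ∮ u(ζ) dζ` of a continuous function on the circle. -/
def cauchyForm (ρ : ℝ) : C(sphere (0 : ℂ) ρ, ℂ) →L[ℂ] ℂ :=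
  open Classical in
  haveI hc : ∀ u : C(sphere (0 : ℂ) ρ, ℂ), ContinuousOn
      (fun ζ => if h : ζ ∈ sphere (0 : ℂ) ρ then u ⟨ζ, h⟩ else 0) (sphere (0 : ℂ) ρ) := fun u => by
    rw [continuousOn_iff_continuous_domRestrict]
    convert map_continuous u using 1
    ext ζ
    simp
  if hρ : 0 ≤ ρ then
    LinearMap.mkContinuous
      { toFun := fun u => (2 * Real.pi * Complex.I : ℂ)⁻¹ •
          ∮ ζ in C(0, ρ), if h : ζ ∈ sphere (0 : ℂ) ρ then u ⟨ζ, h⟩ else 0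
        map_add' := fun u v => by
          rw [← smul_add, ← circleIntegral.integral_add
            ((hc u).circleIntegrable hρ) ((hc v).circleIntegrable hρ)]
          congr 1
          refine circleIntegral.integral_congr (E := ℂ) hρ fun ζ hζ => ?_
          simp only [hζ, dif_pos, ContinuousMap.add_apply]
        map_smul' := fun c u => by
          rw [RingHom.id_apply, smul_comm c, ← circleIntegral.integral_smul c]
          congr 1
          refine circleIntegral.integral_congr (E := ℂ) hρ fun ζ hζ => ?_
          simp only [hζ, dif_pos, ContinuousMap.smul_apply] } ρ (fun u => by
        refine circleIntegral.norm_two_pi_i_inv_smul_integral_le_of_norm_le_const hρ fun ζ hζ => ?_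
        simp only [hζ, dif_pos]
        exact u.norm_coe_le_norm _)
  else 0

theorem cauchyForm_apply {ρ : ℝ} (hρ : 0 ≤ ρ) (u : C(sphere (0 : ℂ) ρ, ℂ)) (g : ℂ → ℂ)
    (hg : ∀ ζ : sphere (0 : ℂ) ρ, u ζ = g ζ) :
    cauchyForm ρ u = (2 * Real.pi * Complex.I : ℂ)⁻¹ • ∮ ζ in C(0, ρ), g ζ := by
  rw [cauchyForm, dif_pos hρ]
  change (2 * Real.pi * Complex.I : ℂ)⁻¹ • (_ : ℂ) = _
  refine congrArg _ (circleIntegral.integral_congr (E := ℂ) hρ fun ζ hζ => ?_)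
  simp only [hζ, dif_pos]
  exact hg ⟨ζ, hζ⟩

/-- The restriction of a function on the closed disc to the circle. -/
def toCircle (ρ : ℝ) : C(closedBall (0 : ℂ) ρ, ℂ) →L[ℂ] C(sphere (0 : ℂ) ρ, ℂ) :=
  let i : C(sphere (0 : ℂ) ρ, closedBall (0 : ℂ) ρ) :=
    ⟨Set.inclusion sphere_subset_closedBall, continuous_inclusion _⟩
  { toFun := fun u => u.comp i
    map_add' := fun _ _ => rfl
    map_smul' := fun _ _ => rfl
    cont := ContinuousMap.continuous_precomp i }

/-- The Cauchy integral `(2πi)⁻¹ ∮ v(ζ) / (ζ - w) dζ` of a continuous function on the closed disc,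
for `w` in the open disc. -/
def cauchyVal {ρ : ℝ} (v : C(closedBall (0 : ℂ) ρ, ℂ)) (w : ℂ) : ℂ :=
  cauchyForm ρ (toCircle ρ v *
    curryC (sphere (0 : ℂ) ρ) (fun p : ℂ × ℂ => (p.2 - p.1)⁻¹) w)

theorem contDiffOn_kernel (ρ : ℝ) : ContDiffOn ℂ ∞
    (curryC (sphere (0 : ℂ) ρ) (fun p : ℂ × ℂ => (p.2 - p.1)⁻¹)) (ball 0 ρ) := by
  refine contDiffOn_curryC (U := {p : ℂ × ℂ | p.2 - p.1 ≠ 0})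
    (isOpen_ne_fun (by fun_prop) (by fun_prop)) ?_ isOpen_ball ?_
  · exact (contDiff_snd.sub contDiff_fst).contDiffOn.inv fun p hp => hp
  · intro z hz w hw h
    simp only [mem_ball, dist_zero_right, mem_sphere] at hz hw
    have h' : w = z := sub_eq_zero.1 h
    rw [h'] at hw
    linarith

/-- The Cauchy integral depends smoothly on the function and on the point together. -/
theorem contDiffOn_cauchyVal {ρ : ℝ} {E : Type} [NormedAddCommGroup E] [NormedSpace ℂ E]
    {W : Set E} {q : E → C(closedBall (0 : ℂ) ρ, ℂ)} (hq : ContDiffOn ℂ ∞ q W) :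
    ContDiffOn ℂ ∞ (fun p : E × ℂ => cauchyVal (q p.1) p.2) (W ×ˢ ball (0 : ℂ) ρ) := by
  refine (cauchyForm ρ).contDiff.comp_contDiffOn (ContDiffOn.mul ?_ ?_)
  · exact (toCircle ρ).contDiff.comp_contDiffOn
      (hq.comp contDiff_fst.contDiffOn fun p hp => hp.1)
  · exact (contDiffOn_kernel ρ).comp contDiff_snd.contDiffOn fun p hp => hp.2

theorem cauchyVal_eq {ρ : ℝ} (hρ : 0 ≤ ρ) (v : C(closedBall (0 : ℂ) ρ, ℂ)) (g : ℂ → ℂ)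
    (hg : DiffContOnCl ℂ g (ball 0 ρ)) (hv : ∀ w, v w = g w) {w : ℂ} (hw : w ∈ ball (0 : ℂ) ρ) :
    cauchyVal v w = g w := by
  rw [← hg.two_pi_i_inv_smul_circleIntegral_sub_inv_smul hw, cauchyVal]
  refine cauchyForm_apply hρ _ (fun ζ => (ζ - w)⁻¹ • g ζ) fun ζ => ?_
  have h1 : curryC (sphere (0 : ℂ) ρ) (fun p : ℂ × ℂ => (p.2 - p.1)⁻¹) w ζ = (ζ - w : ℂ)⁻¹ := by
    refine curryC_apply (U := {p : ℂ × ℂ | p.2 - p.1 ≠ 0}) ?_ (fun ζ hζ h => ?_) ζ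
    · exact (continuous_snd.sub continuous_fst).continuousOn.inv₀ fun p hp => hp
    · simp only [mem_ball, dist_zero_right, mem_sphere] at hw hζ
      have h' : ζ = w := sub_eq_zero.1 h
      rw [h'] at hζ
      linarith
  rw [ContinuousMap.mul_apply, h1, mul_comm, smul_eq_mul]
  exact congrArg _ (hv _)

/-- The Banach space of continuous functions on the closed disc that are holomorphic in the open
disc.  It is closed under multiplication. -/
def discAlg (ρ : ℝ) : Submodule ℂ C(closedBall (0 : ℂ) ρ, ℂ) where
  carrier := {v | ∃ g : ℂ → ℂ, DiffContOnCl ℂ g (ball 0 ρ) ∧ ∀ w, v w = g w}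
  add_mem' := by
    rintro a b ⟨g, hg, ha⟩ ⟨h, hh, hb⟩
    exact ⟨g + h, hg.add hh, fun w => by simp [ha, hb]⟩
  zero_mem' := ⟨fun _ => 0, diffContOnCl_const, fun w => by simp⟩
  smul_mem' := by
    rintro c a ⟨g, hg, ha⟩
    exact ⟨c • g, hg.const_smul c, fun w => by simp [ha]⟩

theorem mul_mem_discAlg {ρ : ℝ} {a b : C(closedBall (0 : ℂ) ρ, ℂ)} (ha : a ∈ discAlg ρ)
    (hb : b ∈ discAlg ρ) : a * b ∈ discAlg ρ := by
  obtain ⟨g, hg, ha⟩ := ha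
  obtain ⟨h, hh, hb⟩ := hb
  exact ⟨g • h, hg.smul hh, fun w => by simp [ha, hb]⟩

/-- The disc algebra is closed, because its elements are the functions that satisfy the Cauchy
integral formula in the open disc. -/
theorem isClosed_discAlg {ρ : ℝ} (hρ : 0 < ρ) :
    IsClosed (discAlg ρ : Set C(closedBall (0 : ℂ) ρ, ℂ)) := by
  have h1 : (discAlg ρ : Set C(closedBall (0 : ℂ) ρ, ℂ)) =
      {v | ∀ w : closedBall (0 : ℂ) ρ, (w : ℂ) ∈ ball (0 : ℂ) ρ → cauchyVal v w = v w} := by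
    ext v
    constructor
    · rintro ⟨g, hg, hv⟩ w hw
      rw [cauchyVal_eq hρ.le v g hg hv hw, hv]
    · intro h
      classical
      refine ⟨fun w => if hw : w ∈ closedBall (0 : ℂ) ρ then v ⟨w, hw⟩ else 0, ⟨?_, ?_⟩,
        fun w => by simp⟩
      · have h2 := contDiffOn_cauchyVal (ρ := ρ) (E := ℂ) (W := Set.univ) (q := fun _ => v)
          contDiffOn_const
        have h3 : DifferentiableOn ℂ (fun w => cauchyVal v w) (ball 0 ρ) :=
          (h2.comp (f := fun w : ℂ => ((0 : ℂ), w)) (by fun_prop) fun w hw =>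
            ⟨trivial, hw⟩).differentiableOn (by simp)
        refine h3.congr fun w hw => ?_
        have hw' := ball_subset_closedBall hw
        simp only [hw', dif_pos]
        exact (h ⟨w, hw'⟩ hw).symm
      · rw [closure_ball _ hρ.ne', continuousOn_iff_continuous_domRestrict]
        convert map_continuous v using 1
        ext w
        exact dif_pos w.2
  rw [h1, Set.ofPred_forall]
  refine isClosed_iInter fun w => ?_
  by_cases hw : (w : ℂ) ∈ ball (0 : ℂ) ρ
  · simp only [hw, true_imp_iff]
    refine isClosed_eq ?_ (by fun_prop)
    unfold cauchyVal
    fun_prop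
  · simp [hw]

/-- The Taylor expansion of order `b` at `0`; the quotient is an iterated difference quotient. -/
theorem exists_dslope_decomposition {ρ : ℝ} (hρ : 0 < ρ) (b : ℕ) (g : ℂ → ℂ)
    (hg : DiffContOnCl ℂ g (ball 0 ρ)) : ∃ (q : ℂ → ℂ) (r : Fin b → ℂ),
      DiffContOnCl ℂ q (ball 0 ρ) ∧ ∀ w, g w = q w * w ^ b + ∑ i, r i * w ^ (i : ℕ) := by
  induction b generalizing g with
  | zero => exact ⟨g, Fin.elim0, hg, fun w => by simp⟩
  | succ b ih =>
    obtain ⟨q, r, hq, h⟩ := ih g hg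
    have h0 : ball (0 : ℂ) ρ ∈ 𝓝 0 := ball_mem_nhds _ hρ
    refine ⟨dslope q 0, Fin.snoc r (q 0), ⟨?_, ?_⟩, fun w => ?_⟩
    · exact (Complex.differentiableOn_dslope h0).2 hq.differentiableOn
    · have h1 : closure (ball (0 : ℂ) ρ) ∈ 𝓝 0 := mem_of_superset h0 subset_closure
      exact (continuousOn_dslope h1).2 ⟨hq.continuousOn, hq.differentiableAt isOpen_ball
        (mem_ball_self hρ)⟩
    · have h2 := sub_smul_dslope q 0 w
      rw [sub_zero, smul_eq_mul] at h2
      rw [Fin.sum_univ_castSucc, h w]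
      simp only [Fin.snoc_castSucc, Fin.snoc_last, Fin.val_castSucc, Fin.val_last]
      linear_combination (-w ^ b) * h2

end

section

/-! ### Weierstrass division -/

/-- The function `z ↦ f (z, ·)` with values in the disc algebra. -/
def curryDisc {E : Type} (ρ : ℝ) (f : E × ℂ → ℂ) (z : E) : discAlg ρ :=
  open Classical in
  if h : curryC (closedBall 0 ρ) f z ∈ discAlg ρ then ⟨_, h⟩ else 0

section

variable {E : Type} [NormedAddCommGroup E] [NormedSpace ℂ E]

theorem coe_curryDisc {ρ δ : ℝ} (hρ : 0 < ρ) (hρδ : ρ < δ) {f : E × ℂ → ℂ}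
    (hf : ContDiffOn ℂ ∞ f (ball 0 δ ×ˢ ball 0 δ)) {z : E} (hz : z ∈ ball (0 : E) δ) :
    (curryDisc ρ f z : C(closedBall (0 : ℂ) ρ, ℂ)) = curryC (closedBall 0 ρ) f z := by
  have hsub : closedBall (0 : ℂ) ρ ⊆ ball 0 δ := closedBall_subset_ball hρδ
  have h : curryC (closedBall 0 ρ) f z ∈ discAlg ρ := by
    refine ⟨fun w => f (z, w), DifferentiableOn.diffContOnCl ?_, fun w => ?_⟩
    · rw [closure_ball _ hρ.ne']
      exact (hf.differentiableOn (by simp)).comp (by fun_prop) fun w hw => ⟨hz, hsub hw⟩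
    · exact curryC_apply hf.continuousOn (fun w hw => ⟨hz, hsub hw⟩) w
  simp [curryDisc, h]

theorem curryDisc_apply {ρ δ : ℝ} (hρ : 0 < ρ) (hρδ : ρ < δ) {f : E × ℂ → ℂ}
    (hf : ContDiffOn ℂ ∞ f (ball 0 δ ×ˢ ball 0 δ)) {z : E} (hz : z ∈ ball (0 : E) δ)
    (w : closedBall (0 : ℂ) ρ) :
    (curryDisc ρ f z : C(closedBall (0 : ℂ) ρ, ℂ)) w = f (z, w) := by
  rw [coe_curryDisc hρ hρδ hf hz]
  exact curryC_apply hf.continuousOn (fun w hw => ⟨hz, closedBall_subset_ball hρδ hw⟩) w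

instance discAlg_completeSpace {ρ : ℝ} [Fact (0 < ρ)] : CompleteSpace (discAlg ρ) :=
  (isClosed_discAlg (ρ := ρ) Fact.out).completeSpace_coe

theorem contDiffOn_curryDisc {ρ δ : ℝ} [Fact (0 < ρ)] (hρδ : ρ < δ) {f : E × ℂ → ℂ}
    (hf : ContDiffOn ℂ ∞ f (ball 0 δ ×ˢ ball 0 δ)) :
    ContDiffOn ℂ ∞ (curryDisc (E := E) ρ f) (ball 0 δ) := by
  refine contDiffOn_of_isometry_comp isOpen_ball (discAlg ρ).subtypeₗᵢ ?_
  refine (contDiffOn_curryC (K := closedBall (0 : ℂ) ρ) (isOpen_ball.prod isOpen_ball) hf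
    isOpen_ball fun z hz w hw => ⟨hz, closedBall_subset_ball hρδ hw⟩).congr fun z hz => ?_
  exact coe_curryDisc Fact.out hρδ hf hz

/-- The function `wⁱ` on the disc. -/
def discPow (ρ : ℝ) (i : ℕ) : discAlg ρ :=
  ⟨⟨fun w => w ^ i, by fun_prop⟩, fun w => w ^ i, (differentiable_id.pow i).diffContOnCl,
    fun _ => rfl⟩

/-- Multiplication in the disc algebra. -/
def discMul (ρ : ℝ) : discAlg ρ →L[ℂ] discAlg ρ →L[ℂ] discAlg ρ :=
  LinearMap.mkContinuous₂ (LinearMap.mk₂ ℂ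
      (fun v q : discAlg ρ => (⟨q.1 * v.1, mul_mem_discAlg q.2 v.2⟩ : discAlg ρ))
      (fun _ _ _ => Subtype.ext (mul_add _ _ _)) (fun _ _ _ => Subtype.ext (mul_smul_comm _ _ _))
      (fun _ _ _ => Subtype.ext (add_mul _ _ _)) (fun _ _ _ => Subtype.ext (smul_mul_assoc _ _ _)))
    1 (fun v q => by
      rw [one_mul, mul_comm]
      exact norm_mul_le q.1 v.1)

/-- The operator `(q, r) ↦ q v + ∑ rᵢ wⁱ` of division with remainder by `v`. -/
def divOp (ρ : ℝ) (b : ℕ) (v : discAlg ρ) : discAlg ρ × (Fin b → ℂ) →L[ℂ] discAlg ρ :=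
  (discMul ρ v).comp (.fst ℂ _ _) +
    (∑ i : Fin b, (ContinuousLinearMap.proj (R := ℂ) (φ := fun _ : Fin b => ℂ) i).smulRight
      (discPow ρ i)).comp (.snd ℂ _ _)

theorem divOp_apply {ρ : ℝ} {b : ℕ} (v : discAlg ρ) (x : discAlg ρ × (Fin b → ℂ))
    (w : closedBall (0 : ℂ) ρ) : (divOp ρ b v x : C(closedBall (0 : ℂ) ρ, ℂ)) w =
      (x.1 : C(closedBall (0 : ℂ) ρ, ℂ)) w * (v : C(closedBall (0 : ℂ) ρ, ℂ)) w +
        ∑ i, x.2 i * (w : ℂ) ^ (i : ℕ) := by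
  simp [divOp, discPow, discMul]

theorem contDiff_divOp {ρ : ℝ} (b : ℕ) : ContDiff ℂ ∞ (divOp ρ b) := by
  unfold divOp
  refine ContDiff.add ?_ contDiff_const
  refine ContDiff.clm_comp ?_ contDiff_const
  exact ContinuousLinearMap.contDiff (𝕜 := ℂ) (E := discAlg ρ) (F := discAlg ρ →L[ℂ] discAlg ρ)
    (discMul ρ)

theorem eq_zero_of_mul_coord {ρ : ℝ} (hρ : 0 < ρ) (q : C(closedBall (0 : ℂ) ρ, ℂ))
    (h : ∀ w : closedBall (0 : ℂ) ρ, (w : ℂ) * q w = 0) : q = 0 := by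
  have h1 : ∀ w : closedBall (0 : ℂ) ρ, (w : ℂ) ≠ 0 → q w = 0 := fun w hw =>
    (mul_eq_zero.1 (h w)).resolve_left hw
  ext w
  by_cases hw : (w : ℂ) = 0
  · have h2 : ∀ n : ℕ, ((ρ / (n + 1) : ℝ) : ℂ) ∈ closedBall (0 : ℂ) ρ := fun n => by
      rw [mem_closedBall_zero_iff, Complex.norm_real, Real.norm_of_nonneg (by positivity)]
      exact div_le_self hρ.le (by linarith [n.cast_nonneg (α := ℝ)])
    have h3 : Tendsto (fun n : ℕ => (⟨_, h2 n⟩ : closedBall (0 : ℂ) ρ)) atTop (𝓝 w) := by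
      refine tendsto_subtype_rng.2 ?_
      have h4 : Tendsto (fun n : ℕ => ((ρ / (n + 1) : ℝ) : ℂ)) atTop (𝓝 ((0 : ℝ) : ℂ)) := by
        refine (Complex.continuous_ofReal.tendsto 0).comp ?_
        exact tendsto_const_nhds.div_atTop
          (tendsto_atTop_add_const_right _ _ tendsto_natCast_atTop_atTop)
      rw [Complex.ofReal_zero] at h4
      simpa only [hw] using h4
    refine tendsto_nhds_unique (((map_continuous q).tendsto w).comp h3)
      (tendsto_const_nhds.congr fun n => (h1 _ ?_).symm)
    have : (ρ / (n + 1) : ℝ) ≠ 0 := by positivity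
    exact Complex.ofReal_ne_zero.2 this
  · exact h1 w hw

theorem eq_zero_of_mul_pow_add_sum {ρ : ℝ} (hρ : 0 < ρ) (b : ℕ) (q : C(closedBall (0 : ℂ) ρ, ℂ))
    (r : Fin b → ℂ) (h : ∀ w : closedBall (0 : ℂ) ρ,
      q w * (w : ℂ) ^ b + ∑ i, r i * (w : ℂ) ^ (i : ℕ) = 0) : q = 0 ∧ r = 0 := by
  induction b with
  | zero => exact ⟨ContinuousMap.ext fun w => by simpa using h w, Subsingleton.elim _ _⟩
  | succ b ih =>
    have h0 : r 0 = 0 := by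
      have := h ⟨0, mem_closedBall_self hρ.le⟩
      simpa [Fin.sum_univ_succ] using this
    let φ : C(closedBall (0 : ℂ) ρ, ℂ) :=
      ⟨fun w => q w * (w : ℂ) ^ b + ∑ i : Fin b, r i.succ * (w : ℂ) ^ (i : ℕ), by fun_prop⟩
    have hφ : φ = 0 := eq_zero_of_mul_coord hρ φ fun w => by
      refine Eq.trans ?_ (h w)
      rw [Fin.sum_univ_succ, h0]
      simp only [φ, ContinuousMap.coe_mk, mul_add, Finset.mul_sum, Fin.val_succ, pow_succ]
      rw [zero_mul, zero_add]
      congr 1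
      · ring
      · exact Finset.sum_congr rfl fun i _ => by ring
    obtain ⟨hq, hr⟩ := ih (fun i => r i.succ) fun w => DFunLike.congr_fun hφ w
    refine ⟨hq, funext fun i => ?_⟩
    refine Fin.cases h0 (fun i => congrFun hr i) i

/-- Division with remainder by `wᵇ u` is uniquely possible if `u` has no zeros: up to the factor `u`
it is the Taylor expansion of order `b`. -/
theorem bijective_divOp {ρ : ℝ} [Fact (0 < ρ)] {b : ℕ} {v : discAlg ρ} {u : ℂ → ℂ}
    (hu : DiffContOnCl ℂ u (ball 0 ρ)) (hu0 : ∀ w ∈ closedBall (0 : ℂ) ρ, u w ≠ 0)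
    (hv : ∀ w, (v : C(closedBall (0 : ℂ) ρ, ℂ)) w = w ^ b * u w) :
    Function.Bijective (divOp ρ b v) := by
  have hρ : 0 < ρ := Fact.out
  have hcl := closure_ball (0 : ℂ) hρ.ne'
  constructor
  · rw [injective_iff_map_eq_zero]
    intro x hx
    have h1 : ∀ w, (x.1 : C(closedBall (0 : ℂ) ρ, ℂ)) w * (w ^ b * u w) +
        ∑ i, x.2 i * (w : ℂ) ^ (i : ℕ) = 0 := fun w => by
      rw [← hv, ← divOp_apply, hx]; rfl
    let U : C(closedBall (0 : ℂ) ρ, ℂ) := ⟨fun w => u w, by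
      refine continuousOn_iff_continuous_domRestrict.1 ?_
      rw [← hcl]
      exact hu.continuousOn⟩
    obtain ⟨h2, h3⟩ := eq_zero_of_mul_pow_add_sum hρ b ((x.1 : C(closedBall (0 : ℂ) ρ, ℂ)) * U) x.2
      fun w => by
        refine Eq.trans ?_ (h1 w)
        change x.1.1 w * u w * _ + _ = _
        rw [mul_assoc, mul_comm (u w)]
    refine Prod.ext (Subtype.ext (ContinuousMap.ext fun w => ?_)) h3
    have h4 : x.1.1 w * u w = 0 := DFunLike.congr_fun h2 w
    exact (mul_eq_zero.1 h4).resolve_right (hu0 w w.2)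
  · rintro ⟨y, g, hg, hy⟩
    obtain ⟨q, r, hq, h⟩ := exists_dslope_decomposition hρ b g hg
    have hqu : DiffContOnCl ℂ (fun w => q w * (u w)⁻¹) (ball 0 ρ) := hq.smul (hu.inv fun w hw =>
      hu0 w (hcl ▸ hw))
    refine ⟨(⟨⟨fun w => q w * (u w)⁻¹, ?_⟩, _, hqu, fun w => rfl⟩, r), ?_⟩
    · have h5 := hqu.continuousOn
      rw [hcl] at h5
      exact continuousOn_iff_continuous_domRestrict.1 h5
    · refine Subtype.ext (ContinuousMap.ext fun w => ?_)
      rw [divOp_apply, hv]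
      change _ = y w
      rw [hy, h]
      change q w * (u w)⁻¹ * _ + _ = _
      have := hu0 w w.2
      field_simp

/-- A linear equation with smooth coefficients in Banach spaces that is uniquely solvable at `0` has
a smooth solution near `0`. -/
theorem exists_smooth_solution {X Y : Type} [NormedAddCommGroup X] [NormedSpace ℂ X]
    [CompleteSpace X] [NormedAddCommGroup Y] [NormedSpace ℂ Y] [CompleteSpace Y] {δ : ℝ}
    (hδ : 0 < δ) {L : E → X →L[ℂ] Y} {y : E → Y} (hL : ContDiffOn ℂ ∞ L (ball 0 δ))
    (hy : ContDiffOn ℂ ∞ y (ball 0 δ)) (hbij : Function.Bijective (L 0)) :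
    ∃ η, 0 < η ∧ η ≤ δ ∧ ∃ s : E → X, ContDiffOn ℂ ∞ s (ball 0 η) ∧
      ∀ z ∈ ball (0 : E) η, L z (s z) = y z := by
  let e := ContinuousLinearEquiv.ofBijective (L 0) (LinearMap.ker_eq_bot.2 hbij.1)
    (LinearMap.range_eq_top.2 hbij.2)
  have hLc : ContinuousAt L 0 := hL.continuousOn.continuousAt (ball_mem_nhds _ hδ)
  have hev : ∀ᶠ z : E in 𝓝 0, ∃ e' : X ≃L[ℂ] Y, L z = e' := by
    have h3 : Set.range ((↑) : (X ≃L[ℂ] Y) → X →L[ℂ] Y) ∈ 𝓝 (L 0) := ContinuousLinearEquiv.nhds e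
    filter_upwards [hLc h3] with z hz
    obtain ⟨e', he'⟩ := hz
    exact ⟨e', he'.symm⟩
  obtain ⟨η, hη, h4⟩ := Metric.eventually_nhds_iff_ball.1 hev
  have hsub : ball (0 : E) (min η δ) ⊆ ball 0 δ := ball_subset_ball (min_le_right _ _)
  have hsub' : ball (0 : E) (min η δ) ⊆ ball 0 η := ball_subset_ball (min_le_left _ _)
  refine ⟨min η δ, lt_min hη hδ, min_le_right _ _, fun z => (L z).inverse (y z), ?_, ?_⟩
  · intro z hz
    obtain ⟨e', he'⟩ := h4 z (hsub' hz)
    refine (ContDiffAt.clm_apply ?_ ?_).contDiffWithinAt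
    · have h5 : ContDiffAt ℂ ∞ ContinuousLinearMap.inverse (L z) := by
        rw [he']
        exact contDiffAt_map_inverse e'
      exact h5.comp z (hL.contDiffAt (isOpen_ball.mem_nhds (hsub hz)))
    · exact hy.contDiffAt (isOpen_ball.mem_nhds (hsub hz))
  · intro z hz
    obtain ⟨e', he'⟩ := h4 z (hsub' hz)
    simp only [he', ContinuousLinearMap.inverse_equiv]
    exact e'.apply_symm_apply _

/-- Weierstrass division with smooth dependence on parameters.  The division operator of the disc
algebra is invertible at the parameter `0`, hence near `0`, with smooth inverse. -/
theorem weierstrass_division (b : ℕ) {f g : E × ℂ → ℂ} {u : ℂ → ℂ}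
    (hf : ∀ᶠ p in 𝓝 0, ContDiffAt ℂ ∞ f p) (hg : ∀ᶠ p in 𝓝 0, ContDiffAt ℂ ∞ g p)
    (hu : AnalyticAt ℂ u 0) (hu0 : u 0 ≠ 0) (hfu : ∀ᶠ w in 𝓝 0, f (0, w) = w ^ b * u w) :
    ∃ (q : E × ℂ → ℂ) (r : Fin b → E → ℂ), (∀ᶠ p in 𝓝 0, ContDiffAt ℂ ∞ q p) ∧
      (∀ i, ∀ᶠ z in 𝓝 0, ContDiffAt ℂ ∞ (r i) z) ∧
      ∀ᶠ p in 𝓝 0, g p = q p * f p + ∑ i, r i p.1 * p.2 ^ (i : ℕ) := by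
  obtain ⟨δ₁, hδ₁, h1⟩ := Metric.eventually_nhds_iff_ball.1 (hf.and hg)
  obtain ⟨δ₂, hδ₂, h2⟩ := Metric.eventually_nhds_iff_ball.1
    ((hu.eventually_analyticAt.and (hu.continuousAt.eventually_ne hu0)).and hfu)
  let δ := min δ₁ δ₂
  have hδ : 0 < δ := lt_min hδ₁ hδ₂
  let ρ := δ / 2
  have hρ : Fact (0 < ρ) := ⟨half_pos hδ⟩
  have hρδ : ρ < δ := half_lt_self hδ
  have hsub : closedBall (0 : ℂ) ρ ⊆ ball 0 δ₂ :=
    (closedBall_subset_ball hρδ).trans (ball_subset_ball (min_le_right _ _))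
  have hsub1 : ball (0 : E) δ ×ˢ ball (0 : ℂ) δ ⊆ ball 0 δ₁ := by
    rw [ball_prod_same]
    exact ball_subset_ball (min_le_left _ _)
  have hfs : ContDiffOn ℂ ∞ f (ball 0 δ ×ˢ ball 0 δ) := fun p hp =>
    (h1 p (hsub1 hp)).1.contDiffWithinAt
  have hgs : ContDiffOn ℂ ∞ g (ball 0 δ ×ˢ ball 0 δ) := fun p hp =>
    (h1 p (hsub1 hp)).2.contDiffWithinAt
  have hbij : Function.Bijective (divOp ρ b (curryDisc (E := E) ρ f 0)) := by
    refine bijective_divOp (u := u) (DifferentiableOn.diffContOnCl ?_) (fun w hw => ?_) fun w => ?_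
    · rw [closure_ball _ hρ.out.ne']
      exact fun w hw => (h2 w (hsub hw)).1.1.differentiableAt.differentiableWithinAt
    · exact (h2 w (hsub hw)).1.2
    · rw [curryDisc_apply hρ.out hρδ hfs (mem_ball_self hδ)]
      exact (h2 w (hsub w.2)).2
  have hL : ContDiffOn ℂ ∞ (fun z : E => divOp ρ b (curryDisc ρ f z)) (ball 0 δ) :=
    (contDiff_divOp b).comp_contDiffOn (contDiffOn_curryDisc hρδ hfs)
  obtain ⟨η, hη, hηδ, s, hs, h4⟩ := exists_smooth_solution hδ hL
    (contDiffOn_curryDisc hρδ hgs) hbij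
  have hs2 : ContDiffOn ℂ ∞ (fun z => ((s z).1 : C(closedBall (0 : ℂ) ρ, ℂ))) (ball 0 η) :=
    (discAlg ρ).subtypeL.contDiff.comp_contDiffOn hs.fst
  -- the Cauchy integral makes the quotient a function smooth in both variables
  refine ⟨fun p => cauchyVal (((s p.1).1 : C(closedBall (0 : ℂ) ρ, ℂ))) p.2,
    fun i z => (s z).2 i, ?_, ?_, ?_⟩
  · have h6 : ball (0 : E) η ×ˢ ball (0 : ℂ) ρ ∈ 𝓝 (0 : E × ℂ) :=
      prod_mem_nhds (ball_mem_nhds _ hη) (ball_mem_nhds _ hρ.out)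
    filter_upwards [(isOpen_ball.prod isOpen_ball).mem_nhds (mem_of_mem_nhds h6)] with p hp
    exact (contDiffOn_cauchyVal hs2).contDiffAt ((isOpen_ball.prod isOpen_ball).mem_nhds hp)
  · intro i
    filter_upwards [ball_mem_nhds (0 : E) hη] with z hz
    exact (contDiffAt_pi.1 (hs.contDiffAt (isOpen_ball.mem_nhds hz)).snd) i
  · filter_upwards [prod_mem_nhds (ball_mem_nhds (0 : E) hη) (ball_mem_nhds (0 : ℂ) hρ.out)]
    rintro ⟨z, w⟩ ⟨hz, hw⟩
    have hzδ : z ∈ ball (0 : E) δ := ball_subset_ball hηδ hz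
    obtain ⟨G, hG, hqG⟩ := (s z).1.2
    have hw' : w ∈ closedBall (0 : ℂ) ρ := ball_subset_closedBall hw
    have h7 : divOp ρ b (curryDisc ρ f z) (s z) = curryDisc ρ g z := h4 z hz
    have h8 := divOp_apply (curryDisc ρ f z) (s z) ⟨w, hw'⟩
    rw [h7, curryDisc_apply hρ.out hρδ hgs hzδ, curryDisc_apply hρ.out hρδ hfs hzδ] at h8
    refine h8.trans ?_
    rw [cauchyVal_eq hρ.out.le ((s z).1 : C(closedBall (0 : ℂ) ρ, ℂ)) G hG hqG hw, ← hqG ⟨w, hw'⟩]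

end

end

section

/-! ### Germs of holomorphic functions -/

/-- `f` is smooth over `ℂ`, that is, holomorphic, in a neighbourhood of `p`. -/
def HolNear {E F : Type} [NormedAddCommGroup E] [NormedSpace ℂ E] [NormedAddCommGroup F]
    [NormedSpace ℂ F] (f : E → F) (p : E) : Prop :=
  ∀ᶠ z in 𝓝 p, ContDiffAt ℂ ∞ f z

section

variable {E F G : Type} [NormedAddCommGroup E] [NormedSpace ℂ E] [NormedAddCommGroup F]
  [NormedSpace ℂ F] [NormedAddCommGroup G] [NormedSpace ℂ G]

theorem HolNear.contDiffAt {f : E → F} {p : E} (h : HolNear f p) : ContDiffAt ℂ ∞ f p :=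
  h.self_of_nhds

theorem HolNear.continuousAt {f : E → F} {p : E} (h : HolNear f p) : ContinuousAt f p :=
  h.contDiffAt.continuousAt

theorem ContDiff.holNear {f : E → F} (h : ContDiff ℂ ∞ f) (p : E) : HolNear f p :=
  Eventually.of_forall fun _ => h.contDiffAt

theorem HolNear.comp {g : F → G} {f : E → F} {p : E} (hg : HolNear g (f p)) (hf : HolNear f p) :
    HolNear (fun z => g (f z)) p := by
  filter_upwards [hf, hf.continuousAt.eventually hg] with z h1 h2
  exact h2.comp z h1

variable (E) in
/-- The ring of germs at `p` of holomorphic functions on `E`. -/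
def HolGerm (p : E) : Subring ((𝓝 p).Germ ℂ) where
  carrier := {g | ∃ f : E → ℂ, HolNear f p ∧ (f : (𝓝 p).Germ ℂ) = g}
  mul_mem' := by
    rintro _ _ ⟨f, hf, rfl⟩ ⟨g, hg, rfl⟩
    exact ⟨f * g, by filter_upwards [hf, hg] with z h1 h2 using h1.mul h2, rfl⟩
  one_mem' := ⟨1, Eventually.of_forall fun _ => contDiffAt_const, rfl⟩
  add_mem' := by
    rintro _ _ ⟨f, hf, rfl⟩ ⟨g, hg, rfl⟩
    exact ⟨f + g, by filter_upwards [hf, hg] with z h1 h2 using h1.add h2, rfl⟩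
  zero_mem' := ⟨0, Eventually.of_forall fun _ => contDiffAt_const, rfl⟩
  neg_mem' := by
    rintro _ ⟨f, hf, rfl⟩
    exact ⟨-f, by filter_upwards [hf] with z h1 using h1.neg, rfl⟩

namespace HolGerm

/-- The germ of a function. -/
def mk {p : E} (f : E → ℂ) (hf : HolNear f p) : HolGerm E p := ⟨f, f, hf, rfl⟩

theorem exists_mk {p : E} (a : HolGerm E p) : ∃ f hf, a = mk f hf := by
  obtain ⟨_, f, hf, rfl⟩ := a
  exact ⟨f, hf, rfl⟩

theorem mk_eq_mk {p : E} {f g : E → ℂ} {hf : HolNear f p} {hg : HolNear g p} :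
    mk f hf = mk g hg ↔ f =ᶠ[𝓝 p] g := by
  rw [Subtype.ext_iff]
  exact Germ.coe_eq

/-- The value of a germ at the base point. -/
def eval (p : E) : HolGerm E p →+* ℂ := Germ.valueRingHom.comp (HolGerm E p).subtype

@[simp] theorem eval_mk {p : E} (f : E → ℂ) (hf : HolNear f p) : eval p (mk f hf) = f p := rfl

/-- Constant germs. -/
instance algebra (p : E) : Algebra ℂ (HolGerm E p) :=
  RingHom.toAlgebra
    { toFun := fun c => mk (fun _ => c) (Eventually.of_forall fun _ => contDiffAt_const)
      map_one' := rfl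
      map_mul' := fun _ _ => rfl
      map_zero' := rfl
      map_add' := fun _ _ => rfl }

@[simp] theorem eval_algebraMap {p : E} (c : ℂ) : eval p (algebraMap ℂ _ c) = c := rfl

theorem isUnit_iff {p : E} (a : HolGerm E p) : IsUnit a ↔ eval p a ≠ 0 := by
  refine ⟨fun h => (h.map (eval p)).ne_zero, fun h => ?_⟩
  obtain ⟨f, hf, rfl⟩ := exists_mk a
  rw [eval_mk] at h
  have h1 : ∀ᶠ z in 𝓝 p, f z ≠ 0 := hf.continuousAt.eventually_ne h
  refine IsUnit.of_mul_eq_one (mk (fun z => (f z)⁻¹) ?_) ?_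
  · filter_upwards [hf, h1] with z h2 h3 using h2.inv h3
  · refine mk_eq_mk (hg := Eventually.of_forall fun _ => contDiffAt_const)
      (hf := ?_).2 ?_
    · filter_upwards [hf, h1] with z h2 h3 using h2.mul (h2.inv h3)
    · filter_upwards [h1] with z h3 using mul_inv_cancel₀ h3

instance isLocalRing (p : E) : IsLocalRing (HolGerm E p) := by
  have : Nontrivial (HolGerm E p) := (eval p).domain_nontrivial
  refine IsLocalRing.of_nonunits_add fun a b ha hb => ?_
  rw [mem_nonunits_iff, isUnit_iff, not_not] at *
  rw [map_add, ha, hb, add_zero]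

theorem mem_maximalIdeal {p : E} {a : HolGerm E p} :
    a ∈ IsLocalRing.maximalIdeal (HolGerm E p) ↔ eval p a = 0 := by
  rw [IsLocalRing.mem_maximalIdeal, mem_nonunits_iff, isUnit_iff, not_not]

/-- Composition of germs with a holomorphic map. -/
def comp {p : E} {q : F} (H : E → F) (hH : HolNear H p) (hq : H p = q) :
    HolGerm F q →ₐ[ℂ] HolGerm E p :=
  have ht : Tendsto H (𝓝 p) (𝓝 q) := hq ▸ hH.continuousAt
  { toFun := fun a => ⟨Germ.compTendsto a.1 H ht, by
      obtain ⟨f, hf, rfl⟩ := exists_mk a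
      subst hq
      exact ⟨fun z => f (H z), hf.comp hH, rfl⟩⟩
    map_one' := rfl
    map_mul' := fun a b => by
      obtain ⟨f, hf, rfl⟩ := exists_mk a
      obtain ⟨g, hg, rfl⟩ := exists_mk b
      rfl
    map_zero' := rfl
    map_add' := fun a b => by
      obtain ⟨f, hf, rfl⟩ := exists_mk a
      obtain ⟨g, hg, rfl⟩ := exists_mk b
      rfl
    commutes' := fun c => rfl }

theorem comp_mk {p : E} {H : E → F} (hH : HolNear H p) {q : F} (hq : H p = q) (f : F → ℂ)
    (hf : HolNear f q) : comp H hH hq (mk f hf) =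
      mk (fun z => f (H z)) ((hq.symm ▸ hf : HolNear f (H p)).comp hH) := rfl

theorem mk_add {p : E} (f g : E → ℂ) (hf : HolNear f p) (hg : HolNear g p)
    (h : HolNear (fun z => f z + g z) p) : mk (fun z => f z + g z) h = mk f hf + mk g hg := rfl

/-- Germs of continuous linear forms. -/
def lin (l : E →L[ℂ] ℂ) : HolGerm E 0 := mk l (ContDiff.holNear l.contDiff 0)

/-- Invariance of the ring of germs under linear changes of coordinates. -/
theorem comp_surjective (e : E ≃L[ℂ] F) :
    Function.Surjective
      (comp (p := 0) (q := 0) e (ContDiff.holNear e.contDiff 0) (map_zero e)) := by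
  intro a
  obtain ⟨f, hf, rfl⟩ := exists_mk a
  have h0 : e.symm 0 = 0 := map_zero _
  refine ⟨mk (fun z => f (e.symm z))
    ((h0.symm ▸ hf : HolNear f (e.symm 0)).comp (ContDiff.holNear e.symm.contDiff 0)), ?_⟩
  rw [comp_mk, mk_eq_mk]
  exact Eventually.of_forall fun z => congrArg f (e.symm_apply_apply z)

/-- The projection to the first factor embeds the germs on `E` in the germs on `E × ℂ`. -/
def compFst : HolGerm E 0 →ₐ[ℂ] HolGerm (E × ℂ) 0 :=
  comp (p := 0) (q := 0) Prod.fst (ContDiff.holNear contDiff_fst 0) rfl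

/-- The germ of the last coordinate. -/
def coordSnd : HolGerm (E × ℂ) 0 := lin (.snd ℂ E ℂ)

/-- The Weierstrass division theorem for germs. -/
theorem exists_division (f : HolGerm (E × ℂ) 0) (F : E × ℂ → ℂ) (hF : HolNear F 0)
    (hfF : f = mk F hF) (b : ℕ) (u : ℂ → ℂ) (hu : AnalyticAt ℂ u 0) (hu0 : u 0 ≠ 0)
    (h : ∀ᶠ w in 𝓝 0, F (0, w) = w ^ b * u w) (g : HolGerm (E × ℂ) 0) :
    ∃ (q : HolGerm (E × ℂ) 0) (r : Fin b → HolGerm E 0),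
      g = q * f + ∑ i, compFst (r i) * coordSnd ^ (i : ℕ) := by
  obtain ⟨g, hg, rfl⟩ := exists_mk g
  subst hfF
  obtain ⟨q, r, hq, hr, hqr⟩ := weierstrass_division b hF hg hu hu0 h
  refine ⟨mk q hq, fun i => mk (r i) (hr i), ?_⟩
  have h1 : ∀ s : Finset (Fin b), ∃ hs, ∑ i ∈ s, compFst (mk (r i) (hr i)) * coordSnd ^ (i : ℕ) =
      mk (p := (0 : E × ℂ)) (fun z => ∑ i ∈ s, r i z.1 * z.2 ^ (i : ℕ)) hs := by
    intro s
    induction s using Finset.cons_induction with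
    | empty => exact ⟨Eventually.of_forall fun _ => by simpa using contDiffAt_const, by simp; rfl⟩
    | cons a s ha ih =>
      obtain ⟨hs, ih⟩ := ih
      have h2 : HolNear (fun z : E × ℂ => r a z.1 * z.2 ^ (a : ℕ)) 0 := by
        have h3 : HolNear (fun z : E × ℂ => r a z.1) 0 :=
          HolNear.comp (f := Prod.fst) (hr a) (ContDiff.holNear contDiff_fst 0)
        filter_upwards [h3] with z hz using hz.mul (contDiffAt_snd.pow _)
      refine ⟨?_, ?_⟩
      · filter_upwards [hs, h2] with z h3 h4
        simpa only [Finset.sum_cons] using h4.add h3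
      · rw [Finset.sum_cons, ih]
        simp only [Finset.sum_cons]
        exact (mk_add _ _ h2 hs _).symm
  obtain ⟨hs, h2⟩ := h1 Finset.univ
  rw [h2]
  exact (mk_eq_mk (hg := by filter_upwards [hq, hF, hs] with z h3 h4 h5 using (h3.mul h4).add h5)).2
    hqr

end HolGerm

end

end

section

/-! ### Noetherian property and Hadamard lemma -/

namespace HolGerm

section

variable {E F : Type} [NormedAddCommGroup E] [NormedSpace ℂ E] [NormedAddCommGroup F]
  [NormedSpace ℂ F]

theorem comp_lin (A : E →L[ℂ] F) (l : F →L[ℂ] ℂ) :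
    comp (p := 0) (q := 0) A (ContDiff.holNear A.contDiff 0) (map_zero A) (lin l) =
      lin (l.comp A) := rfl

theorem map_comp_span_lin (A : E →L[ℂ] F) {a : HolGerm F 0} (ha : a ∈ Ideal.span (Set.range lin)) :
    comp (p := 0) (q := 0) A (ContDiff.holNear A.contDiff 0) (map_zero A) a ∈
      Ideal.span (Set.range (lin (E := E))) := by
  have h := Ideal.mem_map_of_mem
    (comp (p := 0) (q := 0) A (ContDiff.holNear A.contDiff 0) (map_zero A)).toRingHom ha
  rw [Ideal.map_span] at h
  refine Ideal.span_mono ?_ h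
  rintro _ ⟨_, ⟨l, rfl⟩, rfl⟩
  exact ⟨l.comp A, (comp_lin A l).symm⟩

/-- Division by the last coordinate reduces the Hadamard lemma on `E × ℂ` to that on `E`. -/
theorem mem_span_lin_prod (hE : ∀ a : HolGerm E 0, eval 0 a = 0 → a ∈ Ideal.span (Set.range lin))
    (a : HolGerm (E × ℂ) 0) (ha : eval 0 a = 0) : a ∈ Ideal.span (Set.range lin) := by
  obtain ⟨q, r, h⟩ := exists_division (coordSnd (E := E)) _
    (ContDiff.holNear (ContinuousLinearMap.snd ℂ E ℂ).contDiff 0) rfl 1 (fun _ => 1)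
    analyticAt_const one_ne_zero (Eventually.of_forall fun w => by simp) a
  simp only [Fin.sum_univ_one, Fin.val_zero, pow_zero, mul_one] at h
  have h1 : eval (0 : E × ℂ) coordSnd = 0 := rfl
  have h2 : eval 0 (r 0) = 0 := by
    have h3 : eval (0 : E × ℂ) (compFst (r 0)) = eval 0 (r 0) := by
      obtain ⟨f, hf, hr⟩ := exists_mk (r 0)
      rw [hr]; rfl
    rw [← h3, ← ha, h, map_add, map_mul, h1, mul_zero, zero_add]
  rw [h]
  refine Ideal.add_mem _ (Ideal.mul_mem_left _ _ (Ideal.subset_span ⟨_, rfl⟩)) ?_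
  exact map_comp_span_lin (.fst ℂ E ℂ) (hE _ h2)

/-- Modulo a germ that is regular of finite order in the last coordinate, the germs on `E × ℂ` form
a finite module over the germs on `E`. -/
theorem isNoetherianRing_of_regular [IsNoetherianRing (HolGerm E 0)] {S : Type} [CommRing S]
    (φ : HolGerm (E × ℂ) 0 →+* S) (hφ : Function.Surjective φ) (F : E × ℂ → ℂ) (hF : HolNear F 0)
    (h0 : φ (mk F hF) = 0) (b : ℕ) (u : ℂ → ℂ) (hu : AnalyticAt ℂ u 0) (hu0 : u 0 ≠ 0)
    (h : ∀ᶠ w in 𝓝 0, F (0, w) = w ^ b * u w) : IsNoetherianRing S := by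
  let := (φ.comp (compFst (E := E)).toRingHom).toAlgebra
  have hfin : Module.Finite (HolGerm E 0) S := by
    refine ⟨Submodule.fg_def.2 ⟨Set.range fun i : Fin b => φ (coordSnd ^ (i : ℕ)),
      Set.finite_range _, ?_⟩⟩
    rw [eq_top_iff]
    intro s _
    obtain ⟨g, rfl⟩ := hφ s
    obtain ⟨q, r, hg⟩ := exists_division _ F hF rfl b u hu hu0 h g
    rw [hg, map_add, map_mul, h0, mul_zero, zero_add, map_sum]
    refine Submodule.sum_mem _ fun i _ => ?_
    rw [map_mul]
    exact Submodule.smul_mem _ (r i) (Submodule.subset_span ⟨i, rfl⟩)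
  have := isNoetherian_of_isNoetherianRing_of_finite (HolGerm E 0) S
  exact isNoetherian_of_tower (HolGerm E 0) this

/-- A function that does not vanish identically near `0` has finite order on some line. -/
theorem exists_line {f : E → ℂ} (hf : HolNear f 0) (hne : ¬ f =ᶠ[𝓝 0] 0) (h0 : f 0 = 0) :
    ∃ q : E, q ≠ 0 ∧ ∃ (b : ℕ) (u : ℂ → ℂ), AnalyticAt ℂ u 0 ∧ u 0 ≠ 0 ∧
      ∀ᶠ t in 𝓝 (0 : ℂ), f (t • q) = t ^ b * u t := by
  obtain ⟨δ, hδ, h1⟩ := Metric.eventually_nhds_iff_ball.1 hf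
  have h2 : ∃ᶠ z in 𝓝 0, f z ≠ 0 := fun h => hne (by
    filter_upwards [h] with z hz using not_not.1 hz)
  obtain ⟨q, hq, hqδ⟩ := (h2.and_eventually (ball_mem_nhds (0 : E) hδ)).exists
  have hq0 : q ≠ 0 := by
    rintro rfl
    exact hq h0
  have hqn : 0 < ‖q‖ := norm_pos_iff.2 hq0
  have hmem : ∀ t ∈ ball (0 : ℂ) (δ / ‖q‖), t • q ∈ ball (0 : E) δ := by
    intro t ht
    rw [mem_ball_zero_iff] at ht ⊢
    rw [norm_smul]
    exact (lt_div_iff₀ hqn).1 ht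
  have han : AnalyticOnNhd ℂ (fun t : ℂ => f (t • q)) (ball 0 (δ / ‖q‖)) := by
    refine DifferentiableOn.analyticOnNhd (fun t ht => ?_) isOpen_ball
    have h3 : DifferentiableAt ℂ f (t • q) := (h1 _ (hmem t ht)).differentiableAt (by simp)
    exact (h3.comp t (by fun_prop)).differentiableWithinAt
  have hz : (0 : ℂ) ∈ ball (0 : ℂ) (δ / ‖q‖) := mem_ball_self (by positivity)
  refine ⟨q, hq0, ?_⟩
  have h4 : ¬ ∀ᶠ t in 𝓝 (0 : ℂ), f (t • q) = 0 := by
    intro h5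
    have h6 := han.eqOn_zero_of_preconnected_of_eventuallyEq_zero
      (convex_ball _ _).isPreconnected hz h5
    have h7 : (1 : ℂ) ∈ ball (0 : ℂ) (δ / ‖q‖) := by
      rw [mem_ball_zero_iff, norm_one]
      rw [dist_zero_right] at hqδ
      exact (one_lt_div hqn).2 hqδ
    have h8 := h6 h7
    simp only [one_smul, Pi.zero_apply] at h8
    exact hq h8
  obtain ⟨b, u, hu, hu0, h5⟩ := (han 0 hz).exists_eventuallyEq_pow_smul_nonzero_iff.2 h4
  exact ⟨b, u, hu, hu0, by simpa using h5⟩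

/-- A vector `q ≠ 0` spans the last axis in suitable coordinates. -/
theorem exists_adapted_coordinates [FiniteDimensional ℂ E] {q : E} (hq : q ≠ 0) {n : ℕ}
    (hn : Module.finrank ℂ E = n + 1) : ∃ (N : Submodule ℂ E) (e : E ≃L[ℂ] N × ℂ),
      Module.finrank ℂ N = n ∧ ∀ t : ℂ, e.symm (0, t) = t • q := by
  obtain ⟨l, hl⟩ := SeparatingDual.exists_eq_one (R := ℂ) hq
  have hr : Function.RightInverse (ContinuousLinearMap.toSpanSingleton ℂ q) l := fun t => by
    simp [hl]
  let e := (ContinuousLinearEquiv.equivOfRightInverse l _ hr).trans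
    (ContinuousLinearEquiv.prodComm ℂ ℂ l.ker)
  refine ⟨l.ker, e, ?_, fun t => ?_⟩
  · have h1 := e.toLinearEquiv.finrank_eq
    rw [Module.finrank_prod, hn, Module.finrank_self] at h1
    omega
  · refine e.symm_apply_eq.2 ?_
    refine Prod.ext ?_ ?_
    · refine Subtype.ext ?_
      simp [e, hl]
    · simp [e, hl]

end

/-- A ring is Noetherian if its quotients by nonzero elements are. -/
theorem _root_.isNoetherianRing_of_quotients {R : Type} [CommRing R]
    (h : ∀ f : R, f ≠ 0 → IsNoetherianRing (R ⧸ Ideal.span {f})) : IsNoetherianRing R := by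
  rw [isNoetherianRing_iff_ideal_fg]
  intro I
  by_cases hI : I = ⊥
  · rw [hI]; exact Submodule.fg_bot
  obtain ⟨f, hfI, hf⟩ := Submodule.exists_mem_ne_zero_of_ne_bot hI
  have := h f hf
  have h1 : IsNoetherian R (R ⧸ Ideal.span {f}) := by
    refine ⟨fun N => ?_⟩
    let N' : Submodule (R ⧸ Ideal.span {f}) (R ⧸ Ideal.span {f}) :=
      { N with
        smul_mem' := fun c x hx => by
          obtain ⟨c, rfl⟩ := Ideal.Quotient.mk_surjective c
          exact N.smul_mem c hx }
    exact Submodule.FG.restrictScalars_of_surjective (S := N') (IsNoetherian.noetherian N')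
      Ideal.Quotient.mk_surjective
  refine Submodule.fg_of_fg_map_of_fg_inf_ker (Submodule.mkQ (Ideal.span {f}))
    (IsNoetherian.noetherian _) ?_
  rw [Submodule.ker_mkQ, inf_eq_right.2 ((Ideal.span_singleton_le_iff_mem _).2 hfI)]
  exact ⟨{f}, by simp⟩

/-- The ring of germs in finitely many variables is Noetherian (Rückert's basis theorem), and its
maximal ideal is generated by the linear forms (Hadamard's lemma).  Both are proved by induction on
the dimension with Weierstrass division. -/
theorem isNoetherianRing_and_mem_span_lin (n : ℕ) :
    ∀ (E : Type) [NormedAddCommGroup E] [NormedSpace ℂ E] [FiniteDimensional ℂ E],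
      Module.finrank ℂ E = n → IsNoetherianRing (HolGerm E 0) ∧
        ∀ a : HolGerm E 0, eval 0 a = 0 → a ∈ Ideal.span (Set.range lin) := by
  induction n with
  | zero =>
    intro E _ _ _ hE
    have hs : Subsingleton E := Module.finrank_zero_iff.1 hE
    have h0 : ∀ a : HolGerm E 0, eval 0 a = 0 → a = 0 := by
      intro a ha
      obtain ⟨f, hf, rfl⟩ := exists_mk a
      refine (mk_eq_mk (hg := Eventually.of_forall fun _ => contDiffAt_const)).2
        (Eventually.of_forall fun z => ?_)
      rw [hs.elim z 0]
      exact ha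
    refine ⟨?_, fun a ha => by rw [h0 a ha]; exact Ideal.zero_mem _⟩
    refine isNoetherianRing_of_surjective ℂ _ (algebraMap ℂ (HolGerm E 0)) fun a => ?_
    exact ⟨eval 0 a, (sub_eq_zero.1 (h0 _ (by simp))).symm⟩
  | succ n ih =>
    intro E _ _ _ hE
    constructor
    · refine isNoetherianRing_of_quotients fun a ha => ?_
      obtain ⟨f, hf, rfl⟩ := exists_mk a
      have hne : ¬ f =ᶠ[𝓝 0] 0 := fun h => ha ((mk_eq_mk
        (hg := Eventually.of_forall fun _ => contDiffAt_const)).2 h)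
      by_cases h0 : f 0 = 0
      · -- in coordinates whose last axis is a line on which `f` has finite order, Weierstrass
        -- division by `f` applies
        obtain ⟨q, hq, b, u, hu, hu0, h⟩ := exists_line hf hne h0
        obtain ⟨N, e, hN, he⟩ := exists_adapted_coordinates hq hE
        have := (ih N hN).1
        have hcs := comp_surjective e
        have he0 : e.symm 0 = 0 := map_zero _
        refine isNoetherianRing_of_regular (E := N) ((Ideal.Quotient.mk (Ideal.span {mk f hf})).comp
          (comp (p := 0) (q := 0) e (ContDiff.holNear e.contDiff 0) (map_zero e)).toRingHom)
          (Ideal.Quotient.mk_surjective.comp hcs) (fun z => f (e.symm z))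
          ((he0.symm ▸ hf : HolNear f (e.symm 0)).comp (ContDiff.holNear e.symm.contDiff 0))
          ?_ b u hu hu0 (by simpa only [he] using h)
        change Ideal.Quotient.mk (Ideal.span {mk f hf}) (comp _ _ _ (mk _ _)) = 0
        rw [comp_mk, (mk_eq_mk (hg := hf)).2
          (Eventually.of_forall fun z => congrArg f (e.symm_apply_apply z))]
        exact Ideal.Quotient.eq_zero_iff_mem.2 (Ideal.mem_span_singleton_self _)
      · have : Subsingleton (HolGerm E 0 ⧸ Ideal.span {mk f hf}) := by
          rw [Ideal.Quotient.subsingleton_iff, Ideal.span_singleton_eq_top, isUnit_iff]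
          exact h0
        infer_instance
    · intro a ha
      obtain ⟨q, hq⟩ : ∃ q : E, q ≠ 0 := by
        have : Nontrivial E := Module.nontrivial_of_finrank_pos (R := ℂ) (by omega)
        exact exists_ne 0
      obtain ⟨N, e, hN, he⟩ := exists_adapted_coordinates hq hE
      obtain ⟨a, rfl⟩ := comp_surjective e a
      refine map_comp_span_lin (e : E →L[ℂ] N × ℂ) (mem_span_lin_prod (ih N hN).2 a ?_)
      obtain ⟨f, hf, rfl⟩ := exists_mk a
      rw [comp_mk, eval_mk, map_zero] at ha
      exact ha

end HolGerm

end

section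

/-! ### Analytic algebras -/

namespace HolGerm

theorem holNear_sub {E : Type} [NormedAddCommGroup E] [NormedSpace ℂ E] (p q : E) :
    HolNear (fun z : E => z - p) q := ContDiff.holNear (contDiff_id.sub contDiff_const) q

theorem comp_sub_surjective {E : Type} [NormedAddCommGroup E] [NormedSpace ℂ E] (p : E) :
    Function.Surjective (comp (fun z : E => z - p) (holNear_sub p p) (sub_self p)) := by
  intro a
  obtain ⟨f, hf, rfl⟩ := exists_mk a
  have h1 : HolNear (fun z : E => f (z + p)) 0 := HolNear.comp (f := fun z : E => z + p)
    (by simpa using hf) (ContDiff.holNear (contDiff_id.add contDiff_const) 0)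
  refine ⟨mk (fun z => f (z + p)) h1, ?_⟩
  rw [comp_mk, mk_eq_mk]
  exact Eventually.of_forall fun z => congrArg f (sub_add_cancel z p)

variable {ι : Type} [Fintype ι]

instance isNoetherianRing (p : ι → ℂ) : IsNoetherianRing (HolGerm (ι → ℂ) p) :=
  have := (isNoetherianRing_and_mem_span_lin _ (ι → ℂ) rfl).1
  isNoetherianRing_of_surjective _ _ _ (comp_sub_surjective p)

/-- The germ of the `i`-th coordinate. -/
def coord (p : ι → ℂ) (i : ι) : HolGerm (ι → ℂ) p :=
  mk (fun z => z i) (ContDiff.holNear (contDiff_apply ℂ ℂ i) p)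

/-- Hadamard's lemma: the maximal ideal is generated by the coordinates. -/
theorem maximalIdeal_eq (p : ι → ℂ) : IsLocalRing.maximalIdeal (HolGerm (ι → ℂ) p) =
    Ideal.span (Set.range fun i => coord p i - algebraMap ℂ _ (p i)) := by
  classical
  apply le_antisymm
  · intro a ha
    obtain ⟨a, rfl⟩ := comp_sub_surjective p a
    rw [mem_maximalIdeal] at ha
    have h0 : eval 0 a = 0 := by
      obtain ⟨f, hf, rfl⟩ := exists_mk a
      rw [comp_mk, eval_mk, sub_self] at ha
      exact ha
    have h1 := (isNoetherianRing_and_mem_span_lin _ (ι → ℂ) rfl).2 a h0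
    have h2 := Ideal.mem_map_of_mem
      (comp (fun z : ι → ℂ => z - p) (holNear_sub p p) (sub_self p)).toRingHom h1
    rw [Ideal.map_span] at h2
    refine Ideal.span_le.2 ?_ h2
    rintro _ ⟨_, ⟨l, rfl⟩, rfl⟩
    have h3 : (comp (fun z : ι → ℂ => z - p) (holNear_sub p p) (sub_self p)).toRingHom (lin l) =
        ∑ i, algebraMap ℂ _ (l (Pi.single i 1)) * (coord p i - algebraMap ℂ _ (p i)) := by
      have h4 : ∀ s : Finset ι, ∃ hs,
          ∑ i ∈ s, algebraMap ℂ _ (l (Pi.single i 1)) * (coord p i - algebraMap ℂ _ (p i)) =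
            mk (fun z => ∑ i ∈ s, l (Pi.single i 1) * (z i - p i)) hs := by
        intro s
        induction s using Finset.cons_induction with
        | empty => exact ⟨Eventually.of_forall fun _ => by simpa using contDiffAt_const, by
            simp; rfl⟩
        | cons a s ha ih =>
          obtain ⟨hs, ih⟩ := ih
          have h2 : HolNear (fun z : ι → ℂ => l (Pi.single a 1) * (z a - p a)) p :=
            ContDiff.holNear (contDiff_const.mul ((contDiff_apply ℂ ℂ a).sub contDiff_const)) p
          refine ⟨?_, ?_⟩
          · filter_upwards [hs, h2] with z h3 h4
            simpa only [Finset.sum_cons] using h4.add h3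
          · rw [Finset.sum_cons, ih]
            simp only [Finset.sum_cons]
            exact (mk_add _ _ h2 hs _).symm
      obtain ⟨hs, h5⟩ := h4 Finset.univ
      rw [h5]
      have h7 : HolNear (fun z : ι → ℂ => l (z - p)) p :=
        ContDiff.holNear (l.contDiff.comp (contDiff_id.sub contDiff_const)) p
      refine (mk_eq_mk (hf := h7)).2 (Eventually.of_forall fun z => ?_)
      have h6 : z - p = ∑ i, (z i - p i) • (Pi.single i (1 : ℂ) : ι → ℂ) := by
        conv_lhs => rw [← Finset.univ_sum_single (z - p)]
        refine Finset.sum_congr rfl fun i _ => ?_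
        rw [← Pi.single_smul, smul_eq_mul, mul_one, Pi.sub_apply]
      change l (z - p) = _
      rw [h6, map_sum]
      exact Finset.sum_congr rfl fun i _ => by rw [map_smul, smul_eq_mul, mul_comm]
    rw [h3]
    exact Ideal.sum_mem _ fun i _ => Ideal.mul_mem_left _ _ (Ideal.subset_span ⟨i, rfl⟩)
  · refine Ideal.span_le.2 ?_
    rintro _ ⟨i, rfl⟩
    exact mem_maximalIdeal.2 (sub_self (p i))

end HolGerm

/-- Analytic algebras: quotients of rings of germs of holomorphic functions in finitely many
variables. -/
class IsAnalyticAlg (A : Type) [CommRing A] [Algebra ℂ A] : Prop where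
  exists_surjective : ∃ (n : ℕ) (p : Fin n → ℂ) (π : HolGerm (Fin n → ℂ) p →ₐ[ℂ] A),
    Function.Surjective π

namespace IsAnalyticAlg

variable {A B : Type} [CommRing A] [Algebra ℂ A] [CommRing B] [Algebra ℂ B]

theorem of_surjective [IsAnalyticAlg B] (φ : B →ₐ[ℂ] A) (h : Function.Surjective φ) :
    IsAnalyticAlg A := by
  obtain ⟨n, p, π, hπ⟩ := exists_surjective (A := B)
  exact ⟨n, p, φ.comp π, h.comp hπ⟩

variable (A) in
theorem isNoetherianRing [IsAnalyticAlg A] : IsNoetherianRing A := by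
  obtain ⟨n, p, π, hπ⟩ := exists_surjective (A := A)
  exact isNoetherianRing_of_surjective _ _ π.toRingHom hπ

theorem isLocalRing [IsAnalyticAlg A] [Nontrivial A] : IsLocalRing A := by
  obtain ⟨n, p, π, hπ⟩ := exists_surjective (A := A)
  exact IsLocalRing.of_surjective' π.toRingHom hπ

variable [IsLocalRing A] [IsLocalRing B]

theorem exists_const [IsAnalyticAlg A] (a : A) :
    ∃ c : ℂ, a - algebraMap ℂ A c ∈ IsLocalRing.maximalIdeal A := by
  obtain ⟨n, p, π, hπ⟩ := exists_surjective (A := A)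
  obtain ⟨f, rfl⟩ := hπ a
  have : IsLocalHom π.toRingHom := hπ.isLocalHom
  refine ⟨HolGerm.eval p f, ?_⟩
  rw [← π.commutes, ← map_sub, IsLocalRing.mem_maximalIdeal]
  intro hu
  have h := isUnit_of_map_unit π.toRingHom _ hu
  rw [HolGerm.isUnit_iff] at h
  simp at h

theorem const_unique {c : ℂ} (h : algebraMap ℂ A c ∈ IsLocalRing.maximalIdeal A) : c = 0 := by
  by_contra hc
  exact (IsLocalRing.mem_maximalIdeal _).1 h ((isUnit_iff_ne_zero.2 hc).map (algebraMap ℂ A))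

/-- Algebra homomorphisms between analytic algebras are local, as the residue fields are `ℂ`. -/
theorem map_mem_maximalIdeal [IsAnalyticAlg A] (φ : B →ₐ[ℂ] A) {b : B}
    (hb : b ∈ IsLocalRing.maximalIdeal B) : φ b ∈ IsLocalRing.maximalIdeal A := by
  obtain ⟨c, hc⟩ := exists_const (φ b)
  by_cases h : c = 0
  · simpa [h] using hc
  · exfalso
    have h1 : IsUnit (b - algebraMap ℂ B c) := by
      by_contra h2
      have h3 := sub_mem hb ((IsLocalRing.mem_maximalIdeal _).2 h2)
      rw [sub_sub_cancel] at h3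
      exact h (const_unique h3)
    have h4 := h1.map φ
    rw [map_sub, φ.commutes] at h4
    exact (IsLocalRing.mem_maximalIdeal _).1 hc h4

variable {ι : Type} [Fintype ι]

/-- A homomorphism from a ring of germs to an analytic algebra is determined by the images of the
coordinates: by Hadamard's lemma this holds modulo all powers of the maximal ideal, and these
intersect in zero by Krull's theorem. -/
theorem hom_ext [IsAnalyticAlg A] {p : ι → ℂ} {φ ψ : HolGerm (ι → ℂ) p →ₐ[ℂ] A}
    (h : ∀ i, φ (HolGerm.coord p i) = ψ (HolGerm.coord p i)) : φ = ψ := by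
  have := isNoetherianRing A
  have hp : ∀ (k : ℕ) (f : HolGerm (ι → ℂ) p), φ f - ψ f ∈ IsLocalRing.maximalIdeal A ^ k := by
    intro k
    induction k with
    | zero => simp
    | succ k ih =>
      intro f
      have h1 : f - algebraMap ℂ _ (HolGerm.eval p f) ∈ IsLocalRing.maximalIdeal _ := by
        rw [HolGerm.mem_maximalIdeal]; simp
      have h2 : ∀ x ∈ IsLocalRing.maximalIdeal (HolGerm (ι → ℂ) p),
          φ x - ψ x ∈ IsLocalRing.maximalIdeal A ^ (k + 1) := by
        intro x hx
        rw [HolGerm.maximalIdeal_eq] at hx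
        induction hx using Submodule.span_induction with
        | mem x hx =>
          obtain ⟨i, rfl⟩ := hx
          simp [h]
        | zero => simp
        | add x y _ _ hx hy =>
          rw [map_add, map_add, add_sub_add_comm]
          exact add_mem hx hy
        | smul a x hx' hx =>
          have h3 : φ x ∈ IsLocalRing.maximalIdeal A :=
            map_mem_maximalIdeal φ (HolGerm.maximalIdeal_eq p ▸ hx')
          have h4 : φ (a • x) - ψ (a • x) = φ x * (φ a - ψ a) + ψ a * (φ x - ψ x) := by
            simp only [smul_eq_mul, map_mul]; ring
          rw [h4]
          refine add_mem ?_ (Ideal.mul_mem_left _ _ hx)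
          rw [pow_succ']
          exact Ideal.mul_mem_mul h3 (ih a)
      simpa using h2 _ h1
  refine AlgHom.ext fun f => sub_eq_zero.1 ?_
  have h5 := Ideal.iInf_pow_eq_bot_of_isLocalRing (IsLocalRing.maximalIdeal A)
    (Ideal.IsPrime.ne_top inferInstance)
  rw [← Ideal.mem_bot, ← h5]
  exact Ideal.mem_iInf.2 fun k => hp k f

/-- Elements of an analytic algebra can be substituted in germs of holomorphic functions. -/
theorem exists_hom [IsAnalyticAlg A] (a : ι → A) (p : ι → ℂ)
    (h : ∀ i, a i - algebraMap ℂ A (p i) ∈ IsLocalRing.maximalIdeal A) :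
    ∃ φ : HolGerm (ι → ℂ) p →ₐ[ℂ] A, ∀ i, φ (HolGerm.coord p i) = a i := by
  obtain ⟨n, q, π, hπ⟩ := exists_surjective (A := A)
  have h1 : ∀ i, ∃ F : (Fin n → ℂ) → ℂ, ∃ hF : HolNear F q, π (HolGerm.mk F hF) = a i := by
    intro i
    obtain ⟨f, hf⟩ := hπ (a i)
    obtain ⟨F, hF, rfl⟩ := HolGerm.exists_mk f
    exact ⟨F, hF, hf⟩
  choose F hF hFa using h1
  have hH : HolNear (fun z i => F i z) q := by
    filter_upwards [eventually_all.2 hF] with z hz using contDiffAt_pi.2 hz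
  have hHq : (fun i => F i q) = p := by
    funext i
    by_contra hne
    have h2 : IsUnit (HolGerm.mk (F i) (hF i) - algebraMap ℂ _ (p i)) := by
      rw [HolGerm.isUnit_iff, map_sub, HolGerm.eval_mk, HolGerm.eval_algebraMap]
      exact sub_ne_zero.2 hne
    have h3 := h2.map π
    rw [map_sub, hFa, π.commutes] at h3
    exact (IsLocalRing.mem_maximalIdeal _).1 (h i) h3
  refine ⟨π.comp (HolGerm.comp _ hH hHq), fun i => ?_⟩
  exact hFa i

end IsAnalyticAlg

end

section

/-! ### Unramified homomorphisms of analytic algebras -/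

/-- The local inverse of a holomorphic map whose derivative at `q` is the identity. -/
theorem exists_holNear_inverse {E : Type} [NormedAddCommGroup E] [NormedSpace ℂ E] [CompleteSpace E]
    {Ψ : E → E} {q : E} (hΨ : HolNear Ψ q) (hd : HasFDerivAt Ψ (ContinuousLinearMap.id ℂ E) q) :
    ∃ θ : E → E, HolNear θ (Ψ q) ∧ ∀ᶠ z in 𝓝 q, θ (Ψ z) = z := by
  have hd' : HasFDerivAt Ψ ((ContinuousLinearEquiv.refl ℂ E : E ≃L[ℂ] E) : E →L[ℂ] E) q := hd
  have hn : (∞ : WithTop ℕ∞) ≠ 0 := by simp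
  let P := hΨ.contDiffAt.toOpenPartialHomeomorph Ψ hd' hn
  have hq : q ∈ P.source := hΨ.contDiffAt.mem_toOpenPartialHomeomorph_source hd' hn
  have hPq : Ψ q ∈ P.target := P.map_source hq
  have hsymm : P.symm (Ψ q) = q := P.left_inv hq
  have hinv : ∀ᶠ z in 𝓝 q, ∃ e : E ≃L[ℂ] E, HasFDerivAt Ψ (e : E →L[ℂ] E) z := by
    have h1 : ContinuousAt (fderiv ℂ Ψ) q := hΨ.contDiffAt.continuousAt_fderiv (by simp)
    have h2 : Set.range ((↑) : (E ≃L[ℂ] E) → E →L[ℂ] E) ∈ 𝓝 (fderiv ℂ Ψ q) := by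
      rw [hd'.fderiv]
      exact ContinuousLinearEquiv.nhds _
    filter_upwards [h1 h2, hΨ] with z hz hz2
    obtain ⟨e, he⟩ := hz
    exact ⟨e, by rw [he]; exact (hz2.differentiableAt (by simp)).hasFDerivAt⟩
  refine ⟨P.symm, ?_, ?_⟩
  · have h3 : Tendsto P.symm (𝓝 (Ψ q)) (𝓝 q) := by
      have := P.continuousAt_symm hPq
      rwa [ContinuousAt, hsymm] at this
    filter_upwards [h3.eventually (hinv.and hΨ), P.open_target.mem_nhds hPq] with w hw hwt
    obtain ⟨⟨e, he⟩, hw2⟩ := hw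
    exact P.contDiffAt_symm hwt he hw2
  · filter_upwards [P.open_source.mem_nhds hq] with z hz
    exact P.left_inv hz

theorem HolGerm.comp_comp_of_leftInverse {E F : Type} [NormedAddCommGroup E] [NormedSpace ℂ E]
    [NormedAddCommGroup F] [NormedSpace ℂ F] {p : E} {q : F} {H : F → E} {Φ : E → F}
    (hH : HolNear H q) (hq : H q = p) (hΦ : HolNear Φ p) (hp : Φ p = q)
    (h : ∀ᶠ z in 𝓝 p, H (Φ z) = z) (f : HolGerm E p) :
    HolGerm.comp Φ hΦ hp (HolGerm.comp H hH hq f) = f := by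
  obtain ⟨f, hf, rfl⟩ := HolGerm.exists_mk f
  rw [HolGerm.comp_mk, HolGerm.comp_mk, HolGerm.mk_eq_mk]
  filter_upwards [h] with z hz using congrArg f hz

namespace IsAnalyticAlg

/-- Germs `g j` that generate the maximal ideal separate points near the base point, and the
coordinates are holomorphic functions of them: this is the inverse function theorem. -/
theorem exists_retraction {ι κ : Type} [Fintype ι] [Fintype κ] {q : ι → ℂ}
    (g : κ → (ι → ℂ) → ℂ) (hg : ∀ j, HolNear (g j) q) (hgq : ∀ j, g j q = 0)
    (hspan : IsLocalRing.maximalIdeal (HolGerm (ι → ℂ) q) ≤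
      Ideal.span (Set.range fun j => HolGerm.mk (g j) (hg j))) :
    ∃ H : (κ → ℂ) → ι → ℂ, HolNear H 0 ∧ ∀ᶠ z in 𝓝 q, H (fun j => g j z) = z := by
  have h1 : ∀ i, ∃ A : κ → HolGerm (ι → ℂ) q,
      ∑ j, A j * HolGerm.mk (g j) (hg j) = HolGerm.coord q i - algebraMap ℂ _ (q i) := fun i => by
    refine (Ideal.mem_span_range_iff_exists_fun).1 (hspan ?_)
    exact HolGerm.mem_maximalIdeal.2 (sub_self (q i))
  choose A hA using h1
  let L : (κ → ℂ) →L[ℂ] (ι → ℂ) := ContinuousLinearMap.pi fun i =>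
    ∑ j, HolGerm.eval q (A i j) • ContinuousLinearMap.proj (R := ℂ) (φ := fun _ : κ => ℂ) j
  let Φ : (ι → ℂ) → κ → ℂ := fun z j => g j z
  have hΦ : HolNear Φ q := by
    filter_upwards [eventually_all.2 hg] with z hz using contDiffAt_pi.2 hz
  have hΦq : Φ q = 0 := funext hgq
  -- the equations `zᵢ - qᵢ = ∑ Aᵢⱼ gⱼ` show that `L` inverts the derivative of `Φ` on the left
  have hd : HasFDerivAt (fun z => L (Φ z)) (ContinuousLinearMap.id ℂ (ι → ℂ)) q := by
    rw [hasFDerivAt_pi']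
    intro i
    have h2 : ∀ j, ∃ F hF, A i j = HolGerm.mk F hF := fun j => HolGerm.exists_mk _
    choose F hF hAF using h2
    have h3 : (fun z => ∑ j, F j z * g j z) =ᶠ[𝓝 q] fun z => z i - q i := by
      have h4 := hA i
      have h5 : ∀ s : Finset κ, ∃ hs, ∑ j ∈ s, A i j * HolGerm.mk (g j) (hg j) =
          HolGerm.mk (fun z => ∑ j ∈ s, F j z * g j z) hs := by
        intro s
        induction s using Finset.cons_induction with
        | empty => exact ⟨Eventually.of_forall fun _ => by simpa using contDiffAt_const, by
            simp; rfl⟩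
        | cons a s ha ih =>
          obtain ⟨hs, ih⟩ := ih
          have h2 : HolNear (fun z : ι → ℂ => F a z * g a z) q := by
            filter_upwards [hF a, hg a] with z h1 h2 using h1.mul h2
          refine ⟨?_, ?_⟩
          · filter_upwards [hs, h2] with z h3 h4
            simpa only [Finset.sum_cons] using h4.add h3
          · rw [Finset.sum_cons, ih, hAF]
            simp only [Finset.sum_cons]
            exact (HolGerm.mk_add _ _ h2 hs _).symm
      obtain ⟨hs, h6⟩ := h5 Finset.univ
      rw [h6] at h4
      exact (HolGerm.mk_eq_mk (hg := ContDiff.holNear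
        ((contDiff_apply ℂ ℂ i).sub contDiff_const) q)).1 h4
    have hdF : ∀ j, HasFDerivAt (F j) (fderiv ℂ (F j) q) q := fun j =>
      ((hF j).contDiffAt.differentiableAt (by simp)).hasFDerivAt
    have hdg : ∀ j, HasFDerivAt (g j) (fderiv ℂ (g j) q) q := fun j =>
      ((hg j).contDiffAt.differentiableAt (by simp)).hasFDerivAt
    have h7 : HasFDerivAt (fun z => ∑ j, F j z * g j z)
        (∑ j, (F j q • fderiv ℂ (g j) q + g j q • fderiv ℂ (F j) q)) q :=
      HasFDerivAt.fun_sum fun j _ => (hdF j).mul (hdg j)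
    have h8 : HasFDerivAt (fun z : ι → ℂ => z i - q i)
        (ContinuousLinearMap.proj (R := ℂ) (φ := fun _ : ι => ℂ) i) q :=
      (hasFDerivAt_apply i q).sub_const _
    have h9 := h7.unique (h8.congr_of_eventuallyEq h3)
    have h10 : HasFDerivAt (fun z => ∑ j, F j q * g j z)
        (∑ j, F j q • fderiv ℂ (g j) q) q :=
      HasFDerivAt.fun_sum fun j _ => (hdg j).const_mul (F j q)
    have hz : ∀ j, F j q • fderiv ℂ (g j) q + g j q • fderiv ℂ (F j) q =
        F j q • fderiv ℂ (g j) q := fun j => by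
      rw [hgq j]
      ext
      simp
    rw [Finset.sum_congr rfl fun j _ => hz j] at h9
    rw [h9] at h10
    refine h10.congr_of_eventuallyEq (Eventually.of_forall fun z => ?_)
    simp [L, Φ, hAF]
  have hLΦ : HolNear (fun z => L (Φ z)) q := by
    filter_upwards [hΦ] with z hz using L.contDiff.contDiffAt.comp z hz
  obtain ⟨θ, hθ, hθ'⟩ := exists_holNear_inverse hLΦ hd
  refine ⟨fun y => θ (L y), HolNear.comp ?_ (ContDiff.holNear L.contDiff 0), hθ'⟩
  rw [hΦq] at hθ
  exact hθ

variable {A B : Type} [CommRing A] [Algebra ℂ A] [CommRing B] [Algebra ℂ B] [IsLocalRing A]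
  [IsLocalRing B]

/-- If `m_A = m_B A` and `A` is a quotient of a ring of germs, then the maximal ideal of the ring of
germs is generated by finitely many germs with images in `A` that come from `m_B`. -/
theorem exists_generators_of_unramified [IsAnalyticAlg A] [IsAnalyticAlg B] (φ : B →ₐ[ℂ] A)
    (h : IsLocalRing.maximalIdeal A ≤ (IsLocalRing.maximalIdeal B).map φ)
    {n : ℕ} {q : Fin n → ℂ} (π : HolGerm (Fin n → ℂ) q →ₐ[ℂ] A) (hπ : Function.Surjective π) :
    ∃ T : Finset (HolGerm (Fin n → ℂ) q),
      (∀ x ∈ T, x ∈ IsLocalRing.maximalIdeal (HolGerm (Fin n → ℂ) q) ∧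
        ∃ b ∈ IsLocalRing.maximalIdeal B, φ b = π x) ∧
      IsLocalRing.maximalIdeal (HolGerm (Fin n → ℂ) q) ≤ Ideal.span T := by
  let m := IsLocalRing.maximalIdeal (HolGerm (Fin n → ℂ) q)
  let S : Set (HolGerm (Fin n → ℂ) q) :=
    {x | x ∈ m ∧ ∃ b ∈ IsLocalRing.maximalIdeal B, φ b = π x}
  have hmS : m ≤ Ideal.span S := by
    intro x hx
    have h1 : π x ∈ (IsLocalRing.maximalIdeal B).map φ := h (map_mem_maximalIdeal π hx)
    have h2 : (IsLocalRing.maximalIdeal B).map φ ≤ (Ideal.span S).map π := by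
      refine Ideal.map_le_iff_le_comap.2 fun b hb => ?_
      obtain ⟨y, hy⟩ := hπ (φ b)
      have hym : y ∈ m := by
        rw [IsLocalRing.mem_maximalIdeal]
        intro hu
        have := hu.map π
        rw [hy] at this
        exact (IsLocalRing.mem_maximalIdeal _).1 (map_mem_maximalIdeal φ hb) this
      rw [Ideal.mem_comap, ← hy]
      exact Ideal.mem_map_of_mem _ (Ideal.subset_span ⟨hym, b, hb, hy.symm⟩)
    obtain ⟨y, hy, hxy⟩ := (Ideal.mem_map_iff_of_surjective π hπ).1 (h2 h1)
    have hym : y ∈ m := Ideal.span_le.2 (fun z hz => hz.1) hy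
    rw [← sub_add_cancel x y]
    refine add_mem (Ideal.subset_span ⟨sub_mem hx hym, 0, Ideal.zero_mem _, ?_⟩) hy
    rw [map_sub, hxy, sub_self, map_zero]
  obtain ⟨T, hTS, hT⟩ := Submodule.fg_span_iff_fg_span_finset_subset S |>.1
    (IsNoetherian.noetherian (Submodule.span (HolGerm (Fin n → ℂ) q) S))
  exact ⟨T, fun x hx => hTS hx, hmS.trans (le_of_eq hT)⟩

/-- A homomorphism of analytic algebras that is unramified, in the sense that `m_A = m_B A`, is
surjective: the coordinates on `A` are holomorphic functions of generators of the maximal ideal that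
come from `B`, and holomorphic functions can be evaluated on elements of `B`. -/
theorem surjective_of_unramified [IsAnalyticAlg A] [IsAnalyticAlg B] (φ : B →ₐ[ℂ] A)
    (h : IsLocalRing.maximalIdeal A ≤ (IsLocalRing.maximalIdeal B).map φ) :
    Function.Surjective φ := by
  obtain ⟨n, q, π, hπ⟩ := exists_surjective (A := A)
  obtain ⟨T, hTS, hT⟩ := exists_generators_of_unramified φ h π hπ
  have h3 : ∀ x : T, ∃ F hF, (x : HolGerm (Fin n → ℂ) q) = HolGerm.mk F hF := fun x =>
    HolGerm.exists_mk _
  choose g hg hgT using h3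
  have hgq : ∀ x, g x q = 0 := fun x => by
    have h4 := HolGerm.mem_maximalIdeal.1 (hTS x.1 x.2).1
    rw [hgT] at h4
    exact h4
  choose b hb hbT using fun x : T => (hTS x.1 x.2).2
  obtain ⟨H, hH, hHg⟩ := exists_retraction g hg hgq
    (hT.trans (Ideal.span_mono fun x hx => ⟨⟨x, hx⟩, (hgT ⟨x, hx⟩).symm⟩))
  have hΦ : HolNear (fun z (j : T) => g j z) q := by
    filter_upwards [eventually_all.2 hg] with z hz using contDiffAt_pi.2 hz
  have hΦq : (fun j : T => g j q) = 0 := funext hgq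
  have hH0 : H 0 = q := by
    have h5 := hHg.self_of_nhds
    rwa [hΦq] at h5
  obtain ⟨β, hβ⟩ := exists_hom (A := B) b (0 : T → ℂ) (fun j => by simpa using hb j)
  have heq : φ.comp β = π.comp (HolGerm.comp _ hΦ hΦq) := by
    refine hom_ext fun j => ?_
    have h6 : HolGerm.comp _ hΦ hΦq (HolGerm.coord 0 j) = HolGerm.mk (g j) (hg j) := rfl
    rw [AlgHom.comp_apply, AlgHom.comp_apply, hβ, hbT, h6, hgT]
  intro a
  obtain ⟨f, rfl⟩ := hπ a
  refine ⟨β (HolGerm.comp H hH hH0 f), ?_⟩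
  have h6 := AlgHom.congr_fun heq (HolGerm.comp H hH hH0 f)
  exact h6.trans (congrArg π (HolGerm.comp_comp_of_leftInverse hH hH0 hΦ hΦq hHg f))

end IsAnalyticAlg

end

section

/-! ### Morphisms of locally ringed spaces from germs -/

/-- Sections of a sheaf of rings can be glued from germs that locally come from sections. -/
theorem existsUnique_section_of_germs (T : LocallyRingedSpace.{0}) (W : Opens T)
    (γ : ∀ t : T, T.presheaf.stalk t)
    (H : ∀ t ∈ W, ∃ (V : Opens T) (_ : t ∈ V) (σ : T.presheaf.obj (op V)),
      ∀ (t' : T) (h' : t' ∈ V), T.presheaf.germ V t' h' σ = γ t') :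
    ∃! σ : T.presheaf.obj (op W), ∀ (t : T) (ht : t ∈ W), T.presheaf.germ W t ht σ = γ t := by
  choose V hV σ hσ using H
  let V' : W → Opens T := fun t => V t.1 t.2 ⊓ W
  let σ' : ∀ t : W, T.presheaf.obj (op (V' t)) := fun t =>
    T.presheaf.map (homOfLE (inf_le_left : V' t ≤ V t.1 t.2)).op (σ t.1 t.2)
  have hσ' : ∀ (t : W) (t' : T) (h' : t' ∈ V' t), T.presheaf.germ (V' t) t' h' (σ' t) = γ t' := by
    intro t t' h'
    refine (TopCat.Presheaf.germ_res_apply _ _ _ _ _).trans (hσ _ _ _ _)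
  have hu := TopCat.Sheaf.existsUnique_gluing' (T.sheaf) V' W
    (fun t => homOfLE inf_le_right)
    (fun t ht => Opens.mem_iSup.2 ⟨⟨t, ht⟩, hV t ht, ht⟩) σ' (by
      intro i j
      refine TopCat.Presheaf.section_ext T.sheaf _ _ _ fun t ht => ?_
      refine (TopCat.Presheaf.germ_res_apply _ _ _ _ _).trans ?_
      refine Eq.trans ?_ (TopCat.Presheaf.germ_res_apply _ _ _ _ _).symm
      exact (hσ' i t ht.1).trans (hσ' j t ht.2).symm)
  obtain ⟨s, hs, -⟩ := hu
  refine ⟨s, fun t ht => ?_, fun s' hs' => ?_⟩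
  · rw [← hσ' ⟨t, ht⟩ t ⟨hV t ht, ht⟩, ← hs ⟨t, ht⟩]
    exact (TopCat.Presheaf.germ_res_apply T.presheaf _ _ _ _).symm
  · refine TopCat.Presheaf.section_ext T.sheaf _ _ _ fun t ht => ?_
    refine (hs' t ht).trans ?_
    rw [← hσ' ⟨t, ht⟩ t ⟨hV t ht, ht⟩, ← hs ⟨t, ht⟩]
    exact (TopCat.Presheaf.germ_res_apply T.presheaf _ _ _ _)

/-- Morphisms of locally ringed spaces from continuous maps and local homomorphisms on the stalks
that locally map sections to sections. -/
theorem exists_lrsHom_of_germs {T R : LocallyRingedSpace.{0}} (f : T → R) (hf : Continuous f)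
    (ψ : ∀ t : T, R.presheaf.stalk (f t) →+* T.presheaf.stalk t) (hloc : ∀ t, IsLocalHom (ψ t))
    (H : ∀ (U : Opens R) (s : R.presheaf.obj (op U)) (t : T), f t ∈ U →
      ∃ (V : Opens T) (_ : t ∈ V) (σ : T.presheaf.obj (op V)), ∀ (t' : T) (h' : t' ∈ V),
        ∃ h'' : f t' ∈ U, T.presheaf.germ V t' h' σ = ψ t' (R.presheaf.germ U (f t') h'' s)) :
    ∃ h : T ⟶ R, (∀ t, h.base t = f t) ∧
      ∀ (U : Opens R) (s : R.presheaf.obj (op U)) (t : T) (ht : f t ∈ U)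
        (ht' : t ∈ (Opens.map h.base).obj U),
        T.presheaf.germ _ t ht' (h.c.app (op U) s) = ψ t (R.presheaf.germ U (f t) ht s) := by
  let F : T.toTopCat ⟶ R.toTopCat := TopCat.ofHom ⟨f, hf⟩
  have key : ∀ (U : Opens R) (s : R.presheaf.obj (op U)),
      ∃! σ : T.presheaf.obj (op ((Opens.map F).obj U)), ∀ (t : T) (ht : f t ∈ U),
        T.presheaf.germ ((Opens.map F).obj U) t ht σ =
          ψ t (R.presheaf.germ U (f t) ht s) := by
    intro U s
    classical
    obtain ⟨σ, h1, h2⟩ := existsUnique_section_of_germs T ((Opens.map F).obj U)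
      (fun t => if ht : f t ∈ U then ψ t (R.presheaf.germ U (f t) ht s) else 0) (by
        intro t ht
        obtain ⟨V, hV, σ, hσ⟩ := H U s t ht
        refine ⟨V, hV, σ, fun t' h' => ?_⟩
        obtain ⟨h'', h3⟩ := hσ t' h'
        rw [h3, dif_pos h''])
    refine ⟨σ, fun t ht => ?_, fun σ' hσ' => h2 σ' fun t ht => ?_⟩
    · exact (h1 t ht).trans (dif_pos ht)
    · have ht2 : f t ∈ U := ht
      rw [dif_pos ht2]
      exact hσ' t ht
  choose σ hσ hu using key
  let c : R.presheaf ⟶ F _* T.presheaf :=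
    { app := fun U => CommRingCat.ofHom
        { toFun := σ U.unop
          map_one' := (hu _ _ _ fun t ht => by rw [map_one, map_one, map_one]).symm
          map_zero' := (hu _ _ _ fun t ht => by rw [map_zero, map_zero, map_zero]).symm
          map_mul' := fun a b => (hu _ _ _ fun t ht => by
            rw [map_mul, map_mul, map_mul, hσ _ _ t ht, hσ _ _ t ht]).symm
          map_add' := fun a b => (hu _ _ _ fun t ht => by
            rw [map_add, map_add, map_add, hσ _ _ t ht, hσ _ _ t ht]).symm }
      naturality := fun U V i => by
        refine CommRingCat.hom_ext (RingHom.ext fun s => ?_)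
        refine (hu V.unop (R.presheaf.map i s) _ fun t ht => ?_).symm
        refine (TopCat.Presheaf.germ_res_apply' T.presheaf _ _ _ _).trans ?_
        refine (hσ U.unop s t (i.unop.le ht)).trans ?_
        rw [TopCat.Presheaf.germ_res_apply'] }
  let P : T.toPresheafedSpace ⟶ R.toPresheafedSpace := ⟨F, c⟩
  have hP : ∀ t, (P.stalkMap t).hom = ψ t := by
    intro t
    refine RingHom.ext fun z => ?_
    obtain ⟨U, hU, s, rfl⟩ := R.presheaf.exists_germ_eq z
    have h1 := ConcreteCategory.congr_hom (PresheafedSpace.stalkMap_germ P U t hU) s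
    exact h1.trans (hσ U s t hU)
  refine ⟨⟨P, fun t => ?_⟩, fun t => rfl, fun U s t ht ht' => hσ U s t ht⟩
  rw [hP]
  exact hloc t

theorem lrsHom_ext_of_germs {T R : LocallyRingedSpace.{0}} {h₁ h₂ : T ⟶ R}
    (hb : ∀ t, h₁.base t = h₂.base t)
    (hs : ∀ (U : Opens R) (s : R.presheaf.obj (op U)) (t : T)
      (ht : t ∈ (Opens.map h₁.base).obj U) (ht' : t ∈ (Opens.map h₂.base).obj U),
      T.presheaf.germ _ t ht (h₁.c.app (op U) s) = T.presheaf.germ _ t ht' (h₂.c.app (op U) s)) :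
    h₁ = h₂ := by
  obtain ⟨⟨F, c⟩, p⟩ := h₁
  obtain ⟨⟨F', c'⟩, p'⟩ := h₂
  obtain rfl : F = F' := by
    ext t
    exact hb t
  obtain rfl : c = c' := by
    refine NatTrans.ext (funext fun U => CommRingCat.hom_ext (RingHom.ext fun s => ?_))
    exact TopCat.Presheaf.section_ext T.sheaf _ _ _ fun t ht => hs U.unop s t ht ht
  rfl

theorem lrs_stalkMap_germ {T R : LocallyRingedSpace.{0}} (h : T ⟶ R) (U : Opens R)
    (s : R.presheaf.obj (op U)) (t : T) (ht : h.base t ∈ U) :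
    h.stalkMap t (R.presheaf.germ U (h.base t) ht s) =
      T.presheaf.germ ((Opens.map h.base).obj U) t ht (h.c.app (op U) s) :=
  ConcreteCategory.congr_hom (PresheafedSpace.stalkMap_germ h.toHom U t ht) s

/-- The constant germs at a point of a locally ringed space over `Spec ℂ`. -/
def constOf {X : LocallyRingedSpace.{0}} (a : X ⟶ specC) (x : X) : ℂ →+* X.presheaf.stalk x :=
  (StructureSheaf.toStalk ℂ (a.base x) ≫ a.stalkMap x).hom

theorem constOf_toSpecC (X : LocallyRingedSpace.{0}) (φ : ℂ →+* X.presheaf.obj (op ⊤)) (x : X)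
    (c : ℂ) : constOf (toSpecC X φ) x c = X.presheaf.germ ⊤ x trivial (φ c) :=
  congrArg (fun t => t.hom c) (toStalk_toSpecC X φ x)

theorem constOf_comp {X Y : LocallyRingedSpace.{0}} (f : X ⟶ Y) (a : Y ⟶ specC) (x : X) (c : ℂ) :
    constOf (f ≫ a) x c = f.stalkMap x (constOf a (f.base x) c) := by
  have h := LocallyRingedSpace.stalkMap_comp f a x
  exact congrArg (fun t => (StructureSheaf.toStalk ℂ _ ≫ t).hom c) h

theorem eq_of_constOf_eq {X : LocallyRingedSpace.{0}} {a b : X ⟶ specC}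
    (h : ∀ x, constOf a x = constOf b x) : a = b := by
  have hY : Unique specC.carrier := inferInstanceAs (Unique (PrimeSpectrum ℂ))
  refine lrsHom_ext_of_germs (fun t => hY.instSubsingleton.elim _ _) fun U s t ht ht' => ?_
  obtain ⟨z, hz⟩ := toStalk_surjective _ (specC.presheaf.germ U (a.base t) ht s)
  have hz' : StructureSheaf.toStalk ℂ (b.base t) z = specC.presheaf.germ U (b.base t) ht' s := by
    have hab : a.base t = b.base t := hY.instSubsingleton.elim _ _
    have aux : ∀ (q : specC) (hq : a.base t = q) (hm : q ∈ U),
        StructureSheaf.toStalk ℂ q z = specC.presheaf.germ U q hm s := by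
      rintro _ rfl hm
      exact hz
    exact aux _ hab ht'
  refine (lrs_stalkMap_germ a U s t ht).symm.trans (Eq.trans ?_ (lrs_stalkMap_germ b U s t ht'))
  refine (congrArg (a.stalkMap t) hz).symm.trans (Eq.trans ?_ (congrArg (b.stalkMap t) hz'))
  exact RingHom.congr_fun (h t) z

end

section

/-! ### Stalks over `Spec ℂ` -/

/-- The stalk `𝒪_{Z,x}`, as a `ℂ`-algebra. -/
def Stk (Z : Over specC) (x : Z.left) : Type := Z.left.presheaf.stalk x

namespace Stk

instance (Z : Over specC) (x : Z.left) : CommRing (Stk Z x) :=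
  inferInstanceAs (CommRing (Z.left.presheaf.stalk x))

instance (Z : Over specC) (x : Z.left) : IsLocalRing (Stk Z x) :=
  inferInstanceAs (IsLocalRing (Z.left.presheaf.stalk x))

instance (Z : Over specC) (x : Z.left) : Algebra ℂ (Stk Z x) := (constOf Z.hom x).toAlgebra

/-- The germ of a function. -/
def germ {Z : Over specC} {U : Opens Z.left} (x : Z.left) (hx : x ∈ U) :
    Z.left.presheaf.obj (op U) →+* Stk Z x :=
  (Z.left.presheaf.germ U x hx).hom

/-- The pullback of germs. -/
def map {T R : Over specC} (h : T ⟶ R) (t : T.left) : Stk R (h.left.base t) →ₐ[ℂ] Stk T t :=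
  { toRingHom := (h.left.stalkMap t).hom
    commutes' := fun c => by
      have aux : ∀ p : T.left ⟶ specC, h.left ≫ R.hom = p →
          h.left.stalkMap t (constOf R.hom (h.left.base t) c) = constOf p t c := by
        rintro _ rfl
        exact (constOf_comp _ _ _ _).symm
      exact aux T.hom (Over.w h) }

variable {Z T R : Over specC}

theorem exists_germ (x : Z.left) (a : Stk Z x) :
    ∃ (U : Opens Z.left) (hx : x ∈ U) (s : Z.left.presheaf.obj (op U)), germ x hx s = a :=
  Z.left.presheaf.exists_germ_eq a

theorem map_germ (h : T ⟶ R) (U : Opens R.left) (s : R.left.presheaf.obj (op U)) (t : T.left)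
    (ht : h.left.base t ∈ U) :
    map h t (germ (h.left.base t) ht s) =
      germ (U := (Opens.map h.left.base).obj U) t ht (h.left.c.app (op U) s) :=
  lrs_stalkMap_germ h.left U s t ht

theorem map_comp {S : Over specC} (h : T ⟶ R) (k : R ⟶ S) (t : T.left)
    (a : Stk S (k.left.base (h.left.base t))) :
    map (h ≫ k) t a = map h t (map k (h.left.base t) a) :=
  congrArg (fun f => f.hom a) (LocallyRingedSpace.stalkMap_comp h.left k.left t)

end Stk

/-- Morphisms over `Spec ℂ` from continuous maps and local homomorphisms on the stalks that locally
map sections to sections. -/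
theorem exists_overHom_of_germs {T R : Over specC} (f : T.left → R.left) (hf : Continuous f)
    (ψ : ∀ t : T.left, Stk R (f t) →ₐ[ℂ] Stk T t) (hloc : ∀ t a, IsUnit (ψ t a) → IsUnit a)
    (H : ∀ (U : Opens R.left) (s : R.left.presheaf.obj (op U)) (t : T.left), f t ∈ U →
      ∃ (V : Opens T.left) (_ : t ∈ V) (σ : T.left.presheaf.obj (op V)),
        ∀ (t' : T.left) (h' : t' ∈ V),
          ∃ h'' : f t' ∈ U, Stk.germ t' h' σ = ψ t' (Stk.germ (f t') h'' s)) :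
    ∃ h : T ⟶ R, (∀ t, h.left.base t = f t) ∧
      ∀ (U : Opens R.left) (s : R.left.presheaf.obj (op U)) (t : T.left) (ht : f t ∈ U)
        (ht' : t ∈ (Opens.map h.left.base).obj U),
        Stk.germ t ht' (h.left.c.app (op U) s) = ψ t (Stk.germ (f t) ht s) := by
  obtain ⟨h, h1, h2⟩ := exists_lrsHom_of_germs f hf (fun t => (ψ t).toRingHom)
    (fun t => ⟨fun a => hloc t a⟩) H
  refine ⟨Over.homMk h (eq_of_constOf_eq fun t => RingHom.ext fun c => ?_), h1, h2⟩
  rw [constOf_comp]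
  have h3 : ∀ (q : R.left) (hq : h.base t = q) (a : ∀ q, Stk R q) (χ : Stk R q →+* Stk T t)
      (_ : ∀ (U : Opens R.left) (s : R.left.presheaf.obj (op U)) (hU : q ∈ U)
        (ht' : t ∈ (Opens.map h.base).obj U),
        Stk.germ (Z := T) t ht' (h.c.app (op U) s) = χ (Stk.germ q hU s)),
      h.stalkMap t (a (h.base t)) = χ (a q) := by
    rintro _ rfl a χ hχ
    obtain ⟨U, hU, s, hs⟩ := Stk.exists_germ (Z := R) (h.base t) (a (h.base t))
    have h4 := hχ U s hU hU
    rw [← hs]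
    refine Eq.trans ?_ h4
    exact lrs_stalkMap_germ h U s t hU
  refine (h3 (f t) (h1 t) (fun q => constOf R.hom q c) (ψ t).toRingHom
    fun U s hU ht' => h2 U s t hU ht').trans ?_
  exact (ψ t).commutes c

theorem overHom_ext_of_germs {T R : Over specC} {h₁ h₂ : T ⟶ R}
    (hb : ∀ t, h₁.left.base t = h₂.left.base t)
    (hs : ∀ (U : Opens R.left) (s : R.left.presheaf.obj (op U)) (t : T.left)
      (ht : t ∈ (Opens.map h₁.left.base).obj U) (ht' : t ∈ (Opens.map h₂.left.base).obj U),
      Stk.germ t ht (h₁.left.c.app (op U) s) = Stk.germ t ht' (h₂.left.c.app (op U) s)) :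
    h₁ = h₂ :=
  Over.OverMorphism.ext (lrsHom_ext_of_germs hb hs)

/-! ### Germs of holomorphic functions on `ℂⁿ` -/

section affine

variable {n : ℕ}

/-- A holomorphic function on `D ⊆ ℂⁿ`, extended by zero. -/
def HolFun.ext {D : Opens (Fin n → ℂ)} (f : HolFun n D) (z : Fin n → ℂ) : ℂ :=
  open Classical in if h : z ∈ D then f ⟨z, h⟩ else 0

theorem HolFun.ext_apply {D : Opens (Fin n → ℂ)} (f : HolFun n D) {z : Fin n → ℂ} (h : z ∈ D) :
    f.ext z = f ⟨z, h⟩ := dif_pos h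

theorem HolFun.holNear_ext {D : Opens (Fin n → ℂ)} (f : HolFun n D) {z : Fin n → ℂ} (h : z ∈ D) :
    HolNear f.ext z := by
  filter_upwards [D.isOpen.mem_nhds h] with w hw
  have h1 : ContMDiffAt 𝓘(ℂ, Fin n → ℂ) 𝓘(ℂ) ∞ (fun x : D => f.ext x) ⟨w, hw⟩ := by
    have h2 : (fun x : D => f.ext x) = f := funext fun x => f.ext_apply x.2
    rw [h2]
    exact f.contMDiff.contMDiffAt
  exact (contMDiffAt_subtype_iff.1 h1).contDiffAt

/-- A function that is holomorphic at the points of `D`, as a section on `D`. -/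
def HolFun.of {D : Opens (Fin n → ℂ)} (F : (Fin n → ℂ) → ℂ) (h : ∀ z ∈ D, ContDiffAt ℂ ∞ F z) :
    HolFun n D :=
  ⟨fun z => F z, fun z => contMDiffAt_subtype_iff.2 (h z z.2).contMDiffAt⟩

/-- The germ of a section of the sheaf of holomorphic functions. -/
def affineGermHom (D : Opens (Fin n → ℂ)) (p : Fin n → ℂ) (hp : p ∈ D) :
    HolFun n D →+* HolGerm (Fin n → ℂ) p where
  toFun f := HolGerm.mk f.ext (f.holNear_ext hp)
  map_one' := Subtype.ext <| Filter.Germ.coe_eq.2 <| by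
    filter_upwards [D.isOpen.mem_nhds hp] with z hz
    rw [HolFun.ext_apply _ hz]; rfl
  map_zero' := Subtype.ext <| Filter.Germ.coe_eq.2 <| by
    filter_upwards [D.isOpen.mem_nhds hp] with z hz
    rw [HolFun.ext_apply _ hz]; rfl
  map_mul' f g := Subtype.ext <| Filter.Germ.coe_eq.2 <| by
    filter_upwards [D.isOpen.mem_nhds hp] with z hz
    rw [HolFun.ext_apply _ hz, HolFun.ext_apply _ hz, HolFun.ext_apply _ hz]; rfl
  map_add' f g := Subtype.ext <| Filter.Germ.coe_eq.2 <| by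
    filter_upwards [D.isOpen.mem_nhds hp] with z hz
    rw [HolFun.ext_apply _ hz, HolFun.ext_apply _ hz, HolFun.ext_apply _ hz]; rfl

end affine

end

section

/-! ### The stalks of `ℂⁿ` -/

section affine

variable {n : ℕ}

/-- A point of `ℂⁿ`, as a point of the locally ringed space. -/
def affinePt {n : ℕ} (p : Fin n → ℂ) : (affineOver n).left := p

theorem affineGermHom_eq_mk_iff {D : Opens (Fin n → ℂ)} {p : Fin n → ℂ} {hp : p ∈ D}
    {f : HolFun n D} {F : (Fin n → ℂ) → ℂ} {hF : HolNear F p} :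
    affineGermHom D p hp f = HolGerm.mk F hF ↔ f.ext =ᶠ[𝓝 p] F :=
  HolGerm.mk_eq_mk (hf := f.holNear_ext hp)

theorem affineGermHom_res {D D' : Opens (Fin n → ℂ)} (h : D' ≤ D) (p : Fin n → ℂ) (hp : p ∈ D')
    (f : (affineLRS n).presheaf.obj (op D)) :
    affineGermHom D' p hp ((affineLRS n).presheaf.map (homOfLE h).op f) =
      affineGermHom D p (h hp) f := by
  refine (affineGermHom_eq_mk_iff (hF := HolFun.holNear_ext (D := D) f (h hp))).2 ?_
  filter_upwards [D'.isOpen.mem_nhds hp] with z hz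
  exact (HolFun.ext_apply (D := D') _ hz).trans (HolFun.ext_apply (D := D) f (h hz)).symm

/-- The germs at `p` of sections of the sheaf of holomorphic functions, as germs of functions. -/
theorem exists_affineStk (n : ℕ) (p : Fin n → ℂ) :
    ∃ χ : Stk (affineOver n) (affinePt p) →+* HolGerm (Fin n → ℂ) p,
      ∀ (D : Opens (Fin n → ℂ)) (hp : p ∈ D) (f : HolFun n D),
        χ (Stk.germ (Z := affineOver n) (U := D) (affinePt p) hp f) = affineGermHom D p hp f := by
  let F := (affineLRS n).presheaf
  let c : Limits.Cocone ((OpenNhds.inclusion (X := (affineLRS n).toTopCat) p).op ⋙ F) :=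
    { pt := CommRingCat.of (HolGerm (Fin n → ℂ) p)
      ι :=
      { app := fun U => CommRingCat.ofHom (affineGermHom U.unop.1 p U.unop.2)
        naturality := fun U V i => by
          refine CommRingCat.hom_ext (RingHom.ext fun f => ?_)
          exact affineGermHom_res i.unop.le p V.unop.2 f } }
  refine ⟨(Limits.colimit.desc _ c).hom, fun D hp f => ?_⟩
  have h := Limits.colimit.ι_desc c (op ⟨D, hp⟩)
  exact congrArg (fun t => t.hom f) h

/-- The homomorphism from the stalk of `ℂⁿ` to the ring of germs of holomorphic functions. -/
def affineStkHom (n : ℕ) (p : Fin n → ℂ) :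
    Stk (affineOver n) (affinePt p) →ₐ[ℂ] HolGerm (Fin n → ℂ) p :=
  { (exists_affineStk n p).choose with
    commutes' := fun c => by
      have h := constOf_toSpecC (affineLRS n) (affineConst n) p c
      refine (congrArg (exists_affineStk n p).choose h).trans ?_
      refine ((exists_affineStk n p).choose_spec ⊤ trivial _).trans ?_
      refine (affineGermHom_eq_mk_iff (hF := Eventually.of_forall fun _ => contDiffAt_const)).2
        (Eventually.of_forall fun z => ?_)
      exact HolFun.ext_apply (D := ⊤) _ (Opens.mem_top z) }

theorem affineStkHom_germ (D : Opens (Fin n → ℂ)) (p : Fin n → ℂ) (hp : p ∈ D) (f : HolFun n D) :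
    affineStkHom n p (Stk.germ (Z := affineOver n) (U := D) (affinePt p) hp f) =
      affineGermHom D p hp f :=
  (exists_affineStk n p).choose_spec D hp f

theorem HolNear.exists_holFun {p : Fin n → ℂ} {F : (Fin n → ℂ) → ℂ} (hF : HolNear F p) :
    ∃ (D : Opens (Fin n → ℂ)) (_ : p ∈ D), ∀ z ∈ D, ContDiffAt ℂ ∞ F z := by
  obtain ⟨t, ht, ho, hp⟩ := _root_.eventually_nhds_iff.1 hF
  exact ⟨⟨t, ho⟩, hp, ht⟩

theorem affineGermHom_of {D : Opens (Fin n → ℂ)} (F : (Fin n → ℂ) → ℂ)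
    (h : ∀ z ∈ D, ContDiffAt ℂ ∞ F z) (p : Fin n → ℂ) (hp : p ∈ D) (hF : HolNear F p) :
    affineGermHom D p hp (HolFun.of F h) = HolGerm.mk F hF := by
  refine affineGermHom_eq_mk_iff.2 ?_
  filter_upwards [D.isOpen.mem_nhds hp] with z hz
  exact HolFun.ext_apply _ hz

theorem affineStkHom_bijective (p : Fin n → ℂ) : Function.Bijective (affineStkHom n p) := by
  constructor
  · refine (injective_iff_map_eq_zero _).2 fun a ha => ?_
    obtain ⟨D, hp, f, rfl⟩ := Stk.exists_germ (Z := affineOver n) (affinePt p) a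
    have h1 := (affineStkHom_germ D p hp f).symm.trans ha
    obtain ⟨t, ht, ho, hpt⟩ := _root_.eventually_nhds_iff.1
      (Filter.Germ.coe_eq.1 (congrArg Subtype.val h1))
    let D' : Opens (Fin n → ℂ) := ⟨t, ho⟩ ⊓ D
    have h2 : (affineLRS n).presheaf.map (homOfLE (inf_le_right : D' ≤ D)).op f = 0 := by
      refine ContMDiffMap.ext (f := ((affineLRS n).presheaf.map
        (homOfLE (inf_le_right : D' ≤ D)).op f : HolFun n D')) (g := (0 : HolFun n D')) fun z => ?_
      exact (HolFun.ext_apply f z.2.2).symm.trans (ht z z.2.1)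
    have h3 := TopCat.Presheaf.germ_res_apply (affineLRS n).presheaf
      (homOfLE (inf_le_right : D' ≤ D)) p ⟨hpt, hp⟩ f
    rw [h2, map_zero] at h3
    exact h3.symm
  · intro a
    obtain ⟨F, hF, rfl⟩ := HolGerm.exists_mk a
    obtain ⟨D, hp, hD⟩ := hF.exists_holFun
    exact ⟨Stk.germ (Z := affineOver n) (U := D) (affinePt p) hp (HolFun.of F hD),
      (affineStkHom_germ _ _ _ _).trans (affineGermHom_of _ _ _ _ _)⟩

/-- The stalks of `ℂⁿ` are the rings of germs of holomorphic functions. -/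
def affineStk (n : ℕ) (p : Fin n → ℂ) :
    Stk (affineOver n) (affinePt p) ≃ₐ[ℂ] HolGerm (Fin n → ℂ) p :=
  AlgEquiv.ofBijective (affineStkHom n p) (affineStkHom_bijective p)

/-- The coordinates of a point of the locally ringed space `ℂⁿ`. -/
def affineCoord {n : ℕ} (q : (affineOver n).left) : Fin n → ℂ := q

/-- The isomorphism `affineStk`, at a point of the locally ringed space. -/
def affineStk' (q : (affineOver n).left) :
    Stk (affineOver n) q ≃ₐ[ℂ] HolGerm (Fin n → ℂ) (affineCoord q) :=
  affineStk n q

theorem affineStk'_germ (D : Opens (Fin n → ℂ)) (q : (affineOver n).left) (hp : affineCoord q ∈ D)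
    (f : HolFun n D) :
    affineStk' q (Stk.germ (Z := affineOver n) (U := D) q hp f) =
      HolGerm.mk f.ext (f.holNear_ext hp) :=
  affineStkHom_germ D q hp f

theorem affineStk'_germ_of {D : Opens (Fin n → ℂ)} (F : (Fin n → ℂ) → ℂ)
    (h : ∀ z ∈ D, ContDiffAt ℂ ∞ F z) (q : (affineOver n).left) (hp : affineCoord q ∈ D)
    (hF : HolNear F (affineCoord q)) :
    affineStk' q (Stk.germ (Z := affineOver n) (U := D) q hp (HolFun.of F h)) = HolGerm.mk F hF :=
  (affineStkHom_germ D q hp _).trans (affineGermHom_of F h _ hp hF)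

theorem affineStk_germ (D : Opens (Fin n → ℂ)) (p : Fin n → ℂ) (hp : p ∈ D) (f : HolFun n D) :
    affineStk n p (Stk.germ (Z := affineOver n) (U := D) (affinePt p) hp f) =
      HolGerm.mk f.ext (f.holNear_ext hp) :=
  affineStkHom_germ D p hp f

end affine

/-! ### Open subspaces -/

/-- The inclusion of an open subspace. -/
def openIncl (X : Over specC) (U : Opens X.left) : restrictOver X U ⟶ X :=
  Over.homMk (X.left.ofRestrict U.isOpenEmbedding) rfl

theorem openIncl_map_bijective (X : Over specC) (U : Opens X.left)
    (x : (restrictOver X U).left) : Function.Bijective (Stk.map (openIncl X U) x) :=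
  (ConcreteCategory.isIso_iff_bijective _).1
    (LocallyRingedSpace.ofRestrict_stalkMap_isIso X.left U.isOpenEmbedding x)

theorem openIncl_isOpenEmbedding (X : Over specC) (U : Opens X.left) :
    Topology.IsOpenEmbedding (openIncl X U).left.base := U.isOpenEmbedding

/-- A point of `U` as a point of the open subspace. -/
def openPt {X : Over specC} {U : Opens X.left} (x : U) : (restrictOver X U).left := x

/-- The identification of the stalks of an open subspace. -/
def openStk (X : Over specC) (U : Opens X.left) (x : U) :
    Stk X x.1 ≃ₐ[ℂ] Stk (restrictOver X U) (openPt x) :=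
  AlgEquiv.ofBijective
    (show Stk X x.1 →ₐ[ℂ] Stk (restrictOver X U) (openPt x) from Stk.map (openIncl X U) (openPt x))
    (openIncl_map_bijective X U x)

/-- Sections on an open subspace come from sections on the ambient space. -/
theorem openIncl_exists_section (X : Over specC) (U : Opens X.left)
    (V : Opens (restrictOver X U).left) (σ : (restrictOver X U).left.presheaf.obj (op V)) :
    ∃ (V' : Opens X.left) (s : X.left.presheaf.obj (op V')),
      (∀ x, (openIncl X U).left.base x ∈ V' ↔ x ∈ V) ∧ V' ≤ U ∧
      ∀ (x : (restrictOver X U).left) (hx : x ∈ V) (hx' : (openIncl X U).left.base x ∈ V'),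
        Stk.map (openIncl X U) x (Stk.germ _ hx' s) = Stk.germ x hx σ := by
  refine ⟨U.isOpenEmbedding.functor.obj V, σ, fun x => ?_, ?_, fun x hx hx' => ?_⟩
  · exact Function.Injective.mem_set_image U.isOpenEmbedding.injective
  · rintro _ ⟨y, _, rfl⟩
    exact y.2
  · refine (Stk.map_germ _ _ _ _ _).trans ?_
    exact TopCat.Presheaf.germ_res_apply' (restrictOver X U).left.presheaf
      (U := (Opens.map (openIncl X U).left.base).obj (U.isOpenEmbedding.functor.obj V)) (V := V)
      (eqToHom (congrArg op (Opens.map_functor_eq' _ U.isOpenEmbedding V).symm)) x hx' σ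

end

section

/-! ### Charts -/

/-- A local model of a space over `Spec ℂ`, in terms of stalks: an open set `U` with a topological
embedding `w : U → ℂⁿ` onto `{z ∈ D | f₁ z = ⋯ = f_k z = 0}` and surjections `χ y` from the germs of
holomorphic functions at `w y` to the stalks at `y ∈ U`, with kernel generated by the germs of the
`f j`, that map holomorphic functions to sections. -/
structure Chart (X : Over specC) where
  /-- the domain -/
  U : Opens X.left
  /-- the dimension of the ambient space -/
  n : ℕ
  /-- the number of equations -/
  k : ℕ
  /-- the open subset of `ℂⁿ` on which the equations are defined -/
  D : Opens (Fin n → ℂ)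
  /-- the equations -/
  f : Fin k → (Fin n → ℂ) → ℂ
  holNear : ∀ j, ∀ z ∈ D, HolNear (f j) z
  /-- the coordinates -/
  w : U → Fin n → ℂ
  isEmbedding : Topology.IsEmbedding w
  range_eq : Set.range w = {z | z ∈ D ∧ ∀ j, f j z = 0}
  /-- the homomorphisms on the stalks -/
  χ : ∀ y : U, HolGerm (Fin n → ℂ) (w y) →ₐ[ℂ] Stk X y.1
  surjective : ∀ y, Function.Surjective (χ y)
  ker : ∀ y (hy : w y ∈ D), RingHom.ker (χ y) =
    Ideal.span (Set.range fun j => HolGerm.mk (f j) (holNear j _ hy))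
  exists_section : ∀ (y : U) (F : (Fin n → ℂ) → ℂ), HolNear F (w y) →
    ∃ (V : Opens X.left) (hVU : V ≤ U) (_ : y.1 ∈ V) (s : X.left.presheaf.obj (op V)),
      ∀ (y' : X.left) (hy' : y' ∈ V), ∃ hF' : HolNear F (w ⟨y', hVU hy'⟩),
        Stk.germ y' hy' s = χ ⟨y', hVU hy'⟩ (HolGerm.mk F hF')

namespace Chart

theorem w_mem {X : Over specC} (c : Chart X) (y : c.U) : c.w y ∈ c.D :=
  (c.range_eq ▸ Set.mem_range_self y : c.w y ∈ {z | z ∈ c.D ∧ ∀ j, c.f j z = 0}).1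

theorem _root_.IteratedMultiplePoints.ker_comp_of_algEquiv {A B C D : Type} [CommRing A]
    [CommRing B] [CommRing C] [CommRing D] [Algebra ℂ A] [Algebra ℂ B] [Algebra ℂ C] [Algebra ℂ D]
    (e : B ≃ₐ[ℂ] A) (m : B →ₐ[ℂ] C) (e' : C ≃ₐ[ℂ] D) {κ : Type} (g : κ → B)
    (h : RingHom.ker m = Ideal.span (Set.range g)) :
    RingHom.ker ((e' : C →ₐ[ℂ] D).comp (m.comp (e.symm : A →ₐ[ℂ] B))) =
      Ideal.span (Set.range fun j => e (g j)) := by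
  have h2 : Set.range (fun j => e (g j)) = e '' Set.range g := Set.range_comp _ _
  rw [h2]
  refine Eq.trans ?_ (Ideal.map_span e (Set.range g))
  rw [← h]
  ext a
  rw [RingHom.mem_ker]
  change e' (m (e.symm a)) = 0 ↔ _
  rw [map_eq_zero_iff _ e'.injective]
  refine ⟨fun ha => ?_, fun ha => ?_⟩
  · have := Ideal.mem_map_of_mem e (RingHom.mem_ker.2 ha)
    rwa [AlgEquiv.apply_symm_apply] at this
  · obtain ⟨b, hb, rfl⟩ := (Ideal.mem_map_iff_of_surjective _ e.surjective).1 ha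
    rw [AlgEquiv.symm_apply_apply]
    exact RingHom.mem_ker.1 hb

theorem exists_of_isLocalModel {X : Over specC} {U : Opens X.left} {n k : ℕ}
    {i : restrictOver X U ⟶ affineOver n} {D : Opens (Fin n → ℂ)} {f : Fin k → HolFun n D}
    (h : IsLocalModel i D f) : ∃ c : Chart X, c.U = U := by
  have hD : ∀ y : U, affineCoord (i.left.base (openPt y)) ∈ D := fun y => by
    have h1 : i.left.base y ∈ Set.range i.left.base := Set.mem_range_self _
    rw [h.range_eq] at h1
    exact h1.1
  refine ⟨⟨U, n, k, D, fun j => (f j).ext, fun j z hz => (f j).holNear_ext hz,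
    fun y => affineCoord (i.left.base (openPt y)), h.isEmbedding, ?_,
    fun y => ((openStk X U y).symm : Stk (restrictOver X U) (openPt y) →ₐ[ℂ] Stk X y.1).comp
      ((Stk.map i (openPt y)).comp ((affineStk' (i.left.base (openPt y))).symm :
        HolGerm (Fin n → ℂ) (affineCoord (i.left.base (openPt y))) →ₐ[ℂ]
          Stk (affineOver n) (i.left.base (openPt y)))),
    ?_, ?_, ?_⟩, rfl⟩
  · refine h.range_eq.trans (Set.ext fun z => ⟨?_, ?_⟩)
    · rintro ⟨hz, h1⟩
      exact ⟨hz, fun j => ((f j).ext_apply hz).trans (h1 j)⟩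
    · rintro ⟨hz, h1⟩
      exact ⟨hz, fun j => ((f j).ext_apply hz).symm.trans (h1 j)⟩
  · intro y
    exact (openStk X U y).symm.surjective.comp
      ((h.stalk_surjective y).comp (affineStk' (i.left.base (openPt y))).symm.surjective)
  · intro y hy
    have h1 : RingHom.ker (Stk.map i (openPt y)) = Ideal.span (Set.range fun j =>
        Stk.germ (Z := affineOver n) (U := D) (i.left.base (openPt y)) (hD y) (f j)) :=
      h.stalk_ker y (hD y)
    refine (ker_comp_of_algEquiv _ _ _ _ h1).trans ?_
    refine congrArg (fun t => Ideal.span (Set.range t)) (funext fun j => ?_)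
    exact affineStk'_germ D _ hy (f j)
  · intro y F hF
    obtain ⟨Ω, hy, hΩ⟩ := hF.exists_holFun
    obtain ⟨V, s, hV, hVU, hs⟩ := openIncl_exists_section X U ((Opens.map i.left.base).obj Ω)
      (i.left.c.app (op Ω) (HolFun.of F hΩ))
    refine ⟨V, hVU, (hV y).2 hy, s, fun y' hy' => ?_⟩
    have h5 : affineCoord (i.left.base (openPt ⟨y', hVU hy'⟩)) ∈ Ω := (hV ⟨y', hVU hy'⟩).1 hy'
    have h6 : HolNear F (affineCoord (i.left.base (openPt ⟨y', hVU hy'⟩))) := by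
      filter_upwards [Ω.isOpen.mem_nhds h5] with z hz using hΩ z hz
    refine ⟨h6, ?_⟩
    have h7 := hs (openPt ⟨y', hVU hy'⟩) h5 hy'
    have h8 := Stk.map_germ i Ω (HolFun.of F hΩ) (openPt ⟨y', hVU hy'⟩) h5
    have h9 : (affineStk' (i.left.base (openPt ⟨y', hVU hy'⟩))).symm (HolGerm.mk F h6) =
        Stk.germ (Z := affineOver n) (U := Ω) (i.left.base (openPt ⟨y', hVU hy'⟩)) h5
          (HolFun.of F hΩ) := by
      rw [AlgEquiv.symm_apply_eq]
      exact (affineStk'_germ_of F hΩ _ h5 h6).symm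
    change _ = (openStk X U ⟨y', hVU hy'⟩).symm (Stk.map i _
      ((affineStk' (i.left.base (openPt ⟨y', hVU hy'⟩))).symm (HolGerm.mk F h6)))
    rw [h9, AlgEquiv.eq_symm_apply]
    exact h7.trans h8.symm

/-- The homomorphisms on the stalks of the morphism given by a chart. -/
def stkHom {X : Over specC} (c : Chart X) (y : c.U) :
    Stk (affineOver c.n) (affinePt (c.w y)) →ₐ[ℂ] Stk (restrictOver X c.U) (openPt y) :=
  (openStk X c.U y : Stk X y.1 →ₐ[ℂ] Stk (restrictOver X c.U) (openPt y)).comp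
    ((c.χ y).comp (affineStk c.n (c.w y)))

theorem stkHom_surjective {X : Over specC} (c : Chart X) (y : c.U) :
    Function.Surjective (c.stkHom y) :=
  (openStk X c.U y).surjective.comp ((c.surjective y).comp (affineStk c.n (c.w y)).surjective)

theorem exists_hom {X : Over specC} (c : Chart X) :
    ∃ i : restrictOver X c.U ⟶ affineOver c.n, (∀ y : c.U, i.left.base y = affinePt (c.w y)) ∧
      ∀ (Ω : Opens (Fin c.n → ℂ)) (s : (affineOver c.n).left.presheaf.obj (op Ω)) (y : c.U)
        (hy : c.w y ∈ Ω) (hy' : openPt y ∈ (Opens.map i.left.base).obj Ω),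
        Stk.germ (Z := restrictOver X c.U) (openPt y) hy' (i.left.c.app (op Ω) s) =
          c.stkHom y (Stk.germ (Z := affineOver c.n) (affinePt (c.w y)) hy s) := by
  refine exists_overHom_of_germs (T := restrictOver X c.U) (R := affineOver c.n)
    c.w c.isEmbedding.continuous c.stkHom
    (fun y a => (c.stkHom_surjective y).isLocalHom.map_nonunit a) ?_
  intro (Ω : Opens (Fin c.n → ℂ)) s y hy
  obtain ⟨V, hVU, hyV, σ, hσ⟩ := c.exists_section y (HolFun.ext (D := Ω) s)
    (HolFun.holNear_ext (D := Ω) s hy)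
  refine ⟨(Opens.map (openIncl X c.U).left.base).obj V ⊓ ⟨c.w ⁻¹' Ω,
    Ω.isOpen.preimage c.isEmbedding.continuous⟩, ⟨hyV, hy⟩,
    (restrictOver X c.U).left.presheaf.map (homOfLE inf_le_left).op
      ((openIncl X c.U).left.c.app (op V) σ), fun y' hy' => ⟨hy'.2, ?_⟩⟩
  obtain ⟨hF', h1⟩ := hσ y'.1 hy'.1
  have h2 := Stk.map_germ (openIncl X c.U) V σ y' hy'.1
  refine (TopCat.Presheaf.germ_res_apply (restrictOver X c.U).left.presheaf
    (homOfLE inf_le_left) y' hy' _).trans ?_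
  refine h2.symm.trans ?_
  have h3 := affineStk_germ Ω (c.w y') hy'.2 s
  change _ = openStk X c.U y' (c.χ y' (affineStk c.n (c.w y') _))
  refine Eq.trans ?_ (congrArg (fun t => openStk X c.U y' (c.χ y' t)) h3).symm
  exact congrArg (openStk X c.U y') h1

theorem isLocalModel {X : Over specC} (c : Chart X) :
    ∃ (f : Fin c.k → HolFun c.n c.D)
      (i : restrictOver X c.U ⟶ affineOver c.n), IsLocalModel i c.D f := by
  obtain ⟨i, hi, hi'⟩ := c.exists_hom
  have hiw : (i.left.base : c.U → Fin c.n → ℂ) = c.w := funext hi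
  have hmap : ∀ (y : c.U) (q : (affineOver c.n).left) (hq : i.left.base (openPt y) = q)
      (φ : Stk (affineOver c.n) q →ₐ[ℂ] Stk (restrictOver X c.U) (openPt y))
      (_ : ∀ (Ω : Opens (Fin c.n → ℂ)) (s : (affineOver c.n).left.presheaf.obj (op Ω))
        (hy : q ∈ Ω) (hy' : openPt y ∈ (Opens.map i.left.base).obj Ω),
        Stk.germ (Z := restrictOver X c.U) (openPt y) hy' (i.left.c.app (op Ω) s) =
          φ (Stk.germ (Z := affineOver c.n) q hy s)),
      Function.Surjective φ →
      Function.Surjective (Stk.map i (openPt y)) ∧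
        ∀ (hx : i.left.base (openPt y) ∈ (c.D : Set (Fin c.n → ℂ)))
        (f : Fin c.k → HolFun c.n c.D) (hq : q ∈ c.D),
        RingHom.ker φ = Ideal.span (Set.range fun j =>
          Stk.germ (Z := affineOver c.n) (U := c.D) q hq (f j)) →
        RingHom.ker (Stk.map i (openPt y)) = Ideal.span (Set.range fun j =>
          Stk.germ (Z := affineOver c.n) (U := c.D) (i.left.base (openPt y)) hx (f j)) := by
    rintro y _ rfl φ hφ hs
    obtain rfl : Stk.map i (openPt y) = φ := by
      refine AlgHom.ext fun a => ?_
      obtain ⟨Ω, hy, s, rfl⟩ := Stk.exists_germ _ a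
      exact (Stk.map_germ i Ω s _ hy).trans (hφ Ω s hy hy)
    exact ⟨hs, fun hx f hq h => h⟩
  let f : Fin c.k → HolFun c.n c.D := fun j => HolFun.of (c.f j) fun z hz =>
    (c.holNear j z hz).contDiffAt
  have hk : ∀ y : c.U, RingHom.ker (c.stkHom y) = Ideal.span (Set.range fun j =>
      Stk.germ (Z := affineOver c.n) (U := c.D) (affinePt (c.w y)) (c.w_mem y) (f j)) := by
    intro y
    refine (ker_comp_of_algEquiv (affineStk c.n (c.w y)).symm (c.χ y) (openStk X c.U y) _
      (c.ker y (c.w_mem y))).trans ?_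
    refine congrArg (fun t => Ideal.span (Set.range t)) (funext fun j => ?_)
    rw [AlgEquiv.symm_apply_eq]
    exact ((affineStkHom_germ c.D _ (c.w_mem y) _).trans
      (affineGermHom_of _ _ _ (c.w_mem y) _)).symm
  refine ⟨f, i, ?_, ?_, fun y => ?_, fun y hy => ?_⟩
  · exact hiw ▸ c.isEmbedding
  · have h1 : Set.range i.left.base = Set.range c.w := congrArg Set.range hiw
    refine h1.trans (c.range_eq.trans (Set.ext fun z => ?_))
    exact ⟨fun h => ⟨h.1, h.2⟩, fun ⟨h, h'⟩ => ⟨h, h'⟩⟩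
  · exact (hmap y _ (hi y) (c.stkHom y) (fun Ω s h h' => hi' Ω s y h h')
      (c.stkHom_surjective y)).1
  · exact (hmap y _ (hi y) (c.stkHom y) (fun Ω s h h' => hi' Ω s y h h')
      (c.stkHom_surjective y)).2 hy f (c.w_mem y) (hk y)

end Chart

theorem isComplexSpace_iff_exists_chart {X : Over specC} :
    IsComplexSpace X ↔ T2Space X.left ∧ ∀ x : X.left, ∃ c : Chart X, x ∈ c.U := by
  refine and_congr_right fun _ => forall_congr' fun x => ⟨?_, ?_⟩
  · rintro ⟨U, hx, n, k, D, f, i, h⟩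
    obtain ⟨c, rfl⟩ := Chart.exists_of_isLocalModel h
    exact ⟨c, hx⟩
  · rintro ⟨c, hx⟩
    obtain ⟨f, i, h⟩ := c.isLocalModel
    exact ⟨c.U, hx, c.n, c.k, c.D, f, i, h⟩

end

section

/-! ### Open subspaces of complex spaces -/

/-- Charts restrict to open subspaces. -/
theorem Chart.exists_restrict {X : Over specC} (c : Chart X) (O : Opens X.left)
    (x : (restrictOver X O).left) (hx : (openIncl X O).left.base x ∈ c.U) :
    ∃ c' : Chart (restrictOver X O), x ∈ c'.U := by
  obtain ⟨t, ht, hwt⟩ := c.isEmbedding.isInducing.isOpen_iff.1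
    (O.isOpen.preimage (continuous_subtype_val (p := fun y => y ∈ c.U)))
  let V : Opens (restrictOver X O).left := (Opens.map (openIncl X O).left.base).obj c.U
  let r : V → c.U := fun y => ⟨(openIncl X O).left.base y.1, y.2⟩
  have hr : Topology.IsEmbedding r := by
    have h1 : Continuous r := Continuous.subtype_mk
      ((openIncl_isOpenEmbedding X O).continuous.comp continuous_subtype_val) _
    have h2 : Topology.IsEmbedding ((Subtype.val : c.U → X.left) ∘ r) :=
      (openIncl_isOpenEmbedding X O).isEmbedding.comp Topology.IsEmbedding.subtypeVal
    exact Topology.IsEmbedding.of_comp h1 continuous_subtype_val h2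
  have hrt : ∀ y : c.U, c.w y ∈ t ↔ ∃ y', r y' = y := by
    intro y
    have h1 : c.w y ∈ t ↔ y.1 ∈ O := Set.ext_iff.1 hwt y
    rw [h1]
    constructor
    · exact fun h => ⟨⟨openPt ⟨y.1, h⟩, y.2⟩, rfl⟩
    · rintro ⟨⟨y', h'⟩, rfl⟩
      exact y'.2
  refine ⟨⟨V, c.n, c.k, ⟨c.D ∩ t, c.D.isOpen.inter ht⟩, c.f, fun j z hz => c.holNear j z hz.1,
    fun y => c.w (r y), c.isEmbedding.comp hr, ?_,
    fun y => (Stk.map (openIncl X O) y.1).comp (c.χ (r y)), ?_, ?_, ?_⟩, hx⟩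
  · ext z
    constructor
    · rintro ⟨y, rfl⟩
      have h1 : c.w (r y) ∈ {z | z ∈ c.D ∧ ∀ j, c.f j z = 0} := c.range_eq ▸ Set.mem_range_self _
      exact ⟨⟨h1.1, (hrt _).2 ⟨y, rfl⟩⟩, h1.2⟩
    · rintro ⟨⟨h1, h2⟩, h3⟩
      have h4 : z ∈ Set.range c.w := c.range_eq ▸ ⟨h1, h3⟩
      obtain ⟨y, rfl⟩ := h4
      obtain ⟨y', rfl⟩ := (hrt _).1 h2
      exact ⟨y', rfl⟩
  · exact fun y => (openIncl_map_bijective X O y.1).2.comp (c.surjective _)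
  · intro y hy
    rw [← c.ker (r y) hy.1]
    ext a
    exact map_eq_zero_iff _ (openIncl_map_bijective X O y.1).1
  · intro y F hF
    obtain ⟨V', hV', hy, s, hs⟩ := c.exists_section (r y) F hF
    refine ⟨(Opens.map (openIncl X O).left.base).obj V',
      fun y' hy' => hV' hy', hy, (openIncl X O).left.c.app (op V') s, fun y' hy' => ?_⟩
    obtain ⟨hF', h1⟩ := hs _ hy'
    refine ⟨hF', ?_⟩
    exact (Stk.map_germ (openIncl X O) V' s y' hy').symm.trans (congrArg _ h1)

theorem isComplexSpace_restrictOver {X : Over specC} (hX : IsComplexSpace X) (O : Opens X.left) :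
    IsComplexSpace (restrictOver X O) := by
  rw [isComplexSpace_iff_exists_chart] at hX ⊢
  have : T2Space X.left := hX.1
  refine ⟨Topology.IsEmbedding.t2Space (Y := X.left) (openIncl_isOpenEmbedding X O).isEmbedding,
    fun x => ?_⟩
  obtain ⟨c, hc⟩ := hX.2 ((openIncl X O).left.base x)
  exact c.exists_restrict O x hc

theorem Chart.isAnalyticAlg {X : Over specC} (c : Chart X) {x : X.left} (hx : x ∈ c.U) :
    IsAnalyticAlg (Stk X x) :=
  ⟨_, _, c.χ ⟨x, hx⟩, c.surjective ⟨x, hx⟩⟩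

instance (X : ComplexSpace) (x : X.obj.left) : IsAnalyticAlg (Stk X.obj x) := by
  obtain ⟨c, hc⟩ := (isComplexSpace_iff_exists_chart.1 X.property).2 x
  exact c.isAnalyticAlg hc

/-! ### Fat points -/

/-- Artinian analytic algebras: the algebras of functions on fat points. -/
class IsFatAlg (A : Type) [CommRing A] [Algebra ℂ A] : Prop extends IsAnalyticAlg A,
    IsLocalRing A where
  nilpotent : ∃ l, IsLocalRing.maximalIdeal A ^ l = ⊥

section fat

variable (A : Type) [CommRing A] [Algebra ℂ A]

/-- The spectrum of an algebra `A`, over `Spec ℂ`. -/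
def fatOver : Over specC :=
  Over.mk (Spec.locallyRingedSpaceMap (CommRingCat.ofHom (algebraMap ℂ A)) :
    Spec.locallyRingedSpaceObj (CommRingCat.of A) ⟶ specC)

/-- The map from `A` to the stalks of its spectrum. -/
def fatStkHom (t : (fatOver A).left) : A →ₐ[ℂ] Stk (fatOver A) t :=
  { toRingHom := (StructureSheaf.toStalk A t).hom
    commutes' := fun c =>
      (congrArg (fun f => f.hom c)
        (stalkMap_toStalk (CommRingCat.ofHom (algebraMap ℂ A)) t)).symm }

/-- The constant sections of the spectrum of `A`. -/
def fatSection (U : Opens (fatOver A).left) : A →+* (fatOver A).left.presheaf.obj (op U) :=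
  algebraMap A ((structureSheafInType A A).obj.obj (op U))

theorem germ_fatSection (U : Opens (fatOver A).left) (t : (fatOver A).left) (ht : t ∈ U) (a : A) :
    Stk.germ t ht (fatSection A U a) = fatStkHom A t a :=
  StructureSheaf.algebraMap_germ_apply U t ht a

variable [IsFatAlg A]

theorem asIdeal_eq_maximalIdeal (t : PrimeSpectrum A) :
    t.asIdeal = IsLocalRing.maximalIdeal A := by
  obtain ⟨l, hl⟩ := IsFatAlg.nilpotent (A := A)
  refine le_antisymm (IsLocalRing.le_maximalIdeal t.isPrime.ne_top) ?_
  refine t.isPrime.le_of_pow_le (n := l) ?_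
  rw [hl]
  exact bot_le

theorem subsingleton_fatOver : Subsingleton (fatOver A).left :=
  ⟨fun s t => PrimeSpectrum.ext ((asIdeal_eq_maximalIdeal A s).trans
    (asIdeal_eq_maximalIdeal A t).symm)⟩

/-- The point of a fat point. -/
def fatPt : (fatOver A).left :=
  (⟨IsLocalRing.maximalIdeal A, Ideal.IsMaximal.isPrime inferInstance⟩ : PrimeSpectrum A)

theorem toStalk_bijective (t : PrimeSpectrum A) :
    Function.Bijective (StructureSheaf.toStalk A t) := by
  have h1 : t.asIdeal.primeCompl ≤ IsUnit.submonoid A := by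
    intro a ha
    by_contra h
    refine ha ?_
    rw [asIdeal_eq_maximalIdeal]
    exact (IsLocalRing.mem_maximalIdeal _).2 h
  let S := (Spec.structureSheaf A).presheaf.stalk t
  exact (IsLocalization.atUnits A t.asIdeal.primeCompl (S := S) h1).bijective

theorem fatStkHom_bijective (t : (fatOver A).left) : Function.Bijective (fatStkHom A t) :=
  toStalk_bijective A t

/-- The stalks of a fat point. -/
def fatStk (t : (fatOver A).left) : A ≃ₐ[ℂ] Stk (fatOver A) t :=
  AlgEquiv.ofBijective (fatStkHom A t) (fatStkHom_bijective A t)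

/-- The embedding of a fat point into affine space that is given by generators of `A`: the
equations are generators of the kernel, together with powers of the coordinates. -/
theorem exists_chart_fatOver : ∃ c : Chart (fatOver A), c.U = ⊤ := by
  classical
  obtain ⟨n, p, π, hπ⟩ := IsAnalyticAlg.exists_surjective (A := A)
  obtain ⟨l, hl⟩ := IsFatAlg.nilpotent (A := A)
  obtain ⟨T, hT⟩ := IsNoetherian.noetherian (RingHom.ker π)
  have h3 : ∀ x : T, ∃ F hF, (x : HolGerm (Fin n → ℂ) p) = HolGerm.mk F hF := fun x =>
    HolGerm.exists_mk _
  choose g hg hgT using h3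
  let F : T ⊕ Fin n → (Fin n → ℂ) → ℂ :=
    Sum.elim g (fun i z => (z i - p i) ^ (l + 1))
  have hF : ∀ j, HolNear (F j) p := by
    rintro (j | i)
    · exact hg j
    · exact ContDiff.holNear (((contDiff_apply ℂ ℂ i).sub contDiff_const).pow _) p
  obtain ⟨D, hp, hD⟩ : ∃ (D : Opens (Fin n → ℂ)) (_ : p ∈ D), ∀ j, ∀ z ∈ D, HolNear (F j) z := by
    obtain ⟨t, ht, ho, hp⟩ := _root_.eventually_nhds_iff.1
      (eventually_all.2 fun j => (hF j).eventually_nhds)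
    exact ⟨⟨t, ho⟩, hp, fun j z hz => ht z hz j⟩
  have hker : RingHom.ker π = Ideal.span (Set.range fun j => HolGerm.mk (F j) (hF j)) := by
    apply le_antisymm
    · rw [← hT]
      refine Ideal.span_mono fun x hx => ⟨Sum.inl ⟨x, hx⟩, (hgT ⟨x, hx⟩).symm⟩
    · refine Ideal.span_le.2 ?_
      rintro _ ⟨j | i, rfl⟩
      · have : HolGerm.mk (F (Sum.inl j)) (hF (Sum.inl j)) = j.1 := (hgT j).symm
        beta_reduce
        rw [SetLike.mem_coe, this, ← hT]
        exact Submodule.subset_span j.2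
      · have h1 : HolGerm.mk (F (Sum.inr i)) (hF (Sum.inr i)) =
            (HolGerm.coord p i - algebraMap ℂ _ (p i)) ^ (l + 1) := rfl
        beta_reduce
        rw [SetLike.mem_coe, h1, RingHom.mem_ker, map_pow, pow_succ]
        have h2 : π (HolGerm.coord p i - algebraMap ℂ _ (p i)) ∈ IsLocalRing.maximalIdeal A :=
          IsAnalyticAlg.map_mem_maximalIdeal π (HolGerm.mem_maximalIdeal.2 (sub_self (p i)))
        have h3 := Ideal.pow_mem_pow h2 l
        rw [hl, Ideal.mem_bot] at h3
        rw [h3, zero_mul]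
  let e := (Fintype.equivFin (T ⊕ Fin n)).symm
  have := subsingleton_fatOver A
  refine ⟨⟨⊤, n, Fintype.card (T ⊕ Fin n), D, fun j => F (e j), fun j => hD (e j), fun _ => p,
    Topology.IsEmbedding.of_subsingleton _, ?_,
    fun y => (fatStkHom A y.1).comp π, fun y => (fatStkHom_bijective A y.1).2.comp hπ,
    fun y hy => ?_, fun y G hG => ?_⟩, rfl⟩
  · ext z
    constructor
    · rintro ⟨y, rfl⟩
      refine ⟨hp, fun j => ?_⟩
      have h1 : HolGerm.mk (F (e j)) (hF (e j)) ∈ RingHom.ker π := by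
        rw [hker]
        exact Ideal.subset_span ⟨e j, rfl⟩
      by_contra h2
      have h3 : IsUnit (HolGerm.mk (F (e j)) (hF (e j))) := (HolGerm.isUnit_iff _).2 h2
      have h4 := h3.map π
      rw [RingHom.mem_ker.1 h1] at h4
      exact not_isUnit_zero h4
    · rintro ⟨-, h⟩
      refine ⟨⟨fatPt A, trivial⟩, funext fun i => ?_⟩
      have h1 := h (e.symm (Sum.inr i))
      rw [e.apply_symm_apply] at h1
      exact (sub_eq_zero.1 (pow_eq_zero_iff (n := l + 1) (by simp) |>.1 h1)).symm
  · have h1 : Set.range (fun j => HolGerm.mk (F (e j)) (hD (e j) p hy)) =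
        Set.range fun j => HolGerm.mk (F j) (hF j) :=
      e.surjective.range_comp (fun j => HolGerm.mk (F j) (hF j))
    rw [h1, ← hker]
    ext a
    exact map_eq_zero_iff _ (fatStkHom_bijective A y.1).1
  · refine ⟨⊤, le_rfl, trivial, fatSection A ⊤ (π (HolGerm.mk G hG)), fun y' hy' => ⟨hG, ?_⟩⟩
    exact germ_fatSection A ⊤ y' hy' _

/-- The fat point with ring of functions `A`, as a complex space. -/
def fat : ComplexSpace := ⟨fatOver A, by
  refine isComplexSpace_iff_exists_chart.2 ⟨?_, fun x => ?_⟩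
  · have := subsingleton_fatOver A
    infer_instance
  · obtain ⟨c, hc⟩ := exists_chart_fatOver A
    exact ⟨c, hc ▸ trivial⟩⟩

end fat

end

section

open ComplexSpace

/-! ### Holomorphic maps and germs -/

variable {X Y Z : ComplexSpace}

/-- The map on points. -/
def pt (h : X ⟶ Y) (x : X.obj.left) : Y.obj.left := (lrsHom h).base x

/-- The pullback of germs. -/
def stk (h : X ⟶ Y) (x : X.obj.left) : Stk Y.obj (pt h x) →ₐ[ℂ] Stk X.obj x := Stk.map h.hom x

theorem continuous_pt (h : X ⟶ Y) : Continuous (pt h) := (lrsHom h).base.hom.continuous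

theorem stk_germ (h : X ⟶ Y) (U : Y.Open) (s : Y.Sec U) (x : X.obj.left) (hx : pt h x ∈ U) :
    stk h x (Stk.germ (pt h x) hx s) = Stk.germ (U := preim h U) x hx (app h U s) :=
  Stk.map_germ h.hom U s x hx

theorem germ_res {U V : X.Open} (h : V ≤ U) (s : X.Sec U) (x : X.obj.left) (hx : x ∈ V) :
    Stk.germ x hx (X.res h s) = Stk.germ x (h hx) s :=
  TopCat.Presheaf.germ_res_apply X.lrs.presheaf (homOfLE h) x hx s

theorem exists_germ (x : X.obj.left) (a : Stk X.obj x) :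
    ∃ (U : X.Open) (hx : x ∈ U) (s : X.Sec U), Stk.germ x hx s = a :=
  Stk.exists_germ x a

/-- Germs agree at a point if and only if the functions agree near the point. -/
theorem exists_res_eq_of_germ_eq {x : X.obj.left} {U V : X.Open} (hU : x ∈ U) (hV : x ∈ V)
    {s : X.Sec U} {t : X.Sec V} (h : Stk.germ x hU s = Stk.germ x hV t) :
    ∃ (W : X.Open) (_ : x ∈ W) (hWU : W ≤ U) (hWV : W ≤ V), X.res hWU s = X.res hWV t := by
  obtain ⟨W, hx, i, j, hij⟩ := X.lrs.presheaf.germ_eq x hU hV s t h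
  exact ⟨W, hx, i.le, j.le, hij⟩

theorem sec_ext {U : X.Open} {s t : X.Sec U}
    (h : ∀ (x : X.obj.left) (hx : x ∈ U), Stk.germ x hx s = Stk.germ x hx t) : s = t :=
  TopCat.Presheaf.section_ext X.lrs.sheaf _ _ _ h

theorem hom_ext_of_germs {h₁ h₂ : X ⟶ Y} (hb : ∀ x, pt h₁ x = pt h₂ x)
    (hs : ∀ (U : Y.Open) (s : Y.Sec U) (x : X.obj.left) (hx : pt h₁ x ∈ U) (hx' : pt h₂ x ∈ U),
      Stk.germ (U := preim h₁ U) x hx (app h₁ U s) =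
        Stk.germ (U := preim h₂ U) x hx' (app h₂ U s)) :
    h₁ = h₂ :=
  ObjectProperty.hom_ext _ (overHom_ext_of_germs hb hs)

/-- Holomorphic maps can be constructed from continuous maps and algebra homomorphisms on the stalks
that locally map sections to sections. -/
theorem exists_hom_of_germs (f : X.obj.left → Y.obj.left) (hf : Continuous f)
    (ψ : ∀ x : X.obj.left, Stk Y.obj (f x) →ₐ[ℂ] Stk X.obj x)
    (H : ∀ (U : Y.Open) (s : Y.Sec U) (x : X.obj.left), f x ∈ U →
      ∃ (V : X.Open) (_ : x ∈ V) (σ : X.Sec V), ∀ (x' : X.obj.left) (h' : x' ∈ V),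
        ∃ h'' : f x' ∈ U, Stk.germ x' h' σ = ψ x' (Stk.germ (f x') h'' s)) :
    ∃ h : X ⟶ Y, (∀ x, pt h x = f x) ∧
      ∀ (U : Y.Open) (s : Y.Sec U) (x : X.obj.left) (hx : f x ∈ U) (hx' : pt h x ∈ U),
        Stk.germ (U := preim h U) x hx' (app h U s) = ψ x (Stk.germ (f x) hx s) := by
  obtain ⟨h, h1, h2⟩ := exists_overHom_of_germs f hf ψ (fun x a ha => by
    by_contra h
    exact (IsLocalRing.mem_maximalIdeal _).1 (IsAnalyticAlg.map_mem_maximalIdeal (ψ x)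
      ((IsLocalRing.mem_maximalIdeal _).2 h)) ha) H
  exact ⟨ObjectProperty.homMk h, h1, h2⟩

/-! ### Maps from fat points -/

section fat

variable {A : Type} [CommRing A] [Algebra ℂ A] [IsFatAlg A]

variable (A) in
/-- The point of the complex space `fat A`. -/
def fatPoint : (fat A).obj.left := fatPt A

variable (A) in
/-- The stalks of the complex space `fat A`. -/
def fatStalk (t : (fat A).obj.left) : A ≃ₐ[ℂ] Stk (fat A).obj t := fatStk A t

theorem exists_fatHom (x : X.obj.left) (φ : Stk X.obj x →ₐ[ℂ] A) :
    ∃ g : fat A ⟶ X, (∀ t, pt g t = x) ∧ ∀ (U : X.Open) (s : X.Sec U) (t : (fat A).obj.left)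
      (hx : x ∈ U) (ht : pt g t ∈ U),
      Stk.germ (U := preim g U) t ht (app g U s) = fatStalk A t (φ (Stk.germ x hx s)) := by
  refine exists_hom_of_germs (X := fat A) (fun _ => x) continuous_const
    (fun t => (fatStalk A t : A →ₐ[ℂ] Stk (fat A).obj t).comp φ) fun U s t ht => ?_
  exact ⟨⊤, trivial, fatSection A ⊤ (φ (Stk.germ x ht s)), fun t' _ =>
    ⟨ht, germ_fatSection A ⊤ t' trivial _⟩⟩

/-- The map from a fat point given by a point and a homomorphism on the stalk. -/
def fatHom (x : X.obj.left) (φ : Stk X.obj x →ₐ[ℂ] A) : fat A ⟶ X := (exists_fatHom x φ).choose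

/-- The image of a fat point. -/
def fpt (g : fat A ⟶ X) : X.obj.left := pt g (fatPoint A)

/-- The evaluation of germs at a fat point. -/
def fev (g : fat A ⟶ X) : Stk X.obj (fpt g) →ₐ[ℂ] A :=
  ((fatStalk A (fatPoint A)).symm : Stk (fat A).obj (fatPoint A) →ₐ[ℂ] A).comp
    (stk g (fatPoint A))

theorem fpt_fatHom (x : X.obj.left) (φ : Stk X.obj x →ₐ[ℂ] A) : fpt (fatHom x φ) = x :=
  (exists_fatHom x φ).choose_spec.1 _

theorem fev_eq_iff (g : fat A ⟶ X) (U : X.Open) (s : X.Sec U) (h : fpt g ∈ U) (a : A) :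
    fev g (Stk.germ (fpt g) h s) = a ↔
      Stk.germ (U := preim g U) (fatPoint A) h (app g U s) = fatStalk A (fatPoint A) a := by
  change (fatStalk A (fatPoint A)).symm (stk g (fatPoint A) (Stk.germ (pt g (fatPoint A)) h s)) = a
    ↔ _
  rw [AlgEquiv.symm_apply_eq]
  exact iff_of_eq (congrArg (· = _) (stk_germ g U s _ h))

theorem fev_fatHom (x : X.obj.left) (φ : Stk X.obj x →ₐ[ℂ] A) (U : X.Open) (s : X.Sec U)
    (hx : x ∈ U) (h : fpt (fatHom x φ) ∈ U) :
    fev (fatHom x φ) (Stk.germ _ h s) = φ (Stk.germ x hx s) :=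
  (fev_eq_iff _ _ _ _ _).2 ((exists_fatHom x φ).choose_spec.2 U s _ hx h)

theorem fat_hom_ext {g₁ g₂ : fat A ⟶ X} (hp : fpt g₁ = fpt g₂)
    (h : ∀ (U : X.Open) (s : X.Sec U) (h₁ : fpt g₁ ∈ U) (h₂ : fpt g₂ ∈ U),
      fev g₁ (Stk.germ _ h₁ s) = fev g₂ (Stk.germ _ h₂ s)) : g₁ = g₂ := by
  have hu := subsingleton_fatOver A
  have hu' : ∀ t : (fat A).obj.left, t = fatPoint A := fun t => hu.elim _ _
  refine hom_ext_of_germs (fun t => ?_) fun U s t ht ht' => ?_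
  · rw [hu' t]
    exact hp
  · obtain rfl := hu' t
    exact ((fev_eq_iff g₁ U s ht _).1 (h U s ht ht')).trans ((fev_eq_iff g₂ U s ht' _).1 rfl).symm

theorem fatHom_fev (g : fat A ⟶ X) : fatHom (fpt g) (fev g) = g :=
  fat_hom_ext (fpt_fatHom _ _) fun U s _ h₂ => fev_fatHom _ _ U s h₂ _

theorem exists_eq_fatHom (g : fat A ⟶ X) : ∃ x φ, g = fatHom x φ := ⟨_, _, (fatHom_fev g).symm⟩

theorem fatHom_pt_eq {x y : X.obj.left} {φ : Stk X.obj x →ₐ[ℂ] A} {ψ : Stk X.obj y →ₐ[ℂ] A}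
    (h : fatHom x φ = fatHom y ψ) : x = y := by
  rw [← fpt_fatHom x φ, h, fpt_fatHom]

theorem fatHom_injective {x : X.obj.left} {φ ψ : Stk X.obj x →ₐ[ℂ] A}
    (h : fatHom x φ = fatHom x ψ) : φ = ψ := by
  refine AlgHom.ext fun a => ?_
  obtain ⟨U, hx, s, rfl⟩ := exists_germ x a
  have hx' : ∀ χ : Stk X.obj x →ₐ[ℂ] A, fpt (fatHom x χ) ∈ U := fun χ => by rwa [fpt_fatHom]
  have aux : ∀ (g g' : fat A ⟶ X) (_ : g = g') (h1 : fpt g ∈ U) (h2 : fpt g' ∈ U),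
      fev g (Stk.germ _ h1 s) = fev g' (Stk.germ _ h2 s) := by
    rintro g _ rfl _ _
    rfl
  rw [← fev_fatHom x φ U s hx (hx' φ), ← fev_fatHom x ψ U s hx (hx' ψ)]
  exact aux _ _ h _ _

theorem fev_comp (g : fat A ⟶ X) (h : X ⟶ Y) (U : Y.Open) (s : Y.Sec U) (hU : fpt (g ≫ h) ∈ U) :
    fev (g ≫ h) (Stk.germ _ hU s) = fev g (Stk.germ (U := preim h U) (fpt g) hU (app h U s)) :=
  (fev_eq_iff _ _ _ _ _).2 ((fev_eq_iff g (preim h U) (app h U s) hU _).1 rfl)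

theorem fatHom_comp (x : X.obj.left) (φ : Stk X.obj x →ₐ[ℂ] A) (h : X ⟶ Y) :
    fatHom x φ ≫ h = fatHom (pt h x) (φ.comp (stk h x)) := by
  have h1 : fpt (fatHom x φ ≫ h) = pt h x := congrArg (pt h) (fpt_fatHom x φ)
  refine fat_hom_ext (h1.trans (fpt_fatHom _ _).symm) fun U s h₁ h₂ => ?_
  have h3 : pt h x ∈ U := by rwa [← h1]
  refine (fev_comp _ _ _ _ _).trans ((fev_fatHom x φ (preim h U) _ h3 _).trans ?_)
  refine Eq.trans ?_ (fev_fatHom (pt h x) (φ.comp (stk h x)) U s h3 h₂).symm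
  exact congrArg φ (stk_germ h U s x h3).symm

/-- Two maps from fat points that agree on the germs of sections are equal. -/
theorem fatHom_eq_fatHom {x y : X.obj.left} (hxy : x = y) {φ : Stk X.obj x →ₐ[ℂ] A}
    {ψ : Stk X.obj y →ₐ[ℂ] A}
    (h : ∀ (U : X.Open) (s : X.Sec U) (hx : x ∈ U) (hy : y ∈ U),
      φ (Stk.germ x hx s) = ψ (Stk.germ y hy s)) : fatHom x φ = fatHom y ψ := by
  subst hxy
  refine congrArg (fatHom x) (AlgHom.ext fun a => ?_)
  obtain ⟨U, hx, s, rfl⟩ := exists_germ x a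
  exact h U s hx hx

end fat

/-! ### Fat points separate germs -/

theorem isFatAlg_quotient {O : Type} [CommRing O] [Algebra ℂ O] [IsLocalRing O] [IsAnalyticAlg O]
    {J : Ideal O} (hJ : J ≠ ⊤) {l : ℕ} (h : IsLocalRing.maximalIdeal O ^ l ≤ J) :
    IsFatAlg (O ⧸ J) := by
  have h1 : Nontrivial (O ⧸ J) := Ideal.Quotient.nontrivial_iff.2 hJ
  have h2 : IsAnalyticAlg (O ⧸ J) := IsAnalyticAlg.of_surjective (Ideal.Quotient.mkₐ ℂ J)
    (Ideal.Quotient.mkₐ_surjective ℂ J)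
  have h3 : IsLocalRing (O ⧸ J) := h2.isLocalRing
  refine { h2, h3 with nilpotent := ⟨l, ?_⟩ }
  have h4 : IsLocalRing.maximalIdeal (O ⧸ J) ≤
      (IsLocalRing.maximalIdeal O).map (Ideal.Quotient.mk J) := by
    intro a ha
    obtain ⟨b, rfl⟩ := Ideal.Quotient.mk_surjective a
    refine Ideal.mem_map_of_mem _ ?_
    rw [IsLocalRing.mem_maximalIdeal] at ha ⊢
    exact fun hb => ha (hb.map _)
  refine eq_bot_iff.2 ((Ideal.pow_right_mono h4 l).trans ?_)
  rw [← Ideal.map_pow]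
  refine (Ideal.map_mono h).trans ?_
  rw [Ideal.map_quotient_self]

/-- Krull's intersection theorem, modulo an ideal. -/
theorem mem_of_forall_mem_sup_pow {O : Type} [CommRing O] [IsLocalRing O] [IsNoetherianRing O]
    {I : Ideal O} (hI : I ≠ ⊤) {a : O}
    (h : ∀ l, a ∈ I ⊔ IsLocalRing.maximalIdeal O ^ (l + 1)) : a ∈ I := by
  have h1 : Nontrivial (O ⧸ I) := Ideal.Quotient.nontrivial_iff.2 hI
  have h2 : IsLocalRing (O ⧸ I) :=
    IsLocalRing.of_surjective' (Ideal.Quotient.mk I) Ideal.Quotient.mk_surjective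
  have h3 := Ideal.iInf_pow_eq_bot_of_isLocalRing
    ((IsLocalRing.maximalIdeal O).map (Ideal.Quotient.mk I)) (by
      intro h4
      have h5 : (1 : O ⧸ I) ∈ (IsLocalRing.maximalIdeal O).map (Ideal.Quotient.mk I) := h4 ▸ trivial
      obtain ⟨b, hb, hb1⟩ := (Ideal.mem_map_iff_of_surjective _ Ideal.Quotient.mk_surjective).1 h5
      have h6 : 1 - b ∈ I := by
        rw [← Ideal.Quotient.eq_zero_iff_mem, map_sub, hb1, map_one, sub_self]
      have h7 := add_mem (IsLocalRing.le_maximalIdeal hI h6) hb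
      rw [sub_add_cancel] at h7
      exact (IsLocalRing.mem_maximalIdeal _).1 h7 isUnit_one)
  rw [← Ideal.Quotient.eq_zero_iff_mem, ← Ideal.mem_bot, ← h3]
  refine Ideal.mem_iInf.2 fun l => ?_
  rw [← Ideal.map_pow]
  cases l with
  | zero => simp
  | succ l =>
    have h8 := Ideal.mem_map_of_mem (Ideal.Quotient.mk I) (h l)
    rwa [Ideal.map_sup, Ideal.map_quotient_self, bot_sup_eq] at h8

/-- The quotients of an analytic algebra that are functions on fat points detect membership in an
ideal. -/
theorem mem_of_forall_fat {O : Type} [CommRing O] [Algebra ℂ O] [IsLocalRing O] [IsAnalyticAlg O]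
    {I : Ideal O} (hI : I ≠ ⊤) {a : O}
    (h : ∀ (A : Type) [CommRing A] [Algebra ℂ A] [IsFatAlg A] (φ : O →ₐ[ℂ] A),
      Function.Surjective φ → (∀ b ∈ I, φ b = 0) → φ a = 0) : a ∈ I := by
  have := IsAnalyticAlg.isNoetherianRing O
  refine mem_of_forall_mem_sup_pow hI fun l => ?_
  have hJ : I ⊔ IsLocalRing.maximalIdeal O ^ (l + 1) ≠ ⊤ := by
    intro h1
    have h2 : I ⊔ IsLocalRing.maximalIdeal O ^ (l + 1) ≤ IsLocalRing.maximalIdeal O :=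
      sup_le (IsLocalRing.le_maximalIdeal hI) (Ideal.pow_le_self (by simp))
    rw [h1, top_le_iff] at h2
    exact Ideal.IsPrime.ne_top inferInstance h2
  have : IsFatAlg (O ⧸ (I ⊔ IsLocalRing.maximalIdeal O ^ (l + 1))) :=
    isFatAlg_quotient hJ le_sup_right
  rw [← Ideal.Quotient.eq_zero_iff_mem]
  exact h _ (Ideal.Quotient.mkₐ ℂ _) (Ideal.Quotient.mkₐ_surjective ℂ _) fun b hb =>
    Ideal.Quotient.eq_zero_iff_mem.2 (Ideal.mem_sup_left hb)

theorem exists_fat_quotient {O : Type} [CommRing O] [Algebra ℂ O] [IsLocalRing O]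
    [IsAnalyticAlg O] : ∃ (A : Type) (_ : CommRing A) (_ : Algebra ℂ A) (_ : IsFatAlg A),
      Nonempty (O →ₐ[ℂ] A) :=
  have : IsFatAlg (O ⧸ (IsLocalRing.maximalIdeal O)) :=
    isFatAlg_quotient (l := 1) (Ideal.IsPrime.ne_top inferInstance) (pow_one _).le
  ⟨_, _, _, this, ⟨Ideal.Quotient.mkₐ ℂ _⟩⟩

/-- Holomorphic maps that agree on all fat points are equal. -/
theorem hom_ext_of_fat {h₁ h₂ : X ⟶ Y}
    (h : ∀ (A : Type) [CommRing A] [Algebra ℂ A] [IsFatAlg A] (g : fat A ⟶ X),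
      g ≫ h₁ = g ≫ h₂) : h₁ = h₂ := by
  have hp : ∀ x, pt h₁ x = pt h₂ x := by
    intro x
    obtain ⟨A, _, _, _, ⟨φ⟩⟩ := exists_fat_quotient (O := Stk X.obj x)
    have h1 := h A (fatHom x φ)
    rw [fatHom_comp, fatHom_comp] at h1
    exact fatHom_pt_eq h1
  refine hom_ext_of_germs hp fun U s x hx hx' => ?_
  rw [← sub_eq_zero, ← Ideal.mem_bot]
  refine mem_of_forall_fat bot_ne_top fun A _ _ _ φ _ _ => ?_
  have h1 := h A (fatHom x φ)
  rw [map_sub, sub_eq_zero]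
  have aux : ∀ (g g' : fat A ⟶ Y) (_ : g = g') (h1 : fpt g ∈ U) (h2 : fpt g' ∈ U),
      fev g (Stk.germ _ h1 s) = fev g' (Stk.germ _ h2 s) := by
    rintro g _ rfl _ _
    rfl
  have h2 : ∀ (k : X ⟶ Y) (hk : pt k x ∈ U) (hk' : fpt (fatHom x φ ≫ k) ∈ U),
      fev (fatHom x φ ≫ k) (Stk.germ _ hk' s) = φ (Stk.germ (U := preim k U) x hk (app k U s)) := by
    intro k hk hk'
    rw [fev_comp]
    exact fev_fatHom x φ (preim k U) _ hk _
  have h3 : ∀ k : X ⟶ Y, pt k x ∈ U → fpt (fatHom x φ ≫ k) ∈ U := by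
    intro k hk
    rw [fatHom_comp, fpt_fatHom]
    exact hk
  rw [← h2 h₁ hx (h3 _ hx), ← h2 h₂ hx' (h3 _ hx')]
  exact aux _ _ h1 _ _

end

section

open ComplexSpace

/-! ### Closed embeddings and fat points -/

variable {X Y Z : ComplexSpace}

theorem fev_congr {A : Type} [CommRing A] [Algebra ℂ A] [IsFatAlg A] {g g' : fat A ⟶ X}
    (h : g = g') {U : X.Open} (s : X.Sec U) (h₁ : fpt g ∈ U) (h₂ : fpt g' ∈ U) :
    fev g (Stk.germ _ h₁ s) = fev g' (Stk.germ _ h₂ s) := by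
  subst h
  rfl

/-- `h : X ⟶ Y` is injective on maps from fat points. -/
def FatMono (h : X ⟶ Y) : Prop :=
  ∀ (A : Type) [CommRing A] [Algebra ℂ A] [IsFatAlg A] (g₁ g₂ : fat A ⟶ X),
    g₁ ≫ h = g₂ ≫ h → g₁ = g₂

/-- The map from a fat point annihilates the functions that `h` annihilates. -/
def Kills {A : Type} [CommRing A] [Algebra ℂ A] [IsFatAlg A] (g : fat A ⟶ Y) (h : X ⟶ Y) : Prop :=
  ∀ (U : Y.Open) (s : Y.Sec U), app h U s = 0 → ∀ hU : fpt g ∈ U, fev g (Stk.germ _ hU s) = 0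

/-- The maps from fat points that annihilate the functions that `h` annihilates lift along `h`. -/
def FatLift (h : X ⟶ Y) : Prop :=
  ∀ (A : Type) [CommRing A] [Algebra ℂ A] [IsFatAlg A] (g : fat A ⟶ Y),
    Kills g h → ∃ g' : fat A ⟶ X, g' ≫ h = g

theorem FatMono.mono {h : X ⟶ Y} (H : FatMono h) : Mono h :=
  ⟨fun a b hab => hom_ext_of_fat fun A _ _ _ g => H A _ _ (by
    rw [Category.assoc, Category.assoc, hab])⟩

theorem fatMono_id : FatMono (𝟙 X) := fun _ _ _ _ _ _ h => by simpa using h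

theorem stk_surjective {h : X ⟶ Y} (H : ComplexSpace.IsClosedEmbedding h) (x : X.obj.left) :
    Function.Surjective (stk h x) := H.stalk_surjective x

theorem pt_isClosedEmbedding {h : X ⟶ Y} (H : ComplexSpace.IsClosedEmbedding h) :
    Topology.IsClosedEmbedding (pt h) := H.base

theorem fatMono_of_isClosedEmbedding {h : X ⟶ Y} (H : ComplexSpace.IsClosedEmbedding h) :
    FatMono h := by
  intro A _ _ _ g₁ g₂ he
  obtain ⟨x, φ, rfl⟩ := exists_eq_fatHom g₁
  obtain ⟨y, ψ, rfl⟩ := exists_eq_fatHom g₂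
  rw [fatHom_comp, fatHom_comp] at he
  obtain rfl := (pt_isClosedEmbedding H).injective (fatHom_pt_eq he)
  have h1 := fatHom_injective he
  refine congrArg (fatHom x) (AlgHom.ext fun a => ?_)
  obtain ⟨b, rfl⟩ := stk_surjective H x a
  exact AlgHom.congr_fun h1 b

theorem exists_algHom_of_surjective {A B C : Type} [CommRing A] [CommRing B] [CommRing C]
    [Algebra ℂ A] [Algebra ℂ B] [Algebra ℂ C] (f : A →ₐ[ℂ] B) (hf : Function.Surjective f)
    (g : A →ₐ[ℂ] C) (h : ∀ a, f a = 0 → g a = 0) : ∃ k : B →ₐ[ℂ] C, k.comp f = g := by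
  refine ⟨(Ideal.Quotient.liftₐ (RingHom.ker f) g fun a ha => h a ha).comp
    (Ideal.quotientKerAlgEquivOfSurjective hf).symm.toAlgHom, AlgHom.ext fun a => ?_⟩
  have h1 : (Ideal.quotientKerAlgEquivOfSurjective hf).symm (f a) =
      Ideal.Quotient.mk (RingHom.ker f) a := by
    rw [AlgEquiv.symm_apply_eq]
    rfl
  change Ideal.Quotient.liftₐ (RingHom.ker f) g (fun a ha => h a ha)
    ((Ideal.quotientKerAlgEquivOfSurjective hf).symm (f a)) = g a
  rw [h1]
  rfl

/-- If a germ vanishes on a closed subspace, then so does the function nearby. -/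
theorem exists_app_res_eq_zero {h : X ⟶ Y} (H : ComplexSpace.IsClosedEmbedding h) (x : X.obj.left)
    {U : Y.Open} (hU : pt h x ∈ U) {s : Y.Sec U} (hs : stk h x (Stk.germ _ hU s) = 0) :
    ∃ (V : Y.Open) (_ : pt h x ∈ V) (hVU : V ≤ U), app h V (Y.res hVU s) = 0 := by
  rw [stk_germ, ← map_zero (Stk.germ (Z := X.obj) (U := preim h U) x hU)] at hs
  obtain ⟨W, hxW, hWU, _, hW⟩ := exists_res_eq_of_germ_eq (X := X) (U := preim h U) _ _ hs
  obtain ⟨t, ht, hWt⟩ := (pt_isClosedEmbedding H).isInducing.isOpen_iff.1 W.isOpen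
  refine ⟨⟨t, ht⟩ ⊓ U, ⟨?_, hU⟩, inf_le_right, ?_⟩
  · have : x ∈ pt h ⁻¹' t := hWt ▸ hxW
    exact this
  · refine sec_ext fun x' hx' => ?_
    have hxW' : x' ∈ W := by
      have h1 : x' ∈ pt h ⁻¹' t := hx'.1
      rw [hWt] at h1
      exact h1
    rw [app_res, germ_res, map_zero]
    have h2 := congrArg (Stk.germ (Z := X.obj) x' hxW') hW
    rw [germ_res, germ_res, map_zero] at h2
    exact h2

/-- The maps from fat points to a closed subspace are the maps to the ambient space that annihilate
the functions that vanish on the subspace. -/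
theorem fatLift_of_isClosedEmbedding {h : X ⟶ Y} (H : ComplexSpace.IsClosedEmbedding h) :
    FatLift h := by
  intro A _ _ _ g hg
  obtain ⟨y, φ, rfl⟩ := exists_eq_fatHom g
  have hy : y ∈ Set.range (pt h) := by
    by_contra hy
    let U : Y.Open := ⟨(Set.range (pt h))ᶜ, (pt_isClosedEmbedding H).isClosed_range.isOpen_compl⟩
    have h1 : app h U 1 = 0 := sec_ext fun x hx => absurd ⟨x, rfl⟩ hx
    have h2 := hg U 1 h1 (by rw [fpt_fatHom]; exact hy)
    rw [map_one, map_one] at h2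
    exact one_ne_zero h2
  obtain ⟨x, rfl⟩ := hy
  obtain ⟨ψ, hψ⟩ := exists_algHom_of_surjective (stk h x) (stk_surjective H x) φ (by
    intro a ha
    obtain ⟨U, hU, s, rfl⟩ := exists_germ _ a
    obtain ⟨V, hV, hVU, h1⟩ := exists_app_res_eq_zero H x hU ha
    have h2 := hg V _ h1 (by rw [fpt_fatHom]; exact hV)
    rw [fev_fatHom _ _ _ _ hV, germ_res] at h2
    exact h2)
  exact ⟨fatHom x ψ, by rw [fatHom_comp, hψ]⟩

/-- A map into the ambient space of a closed subspace factors through the subspace if this holds on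
fat points. -/
theorem exists_lift_of_fat {T : ComplexSpace} {h : X ⟶ Y} (H : ComplexSpace.IsClosedEmbedding h)
    (k : T ⟶ Y) (hk : ∀ (A : Type) [CommRing A] [Algebra ℂ A] [IsFatAlg A] (g : fat A ⟶ T),
      ∃ g' : fat A ⟶ X, g' ≫ h = g ≫ k) : ∃ l : T ⟶ X, l ≫ h = k := by
  have h1 : ∀ (t : T.obj.left) (y : Y.obj.left) (φ : Stk Y.obj y →ₐ[ℂ] Stk T.obj t),
      (∀ (A : Type) [CommRing A] [Algebra ℂ A] [IsFatAlg A] (θ : Stk T.obj t →ₐ[ℂ] A),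
        ∃ g' : fat A ⟶ X, g' ≫ h = fatHom y (θ.comp φ)) →
      ∃ (x : X.obj.left) (ψ : Stk X.obj x →ₐ[ℂ] Stk T.obj t), pt h x = y ∧
        ∀ (U : Y.Open) (s : Y.Sec U) (hx : pt h x ∈ U) (hy : y ∈ U),
          ψ (Stk.germ (U := preim h U) x hx (app h U s)) = φ (Stk.germ y hy s) := by
    intro t y φ hφ
    have hx : ∃ x, pt h x = y := by
      obtain ⟨A, _, _, _, ⟨θ⟩⟩ := exists_fat_quotient (O := Stk T.obj t)
      obtain ⟨g', hg'⟩ := hφ A θ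
      obtain ⟨x, χ, rfl⟩ := exists_eq_fatHom g'
      rw [fatHom_comp] at hg'
      exact ⟨x, fatHom_pt_eq hg'⟩
    obtain ⟨x, rfl⟩ := hx
    obtain ⟨ψ, hψ⟩ := exists_algHom_of_surjective (stk h x) (stk_surjective H x) φ (by
      intro a ha
      rw [← Ideal.mem_bot]
      refine mem_of_forall_fat bot_ne_top fun A _ _ _ θ _ _ => ?_
      obtain ⟨g', hg'⟩ := hφ A θ
      obtain ⟨x', χ, rfl⟩ := exists_eq_fatHom g'
      rw [fatHom_comp] at hg'
      obtain rfl := (pt_isClosedEmbedding H).injective (fatHom_pt_eq hg')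
      have h2 := AlgHom.congr_fun (fatHom_injective hg') a
      refine h2.symm.trans ?_
      change χ (stk h x' a) = 0
      rw [ha, map_zero])
    refine ⟨x, ψ, rfl, fun U s hx _ => ?_⟩
    rw [← hψ]
    exact congrArg ψ (stk_germ h U s x hx).symm
  have h2 := fun t => h1 t (pt k t) (stk k t) (fun A _ _ _ θ => by
    obtain ⟨g', hg'⟩ := hk A (fatHom t θ)
    exact ⟨g', hg'.trans (fatHom_comp _ _ _)⟩)
  choose f ψ hf hψ using h2
  have hfc : Continuous f := by
    rw [(pt_isClosedEmbedding H).isInducing.continuous_iff]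
    exact (continuous_congr hf).2 (continuous_pt k)
  obtain ⟨l, hl, hl'⟩ := exists_hom_of_germs f hfc ψ (by
    intro U s t ht
    obtain ⟨a, ha⟩ := stk_surjective H (f t) (Stk.germ _ ht s)
    obtain ⟨U', hU', s', rfl⟩ := exists_germ _ a
    rw [stk_germ] at ha
    obtain ⟨W, hxW, hWU', hWU, hW⟩ := exists_res_eq_of_germ_eq (X := X) (U := preim h U') _ _ ha
    have hU'k : pt k t ∈ U' := hf t ▸ hU'
    refine ⟨⟨f ⁻¹' W, W.isOpen.preimage hfc⟩ ⊓ preim k U', ⟨hxW, hU'k⟩,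
      T.res inf_le_right (app k U' s'), fun t' ht' => ⟨hWU ht'.1, ?_⟩⟩
    have h3 := congrArg (Stk.germ (Z := X.obj) (f t') ht'.1) hW
    rw [germ_res, germ_res] at h3
    rw [germ_res, ← h3]
    refine Eq.trans ?_ (hψ t' U' s' (hWU' ht'.1) ht'.2).symm
    exact (stk_germ k U' s' t' ht'.2).symm)
  refine ⟨l, hom_ext_of_germs (fun t => ?_) fun U s t ht ht' => ?_⟩
  · exact (congrArg (pt h) (hl t)).trans (hf t)
  · have h4 : f t ∈ preim h U := by
      have : pt h (pt l t) ∈ U := ht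
      rwa [hl] at this
    refine (hl' (preim h U) (app h U s) t h4 ht).trans ?_
    exact (hψ t U s h4 ht').trans (stk_germ k U s t ht')

end

section

open ComplexSpace

variable {X Y Z : ComplexSpace}

/-! ### Values of functions -/

theorem exists_value (x : X.obj.left) (a : Stk X.obj x) :
    ∃ c : ℂ, a - algebraMap ℂ _ c ∈ IsLocalRing.maximalIdeal (Stk X.obj x) :=
  IsAnalyticAlg.exists_const a

/-- The value of a germ. -/
def valueAux (x : X.obj.left) (a : Stk X.obj x) : ℂ := (exists_value x a).choose

theorem valueAux_eq_iff {x : X.obj.left} {a : Stk X.obj x} {c : ℂ} :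
    valueAux x a = c ↔ a - algebraMap ℂ _ c ∈ IsLocalRing.maximalIdeal (Stk X.obj x) := by
  have h1 := (exists_value x a).choose_spec
  constructor
  · rintro rfl
    exact h1
  · intro h2
    have h3 := sub_mem h2 h1
    rw [sub_sub_sub_cancel_left, ← map_sub] at h3
    exact sub_eq_zero.1 (IsAnalyticAlg.const_unique h3)

/-- The value of a germ at the point. -/
def value (x : X.obj.left) : Stk X.obj x →ₐ[ℂ] ℂ where
  toFun := valueAux x
  map_one' := valueAux_eq_iff.2 (by simp)
  map_zero' := valueAux_eq_iff.2 (by simp)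
  map_mul' a b := valueAux_eq_iff.2 <| by
    have h1 := valueAux_eq_iff.1 (rfl : valueAux x a = _)
    have h2 := valueAux_eq_iff.1 (rfl : valueAux x b = _)
    have h3 : a * b - algebraMap ℂ _ (valueAux x a * valueAux x b) =
        b * (a - algebraMap ℂ _ (valueAux x a)) +
          algebraMap ℂ _ (valueAux x a) * (b - algebraMap ℂ _ (valueAux x b)) := by
      rw [map_mul]; ring
    rw [h3]
    exact add_mem (Ideal.mul_mem_left _ _ h1) (Ideal.mul_mem_left _ _ h2)
  map_add' a b := valueAux_eq_iff.2 <| by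
    have h1 := valueAux_eq_iff.1 (rfl : valueAux x a = _)
    have h2 := valueAux_eq_iff.1 (rfl : valueAux x b = _)
    rw [map_add, add_sub_add_comm]
    exact add_mem h1 h2
  commutes' c := valueAux_eq_iff.2 (by simp)

theorem value_eq_iff {x : X.obj.left} {a : Stk X.obj x} {c : ℂ} :
    value x a = c ↔ a - algebraMap ℂ _ c ∈ IsLocalRing.maximalIdeal (Stk X.obj x) :=
  valueAux_eq_iff

instance isFatAlg_complex : IsFatAlg ℂ where
  exists_surjective := ⟨0, 0, { HolGerm.eval (0 : Fin 0 → ℂ) with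
    commutes' := fun c => HolGerm.eval_algebraMap c },
    fun c => ⟨algebraMap ℂ _ c, HolGerm.eval_algebraMap c⟩⟩
  toIsLocalRing := inferInstance
  nilpotent := ⟨1, by rw [pow_one]; exact IsLocalRing.maximalIdeal_eq_bot⟩

theorem eq_value {x : X.obj.left} (φ : Stk X.obj x →ₐ[ℂ] ℂ) : φ = value x := by
  refine AlgHom.ext fun a => ?_
  have h1 := IsAnalyticAlg.map_mem_maximalIdeal φ (value_eq_iff.1 (rfl : value x a = _))
  rw [IsLocalRing.maximalIdeal_eq_bot, Ideal.mem_bot, map_sub, φ.commutes] at h1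
  exact sub_eq_zero.1 h1

theorem value_stk (h : X ⟶ Y) (x : X.obj.left) (a : Stk Y.obj (pt h x)) :
    value x (stk h x a) = value (pt h x) a := by
  rw [value_eq_iff]
  have h1 := IsAnalyticAlg.map_mem_maximalIdeal (stk h x)
    (value_eq_iff.1 (rfl : value (pt h x) a = _))
  rwa [map_sub, AlgHom.commutes] at h1

theorem value_χ (c : Chart X.obj) {y : X.obj.left} (hy : y ∈ c.U)
    (a : HolGerm (Fin c.n → ℂ) (c.w ⟨y, hy⟩)) :
    value y (c.χ ⟨y, hy⟩ a) = HolGerm.eval _ a := by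
  have h1 := IsAnalyticAlg.map_mem_maximalIdeal (c.χ ⟨y, hy⟩)
    (b := a - algebraMap ℂ _ (HolGerm.eval _ a)) (by rw [HolGerm.mem_maximalIdeal]; simp)
  rw [map_sub, AlgHom.commutes] at h1
  exact value_eq_iff.2 h1

/-- A function with the germ `F` in a chart has the values of `F`. -/
theorem eventually_value_eq (c : Chart X.obj) {y : X.obj.left} (hy : y ∈ c.U)
    {F : (Fin c.n → ℂ) → ℂ} (hF : HolNear F (c.w ⟨y, hy⟩)) {U : X.Open} (hU : y ∈ U) {s : X.Sec U}
    (h : Stk.germ y hU s = c.χ ⟨y, hy⟩ (HolGerm.mk F hF)) :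
    ∃ (V : X.Open) (_ : y ∈ V) (hVc : V ≤ c.U) (hVU : V ≤ U), ∀ (y' : X.obj.left) (h' : y' ∈ V),
      value y' (Stk.germ y' (hVU h') s) = F (c.w ⟨y', hVc h'⟩) := by
  obtain ⟨V, hVc, hyV, s', hs'⟩ := c.exists_section ⟨y, hy⟩ F hF
  obtain ⟨hF', h1⟩ := hs' y hyV
  obtain ⟨W, hyW, hWU, hWV, hW⟩ := exists_res_eq_of_germ_eq (X := X) hU hyV (h.trans h1.symm)
  refine ⟨W, hyW, hWV.trans hVc, hWU, fun y' h' => ?_⟩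
  obtain ⟨hF'', h2⟩ := hs' y' (hWV h')
  have h3 := congrArg (Stk.germ (Z := X.obj) y' h') hW
  rw [germ_res, germ_res] at h3
  rw [h3]
  refine (congrArg (value y') h2).trans ((value_χ c _ _).trans ?_)
  rw [HolGerm.eval_mk]

/-- If the germ of `γ` is obtained by substituting the germs of the functions `W j` in `F`, then
`γ = F(W)` near the point. -/
theorem eventually_value_eq_comp {m : ℕ} {p : Fin m → ℂ} (y : X.obj.left)
    (φ : HolGerm (Fin m → ℂ) p →ₐ[ℂ] Stk X.obj y) {U : X.Open} (hU : y ∈ U) (W : Fin m → X.Sec U)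
    (hW : ∀ j, φ (HolGerm.coord p j) = Stk.germ y hU (W j)) :
    (∀ j, value y (Stk.germ y hU (W j)) = p j) ∧
    (∃ (V : X.Open) (_ : y ∈ V) (hVU : V ≤ U), ∀ (O : Set (Fin m → ℂ)), O ∈ 𝓝 p →
      ∃ (V' : X.Open) (_ : y ∈ V') (hV : V' ≤ V), ∀ (y' : X.obj.left) (h' : y' ∈ V'),
      (fun j => value y' (Stk.germ y' (hVU (hV h')) (W j))) ∈ O) ∧
    ∀ (F : (Fin m → ℂ) → ℂ) (hF : HolNear F p) (U' : X.Open) (hU' : y ∈ U') (γ : X.Sec U'),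
      φ (HolGerm.mk F hF) = Stk.germ y hU' γ →
      ∃ (V : X.Open) (_ : y ∈ V) (hVU : V ≤ U) (hVU' : V ≤ U'), ∀ (y' : X.obj.left) (h' : y' ∈ V),
        value y' (Stk.germ y' (hVU' h') γ) =
          F fun j => value y' (Stk.germ y' (hVU h') (W j)) := by
  obtain ⟨c, hc⟩ := (isComplexSpace_iff_exists_chart.1 X.property).2 y
  have h1 : ∀ j, ∃ G, ∃ hG : HolNear G (c.w ⟨y, hc⟩),
      Stk.germ y hU (W j) = c.χ ⟨y, hc⟩ (HolGerm.mk G hG) := by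
    intro j
    obtain ⟨a, ha⟩ := c.surjective ⟨y, hc⟩ (Stk.germ y hU (W j))
    obtain ⟨G, hG, rfl⟩ := HolGerm.exists_mk a
    exact ⟨G, hG, ha.symm⟩
  choose G hG hGW using h1
  have hval : ∀ j, value y (Stk.germ y hU (W j)) = p j := by
    intro j
    rw [← hW, value_eq_iff, ← φ.commutes, ← map_sub]
    exact IsAnalyticAlg.map_mem_maximalIdeal φ (HolGerm.mem_maximalIdeal.2 (sub_self (p j)))
  have hGp : (fun j => G j (c.w ⟨y, hc⟩)) = p := by
    funext j
    rw [← hval, hGW]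
    exact ((value_χ c _ _).trans (HolGerm.eval_mk _ _)).symm
  have hGn : HolNear (fun z j => G j z) (c.w ⟨y, hc⟩) := by
    filter_upwards [eventually_all.2 hG] with z hz using contDiffAt_pi.2 hz
  have h2 : φ = (c.χ ⟨y, hc⟩).comp (HolGerm.comp _ hGn hGp) := by
    refine IsAnalyticAlg.hom_ext fun j => ?_
    rw [hW, hGW]
    rfl
  -- a common neighbourhood on which all `W j` have the values of `G j`
  obtain ⟨V, hyV, hVc, hVU, hV⟩ : ∃ (V : X.Open) (_ : y ∈ V) (hVc : V ≤ c.U) (hVU : V ≤ U),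
      ∀ (y' : X.obj.left) (h' : y' ∈ V) (j : Fin m),
        value y' (Stk.germ y' (hVU h') (W j)) = G j (c.w ⟨y', hVc h'⟩) := by
    choose V hyV hVc hVU hV using fun j => eventually_value_eq c hc (hG j) hU (hGW j)
    refine ⟨c.U ⊓ U ⊓ ⟨⋂ j, V j, isOpen_iInter_of_finite fun j => (V j).isOpen⟩,
      ⟨⟨hc, hU⟩, Set.mem_iInter.2 hyV⟩, inf_le_left.trans inf_le_left,
      inf_le_left.trans inf_le_right, fun y' h' j => hV j y' (Set.mem_iInter.1 h'.2 j)⟩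
  refine ⟨hval, ⟨V, hyV, hVU, fun O hO => ?_⟩, fun F hF U' hU' γ hγ => ?_⟩
  · have h3 : ContinuousAt (fun z j => G j z) (c.w ⟨y, hc⟩) := hGn.continuousAt
    have h4 : ContinuousAt (fun y' : c.U => fun j => G j (c.w y')) ⟨y, hc⟩ :=
      ContinuousAt.comp (f := c.w) (g := fun z j => G j z) h3
        c.isEmbedding.continuous.continuousAt
    have h5 : ∀ᶠ y' in 𝓝 (⟨y, hc⟩ : c.U), (fun j => G j (c.w y')) ∈ O := by
      have h6 : 𝓝 (fun j => G j (c.w ⟨y, hc⟩)) = 𝓝 p := congrArg 𝓝 hGp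
      exact h4.eventually (show O ∈ 𝓝 (fun j => G j (c.w ⟨y, hc⟩)) from h6 ▸ hO)
    rw [nhds_subtype_eq_comap, eventually_comap] at h5
    obtain ⟨t, ht, hto, hyt⟩ := _root_.eventually_nhds_iff.1 h5
    refine ⟨V ⊓ ⟨t, hto⟩, ⟨hyV, hyt⟩, inf_le_left, fun y' h' => ?_⟩
    have h6 := ht y' h'.2 ⟨y', hVc h'.1⟩ rfl
    rwa [funext fun j => hV y' h'.1 j]
  · have h3 : Stk.germ y hU' γ = c.χ ⟨y, hc⟩ (HolGerm.mk (fun z => F fun j => G j z)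
        ((hGp.symm ▸ hF : HolNear F (fun j => G j (c.w ⟨y, hc⟩))).comp hGn)) := by
      rw [← hγ, h2]
      rfl
    obtain ⟨V', hyV', hVc', hVU', hV'⟩ := eventually_value_eq c hc _ hU' h3
    refine ⟨V ⊓ V', ⟨hyV, hyV'⟩, inf_le_left.trans hVU, inf_le_right.trans hVU', fun y' h' => ?_⟩
    rw [hV' y' h'.2, funext fun j => hV y' h'.1 j]

/-! ### A criterion for closed embeddings -/

theorem FatMono.pt_injective {h : X ⟶ Y} (H : FatMono h) : Function.Injective (pt h) := by
  intro x x' hx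
  refine fatHom_pt_eq (H ℂ (fatHom x (value x)) (fatHom x' (value x')) ?_)
  rw [fatHom_comp, fatHom_comp, eq_value ((value x).comp (stk h x)),
    eq_value ((value x').comp (stk h x')), hx]

/-- A map that is injective on fat points is injective on tangent vectors, so that by the Nakayama
lemma it is unramified, and therefore surjective on the stalks. -/
theorem FatMono.stk_surjective {h : X ⟶ Y} (H : FatMono h) (x : X.obj.left) :
    Function.Surjective (stk h x) := by
  have := IsAnalyticAlg.isNoetherianRing (Stk X.obj x)
  let m := IsLocalRing.maximalIdeal (Stk X.obj x)
  let n := (IsLocalRing.maximalIdeal (Stk Y.obj (pt h x))).map (stk h x)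
  have hnm : n ≤ m := Ideal.map_le_iff_le_comap.2 fun b hb =>
    IsAnalyticAlg.map_mem_maximalIdeal (stk h x) hb
  refine IsAnalyticAlg.surjective_of_unramified (stk h x) ?_
  refine Submodule.le_of_le_smul_of_le_jacobson_bot (IsNoetherian.noetherian m)
    (IsLocalRing.maximalIdeal_le_jacobson _) (N := n) (show m ≤ n ⊔ m • m from ?_)
  have hJ : n ⊔ m • m ≠ ⊤ := fun h1 => by
    have h2 : n ⊔ m • m ≤ m := sup_le hnm Ideal.mul_le_left
    rw [h1, top_le_iff] at h2
    exact Ideal.IsPrime.ne_top inferInstance h2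
  have : IsFatAlg (Stk X.obj x ⧸ (n ⊔ m • m)) := isFatAlg_quotient (l := 2) hJ (by
    rw [pow_two]
    exact le_sup_right)
  -- the tangent vector given by the quotient and the constant one have the same image in `Y`
  have h1 : Ideal.Quotient.mkₐ ℂ (n ⊔ m • m) =
      (Algebra.ofId ℂ (Stk X.obj x ⧸ (n ⊔ m • m))).comp (value x) := by
    refine fatHom_injective (H _ _ _ ?_)
    rw [fatHom_comp, fatHom_comp]
    refine congrArg _ (AlgHom.ext fun b => ?_)
    have h2 := value_eq_iff.1 (rfl : value (pt h x) b = _)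
    have h3 : stk h x (b - algebraMap ℂ _ (value (pt h x) b)) ∈ n ⊔ m • m :=
      Ideal.mem_sup_left (Ideal.mem_map_of_mem _ h2)
    rw [map_sub, AlgHom.commutes] at h3
    have h4 := Ideal.Quotient.eq.2 h3
    change Ideal.Quotient.mk _ (stk h x b) = algebraMap ℂ _ (value x (stk h x b))
    rw [h4, value_stk]
    rfl
  intro a ha
  have h2 : value x a = 0 := value_eq_iff.2 (by rwa [map_zero, sub_zero])
  have h3 := AlgHom.congr_fun h1 a
  rw [AlgHom.comp_apply, h2, map_zero] at h3
  exact Ideal.Quotient.eq_zero_iff_mem.1 h3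

/-- The ideal of germs at `y` of the functions that vanish on the subspace `h : X ⟶ Y`. -/
def stalkIdeal (h : X ⟶ Y) (y : Y.obj.left) : Ideal (Stk Y.obj y) where
  carrier := {a | ∃ (U : Y.Open) (hy : y ∈ U) (s : Y.Sec U), app h U s = 0 ∧ Stk.germ y hy s = a}
  zero_mem' := ⟨⊤, trivial, 0, map_zero _, map_zero _⟩
  add_mem' := by
    rintro _ _ ⟨U, hU, s, hs, rfl⟩ ⟨V, hV, t, ht, rfl⟩
    refine ⟨U ⊓ V, Opens.mem_inf.2 ⟨hU, hV⟩, Y.res inf_le_left s + Y.res inf_le_right t, ?_, ?_⟩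
    · rw [map_add, app_res, app_res, hs, ht, map_zero, map_zero, add_zero]
    · rw [map_add, germ_res, germ_res]
  smul_mem' := by
    rintro a _ ⟨U, hU, s, hs, rfl⟩
    obtain ⟨V, hV, t, rfl⟩ := exists_germ y a
    refine ⟨U ⊓ V, Opens.mem_inf.2 ⟨hU, hV⟩, Y.res inf_le_right t * Y.res inf_le_left s, ?_, ?_⟩
    · rw [map_mul, app_res, app_res, hs, map_zero, mul_zero]
    · rw [map_mul, germ_res, germ_res, smul_eq_mul]

theorem mem_stalkIdeal {h : X ⟶ Y} {y : Y.obj.left} {a : Stk Y.obj y} : a ∈ stalkIdeal h y ↔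
    ∃ (U : Y.Open) (hy : y ∈ U) (s : Y.Sec U), app h U s = 0 ∧ Stk.germ y hy s = a := Iff.rfl

theorem germ_mem_stalkIdeal {h : X ⟶ Y} {y : Y.obj.left} {U : Y.Open} (hy : y ∈ U) {s : Y.Sec U}
    (hs : app h U s = 0) : Stk.germ y hy s ∈ stalkIdeal h y := ⟨U, hy, s, hs, rfl⟩

theorem stalkIdeal_le_ker (h : X ⟶ Y) (x : X.obj.left) :
    stalkIdeal h (pt h x) ≤ RingHom.ker (stk h x) := by
  rintro _ ⟨U, hU, s, hs, rfl⟩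
  rw [RingHom.mem_ker, stk_germ, hs, map_zero]

theorem kills_fatHom_iff {A : Type} [CommRing A] [Algebra ℂ A] [IsFatAlg A] {h : X ⟶ Y}
    {y : Y.obj.left} {φ : Stk Y.obj y →ₐ[ℂ] A} :
    Kills (fatHom y φ) h ↔ ∀ a ∈ stalkIdeal h y, φ a = 0 := by
  constructor
  · rintro H _ ⟨U, hU, s, hs, rfl⟩
    have h1 := H U s hs (by rwa [fpt_fatHom])
    rwa [fev_fatHom _ _ _ _ hU] at h1
  · intro H U s hs hU
    have hU' : y ∈ U := by rwa [fpt_fatHom] at hU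
    rw [fev_fatHom _ _ _ _ hU']
    exact H _ ⟨U, hU', s, hs, rfl⟩

/-- The germs that vanish in the stalk of `X` are germs of functions that vanish on all of `X`. -/
theorem FatMono.ker_le {h : X ⟶ Y} (H : FatMono h) (H' : FatLift h) (x : X.obj.left) :
    RingHom.ker (stk h x) ≤ stalkIdeal h (pt h x) := by
  intro a ha
  refine mem_of_forall_fat (fun h1 => ?_) fun A _ _ _ φ _ hφ => ?_
  · have h2 := stalkIdeal_le_ker h x (h1 ▸ trivial : (1 : Stk Y.obj (pt h x)) ∈ _)
    rw [RingHom.mem_ker, map_one] at h2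
    exact one_ne_zero h2
  · obtain ⟨g', hg'⟩ := H' A (fatHom (pt h x) φ) (kills_fatHom_iff.2 hφ)
    obtain ⟨x', ψ, rfl⟩ := exists_eq_fatHom g'
    rw [fatHom_comp] at hg'
    obtain rfl := H.pt_injective (fatHom_pt_eq hg')
    rw [← fatHom_injective hg']
    change ψ (stk h x' a) = 0
    rw [RingHom.mem_ker.1 ha, map_zero]

/-- The range is closed: at a point `y` outside the range the functions that vanish on `X` generate
the unit ideal, because otherwise the reduced point `y` would lift. -/
theorem FatLift.isClosed_range {h : X ⟶ Y} (H : FatLift h) : IsClosed (Set.range (pt h)) := by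
  rw [← isOpen_compl_iff, isOpen_iff_mem_nhds]
  intro y hy
  have h1 : stalkIdeal h y = ⊤ := by
    by_contra h1
    have : IsFatAlg (Stk Y.obj y ⧸ (stalkIdeal h y ⊔ IsLocalRing.maximalIdeal (Stk Y.obj y))) :=
      isFatAlg_quotient (l := 1) (fun h2 => by
        have h3 := sup_le (IsLocalRing.le_maximalIdeal h1) le_rfl
        rw [h2, top_le_iff] at h3
        exact Ideal.IsPrime.ne_top inferInstance h3) ((pow_one _).le.trans le_sup_right)
    obtain ⟨g', hg'⟩ := H _ (fatHom y (Ideal.Quotient.mkₐ ℂ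
        (stalkIdeal h y ⊔ IsLocalRing.maximalIdeal (Stk Y.obj y)))) (kills_fatHom_iff.2 fun a ha =>
      Ideal.Quotient.eq_zero_iff_mem.2 (Ideal.mem_sup_left ha))
    obtain ⟨x', ψ, rfl⟩ := exists_eq_fatHom g'
    rw [fatHom_comp] at hg'
    exact hy ⟨x', fatHom_pt_eq hg'⟩
  obtain ⟨U, hU, s, hs, hs1⟩ := mem_stalkIdeal.1 (h1 ▸ trivial : (1 : Stk Y.obj y) ∈ stalkIdeal h y)
  obtain ⟨W, hyW, hWU, hWU', hW⟩ := exists_res_eq_of_germ_eq (X := Y) hU hU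
    (hs1.trans (map_one (Stk.germ y hU)).symm)
  refine Filter.mem_of_superset (W.isOpen.mem_nhds hyW) ?_
  rintro _ hz ⟨x, rfl⟩
  have h2 : app h W (Y.res hWU s) = 0 := by rw [app_res, hs, map_zero]
  rw [hW, map_one, map_one] at h2
  have h3 := congrArg (Stk.germ (Z := X.obj) (U := preim h W) x hz) h2
  rw [map_one, map_zero] at h3
  exact one_ne_zero h3

/-- A subspace that is injective on fat points and closed in the sense of `FatLift` has the
subspace topology: the coordinates `c.w` of `X` are restrictions of functions `W` on `Y`. Near
`pt h x`, the equations of `X` hold for `W` on the image of `X`, so that a point `y` of the image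
yields a point `x₂` near `x` with coordinates `W y`; and the coordinates of `Y` are functions of
`W` on the image, so that `pt h x₂ = y`. -/
theorem FatMono.exists_open {h : X ⟶ Y} (H : FatMono h) (H' : FatLift h) (x : X.obj.left)
    (O : X.Open) (hO : x ∈ O) :
    ∃ (V : Y.Open) (_ : pt h x ∈ V), ∀ x₁, pt h x₁ ∈ V → x₁ ∈ O := by
  obtain ⟨c, hc⟩ := (isComplexSpace_iff_exists_chart.1 X.property).2 x
  obtain ⟨d, hd⟩ := (isComplexSpace_iff_exists_chart.1 Y.property).2 (pt h x)
  let p := c.w ⟨x, hc⟩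
  have hb : ∀ j, ∃ b, stk h x b = c.χ ⟨x, hc⟩ (HolGerm.coord p j) := fun j => H.stk_surjective x _
  choose b hb using hb
  obtain ⟨U, hU, W, hW⟩ : ∃ (U : Y.Open) (hU : pt h x ∈ U) (W : Fin c.n → Y.Sec U),
      ∀ j, Stk.germ (pt h x) hU (W j) = b j := by
    choose U hU W hW using fun j => exists_germ (pt h x) (b j)
    refine ⟨⟨⋂ j, U j, isOpen_iInter_of_finite fun j => (U j).isOpen⟩, Set.mem_iInter.2 hU,
      fun j => Y.res (fun y hy => Set.mem_iInter.1 hy j) (W j), fun j => ?_⟩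
    exact (germ_res _ _ _ _).trans (hW j)
  obtain ⟨φ, hφ⟩ := IsAnalyticAlg.exists_hom b p (fun j => by
    rw [← value_eq_iff, ← value_stk, hb, value_χ]
    rfl)
  have hφ' : ∀ a, stk h x (φ a) = c.χ ⟨x, hc⟩ a := fun a => AlgHom.congr_fun
    (IsAnalyticAlg.hom_ext (φ := (stk h x).comp φ) (ψ := c.χ ⟨x, hc⟩) fun j => by
      rw [AlgHom.comp_apply, hφ, hb]) a
  obtain ⟨-, ⟨V₀, hV₀, hV₀U, hnear⟩, hcomp⟩ := eventually_value_eq_comp (pt h x) φ hU W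
    (fun j => (hφ j).trans (hW j).symm)
  -- the equations of `X`
  have heq : ∀ k, ∃ (V : Y.Open) (_ : pt h x ∈ V) (hVU : V ≤ U), ∀ (x₁ : X.obj.left)
      (h₁ : pt h x₁ ∈ V), c.f k (fun j => value _ (Stk.germ (pt h x₁) (hVU h₁) (W j))) = 0 := by
    intro k
    have h1 : φ (HolGerm.mk (c.f k) (c.holNear k p (c.w_mem ⟨x, hc⟩))) ∈
        stalkIdeal h (pt h x) := by
      refine H.ker_le H' x ?_
      rw [RingHom.mem_ker, hφ', ← RingHom.mem_ker, c.ker _ (c.w_mem ⟨x, hc⟩)]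
      exact Ideal.subset_span ⟨k, rfl⟩
    obtain ⟨U', hU', γ, hγ, hγ'⟩ := h1
    obtain ⟨V, hV, hVU, hVU', h2⟩ := hcomp _ _ U' hU' γ hγ'.symm
    refine ⟨V, hV, hVU, fun x₁ h₁ => ?_⟩
    rw [← h2 _ h₁, ← value_stk, stk_germ, hγ, map_zero, map_zero]
  choose V₁ hV₁ hV₁U heq using heq
  -- the coordinates of `Y`
  have hcoord : ∀ i : Fin d.n, ∃ (V : Y.Open) (_ : pt h x ∈ V) (hVU : V ≤ U) (hVd : V ≤ d.U)
      (N : X.Open) (_ : x ∈ N) (hNc : N ≤ c.U) (hNd : ∀ x₂ ∈ N, pt h x₂ ∈ d.U)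
      (Ψ : (Fin c.n → ℂ) → ℂ),
      (∀ (x₁ : X.obj.left) (h₁ : pt h x₁ ∈ V), d.w ⟨pt h x₁, hVd h₁⟩ i =
        Ψ fun j => value _ (Stk.germ (pt h x₁) (hVU h₁) (W j))) ∧
      ∀ (x₂ : X.obj.left) (h₂ : x₂ ∈ N),
        d.w ⟨pt h x₂, hNd x₂ h₂⟩ i = Ψ (c.w ⟨x₂, hNc h₂⟩) := by
    intro i
    have hco : HolNear (fun z : Fin d.n → ℂ => z i) (d.w ⟨pt h x, hd⟩) :=
      ContDiff.holNear (contDiff_apply ℂ ℂ i) _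
    obtain ⟨Vd, hVd, hxVd, v, hv⟩ := d.exists_section ⟨pt h x, hd⟩ _ hco
    have hvval : ∀ (y : Y.obj.left) (hy : y ∈ Vd),
        value y (Stk.germ y hy v) = d.w ⟨y, hVd hy⟩ i := by
      intro y hy
      obtain ⟨hF', h1⟩ := hv y hy
      refine (congrArg (value y) h1).trans ((value_χ d _ _).trans ?_)
      rw [HolGerm.eval_mk]
    obtain ⟨a, ha⟩ := c.surjective ⟨x, hc⟩ (stk h x (Stk.germ (pt h x) hxVd v))
    obtain ⟨Ψ, hΨ, rfl⟩ := HolGerm.exists_mk a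
    have h1 : Stk.germ (pt h x) hxVd v - φ (HolGerm.mk Ψ hΨ) ∈ stalkIdeal h (pt h x) := by
      refine H.ker_le H' x ?_
      rw [RingHom.mem_ker, map_sub, hφ', ha, sub_self]
    obtain ⟨U', hU', δ, hδ, hδ'⟩ := h1
    have h2 : φ (HolGerm.mk Ψ hΨ) = Stk.germ (Z := Y.obj) (U := Vd ⊓ U') (pt h x) ⟨hxVd, hU'⟩
        (Y.res inf_le_left v - Y.res inf_le_right δ) := by
      rw [map_sub]
      refine Eq.trans ?_ (congrArg₂ (· - ·) (germ_res _ _ _ _).symm (germ_res _ _ _ _).symm)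
      rw [hδ', sub_sub_cancel]
    obtain ⟨V, hV, hVU, hVU', h3⟩ := hcomp _ _ _ _ _ h2
    obtain ⟨N, hN, hNc, hNU, h4⟩ := eventually_value_eq (X := X) c hc hΨ (U := preim h Vd) hxVd
      (s := app h Vd v) ((stk_germ _ _ _ _ _).symm.trans ha.symm)
    refine ⟨V, hV, hVU, hVU'.trans (inf_le_left.trans hVd), N, hN, hNc, fun x₂ h₂ => hVd (hNU h₂),
      Ψ, fun x₁ h₁ => ?_, fun x₂ h₂ => ?_⟩
    · rw [← h3 _ h₁, map_sub, map_sub, germ_res, germ_res, hvval]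
      have h5 : value (pt h x₁) (Stk.germ (pt h x₁) (hVU' h₁).2 δ) = 0 := by
        rw [← value_stk, stk_germ, hδ, map_zero, map_zero]
      rw [h5, sub_zero]
    · rw [← h4 _ h₂]
      refine (hvval (pt h x₂) (hNU h₂)).symm.trans ((value_stk h x₂ _).symm.trans ?_)
      exact congrArg (value x₂) (stk_germ h Vd v x₂ (hNU h₂))
  choose V₂ hV₂ hV₂U hV₂d N hN hNc hNd Ψ hΨ₁ hΨ₂ using hcoord
  -- points of `X` near `x` are characterized by their coordinates
  obtain ⟨t, ht, hwt⟩ := c.isEmbedding.isInducing.isOpen_iff.1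
    ((O.isOpen.inter ((preim h d.U).isOpen.inter
      (isOpen_iInter_of_finite fun i => (N i).isOpen))).preimage
      (continuous_subtype_val (p := fun y => y ∈ c.U)))
  have hpt : p ∈ t := by
    have : (⟨x, hc⟩ : c.U) ∈ c.w ⁻¹' t := by
      rw [hwt]
      exact ⟨hO, hd, Set.mem_iInter.2 hN⟩
    exact this
  obtain ⟨V', hV', hV'V, h5⟩ := hnear (t ∩ c.D)
    ((ht.inter c.D.isOpen).mem_nhds ⟨hpt, c.w_mem ⟨x, hc⟩⟩)
  refine ⟨V' ⊓ (⟨⋂ k, V₁ k, isOpen_iInter_of_finite fun j => (V₁ j).isOpen⟩ ⊓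
    (⟨⋂ k, V₂ k, isOpen_iInter_of_finite fun j => (V₂ j).isOpen⟩ ⊓ d.U)),
    ⟨hV', Set.mem_iInter.2 hV₁, Set.mem_iInter.2 hV₂, hd⟩, ?_⟩
  rintro x₁ ⟨h₁, h₂, h₃, h₄⟩
  have h6 : (fun j => value _ (Stk.germ (pt h x₁) (hV₀U (hV'V h₁)) (W j))) ∈ Set.range c.w := by
    rw [c.range_eq]
    exact ⟨(h5 _ h₁).2, fun k => heq k x₁ (Set.mem_iInter.1 h₂ k)⟩
  obtain ⟨⟨x₂, hx₂⟩, h7⟩ := h6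
  have h8 : x₂ ∈ O ∧ pt h x₂ ∈ d.U ∧ ∀ i, x₂ ∈ N i := by
    have h9 : (⟨x₂, hx₂⟩ : c.U) ∈ c.w ⁻¹' t := by
      change c.w ⟨x₂, hx₂⟩ ∈ t
      rw [h7]
      exact (h5 _ h₁).1
    rw [hwt] at h9
    exact ⟨h9.1, h9.2.1, Set.mem_iInter.1 h9.2.2⟩
  have h10 : x₁ = x₂ := by
    refine H.pt_injective ?_
    have h12 : d.w ⟨pt h x₁, h₄⟩ = d.w ⟨pt h x₂, h8.2.1⟩ := by
      funext i
      rw [hΨ₁ i x₁ (Set.mem_iInter.1 h₃ i), hΨ₂ i x₂ (h8.2.2 i), h7]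
    exact congrArg Subtype.val (d.isEmbedding.injective h12)
  rw [h10]
  exact h8.1

/-- A map is a closed embedding if it is injective on fat points and all maps from fat points that
annihilate the functions vanishing on the subspace lift. -/
theorem isClosedEmbedding_of_fat {h : X ⟶ Y} (H : FatMono h) (H' : FatLift h) :
    ComplexSpace.IsClosedEmbedding h := by
  refine ⟨?_, H.stk_surjective⟩
  have h1 : Topology.IsInducing (pt h) := by
    rw [Topology.isInducing_iff_nhds]
    intro x
    refine le_antisymm (continuous_pt h).continuousAt.le_comap ?_
    intro s hs
    obtain ⟨t, hts, ht, hxt⟩ := mem_nhds_iff.1 hs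
    obtain ⟨V, hV, hVt⟩ := H.exists_open H' x ⟨t, ht⟩ hxt
    exact Filter.mem_comap.2 ⟨V, V.isOpen.mem_nhds hV, fun x₁ h₁ => hts (hVt x₁ h₁)⟩
  exact (⟨⟨h1, H.pt_injective⟩, H'.isClosed_range⟩ : Topology.IsClosedEmbedding (pt h))

end

section

open ComplexSpace

variable {W X T R : ComplexSpace} {i : W ⟶ X} {r : R ⟶ X}

/-! ### Residual spaces: universal property in degree one -/

theorem mem_preim {g : T ⟶ X} {U : X.Open} {t : T.obj.left} : t ∈ preim g U ↔ pt g t ∈ U := Iff.rfl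

theorem mem_inf_preim {g : T ⟶ X} {U : X.Open} {O : T.Open} {t : T.obj.left} (h : t ∈ O)
    (h' : pt g t ∈ U) : t ∈ O ⊓ preim g U := ⟨h, h'⟩

theorem germ_appLE {g : T ⟶ X} {U : X.Open} {O : T.Open} (h : O ≤ preim g U) (s : X.Sec U)
    (t : T.obj.left) (ht : t ∈ O) (ht' : pt g t ∈ U) :
    Stk.germ t ht (appLE g U O h s) = stk g t (Stk.germ (pt g t) ht' s) :=
  (germ_res h _ t ht).trans (stk_germ g U s t ht').symm

/-- A morphism from the symmetric algebra of the ideal sheaf is given by its restriction to degree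
one. -/
def SymAlgHom.ofDegreeOne {g : T ⟶ X} {U : X.Open} {O : T.Open}
    (l : ∀ V : X.Open, V ≤ U → idealOf i V → T.Sec (O ⊓ preim g V))
    (add : ∀ V hV x y, l V hV (x + y) = l V hV x + l V hV y)
    (smul : ∀ V hV (a : X.Sec V) x, l V hV (a • x) = appLE g V _ inf_le_right a * l V hV x)
    (res : ∀ V V' hV (h : V' ≤ V) x, l V' (h.trans hV) (idealRes i h x) =
      T.res (inf_le_inf_left O ((Opens.map (lrsHom g).base).monotone h)) (l V hV x)) :
    SymAlgHom i g U O :=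
  let f (V : X.Open) (hV : V ≤ U) : { f : SymIdeal i V →+* T.Sec (O ⊓ preim g V) //
      (∀ a, f (algebraMap _ _ a) = appLE g V _ inf_le_right a) ∧
        ∀ x, f (symι i x) = l V hV x } :=
    letI := (appLE g V (O ⊓ preim g V) inf_le_right).toAlgebra
    let k : SymIdeal i V →ₐ[X.Sec V] T.Sec (O ⊓ preim g V) := SymmetricAlgebra.lift
      { toFun := l V hV
        map_add' := add V hV
        map_smul' := smul V hV }
    ⟨k.toRingHom, k.commutes, fun x => SymmetricAlgebra.lift_ι_apply _ x⟩
  { hom := fun V hV => (f V hV).1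
    hom_algebraMap := fun V hV => (f V hV).2.1
    hom_res := fun V V' hV h x => by
      rw [(f V' (h.trans hV)).2.2, (f V hV).2.2, res] }

theorem SymAlgHom.ofDegreeOne_hom {g : T ⟶ X} {U : X.Open} {O : T.Open}
    (l : ∀ V : X.Open, V ≤ U → idealOf i V → T.Sec (O ⊓ preim g V)) (add smul res) (V : X.Open)
    (hV : V ≤ U) (x : idealOf i V) :
    (SymAlgHom.ofDegreeOne (g := g) l add smul res).hom V hV (symι i x) = l V hV x := by
  let := (appLE g V (O ⊓ preim g V) inf_le_right).toAlgebra
  exact SymmetricAlgebra.lift_ι_apply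
    (⟨⟨l V hV, add V hV⟩, smul V hV⟩ : idealOf i V →ₗ[X.Sec V] T.Sec (O ⊓ preim g V)) x

theorem symIdeal_ringHom_ext {V : X.Open} {B : Type} [CommRing B] {f g : SymIdeal i V →+* B}
    (h₁ : ∀ a : X.Sec V, f (algebraMap _ (SymIdeal i V) a) = g (algebraMap _ (SymIdeal i V) a))
    (h₂ : ∀ x, f (symι i x) = g (symι i x)) : f = g := by
  refine RingHom.ext fun a => ?_
  induction a using SymmetricAlgebra.induction with
  | algebraMap a => exact h₁ a
  | ι x => exact h₂ x
  | mul a b ha hb => rw [map_mul, map_mul, ha, hb]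
  | add a b ha hb => rw [map_add, map_add, ha, hb]

namespace ResidualSpace

/-- The germ at `y ∈ D₊(s)` of the function `t / s`. -/
def coordGerm (S : ResidualSpace i r) {U : X.Open} (s : idealOf i U) (y : R.obj.left)
    (hy : y ∈ S.D U s) {V : X.Open} (hV : V ≤ U) (t : idealOf i V) (hyV : pt r y ∈ V) :
    Stk R.obj y :=
  Stk.germ (U := S.D U s ⊓ preim r V) y (mem_inf_preim hy hyV) ((S.coord U s).hom V hV (symι i t))

variable (S : ResidualSpace i r)

theorem coordGerm_res {U : X.Open} (s : idealOf i U) (y : R.obj.left) (hy : y ∈ S.D U s)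
    {V V' : X.Open} (hV : V ≤ U) (h : V' ≤ V) (t : idealOf i V) (hyV : pt r y ∈ V') :
    S.coordGerm s y hy (h.trans hV) (idealRes i h t) hyV = S.coordGerm s y hy hV t (h hyV) := by
  unfold coordGerm
  rw [(S.coord U s).hom_res V V' hV h t, germ_res]

theorem coordGerm_add {U : X.Open} (s : idealOf i U) (y : R.obj.left) (hy : y ∈ S.D U s)
    {V : X.Open} (hV : V ≤ U) (t t' : idealOf i V) (hyV : pt r y ∈ V) :
    S.coordGerm s y hy hV (t + t') hyV = S.coordGerm s y hy hV t hyV +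
      S.coordGerm s y hy hV t' hyV := by
  unfold coordGerm symι
  rw [map_add, map_add, map_add]

theorem coordGerm_smul {U : X.Open} (s : idealOf i U) (y : R.obj.left) (hy : y ∈ S.D U s)
    {V : X.Open} (hV : V ≤ U) (a : X.Sec V) (t : idealOf i V) (hyV : pt r y ∈ V) :
    S.coordGerm s y hy hV (a • t) hyV =
      stk r y (Stk.germ (pt r y) hyV a) * S.coordGerm s y hy hV t hyV := by
  unfold coordGerm symι
  rw [map_smul, Algebra.smul_def, map_mul, map_mul, (S.coord U s).hom_algebraMap,
    germ_appLE _ _ _ _ hyV]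

theorem coordGerm_self {U : X.Open} (s : idealOf i U) (y : R.obj.left) (hy : y ∈ S.D U s) :
    S.coordGerm s y hy le_rfl s (S.D_le U s hy) = 1 := by
  unfold coordGerm
  rw [S.coord_self, map_one]

theorem mem_D_iff_coordGerm {U V : X.Open} (s : idealOf i U) (t : idealOf i V) (y : R.obj.left)
    (hy : y ∈ S.D U s) (hyV : pt r y ∈ V) :
    y ∈ S.D V t ↔ IsUnit (S.coordGerm s y hy inf_le_left
      (idealRes i (inf_le_right : U ⊓ V ≤ V) t) (Opens.mem_inf.2 ⟨S.D_le U s hy, hyV⟩)) :=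
  S.mem_D_iff U V s t y hy hyV

theorem coordGerm_mul {U V V' : X.Open} (s : idealOf i U) (t : idealOf i V) (hU : V' ≤ U)
    (hV : V' ≤ V) (x : idealOf i V') (y : R.obj.left) (hy : y ∈ S.D U s) (hy' : y ∈ S.D V t)
    (hyV : pt r y ∈ V') :
    S.coordGerm t y hy' hV x hyV * S.coordGerm s y hy hU (idealRes i hV t) hyV =
      S.coordGerm s y hy hU x hyV := by
  have h := congrArg (Stk.germ (Z := R.obj) y
    (show y ∈ (S.D U s ⊓ S.D V t) ⊓ preim r V' from ⟨⟨hy, hy'⟩, hyV⟩))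
    (S.coord_mul U V V' s t hU hV x)
  rw [map_mul, germ_res, germ_res, germ_res] at h
  exact h

/-- The universal property of `D₊(s)`, in terms of the restriction of the algebra homomorphisms to
degree one. -/
theorem exists_hom {U : X.Open} (s : idealOf i U) (g : T ⟶ X) (hg : ∀ t, pt g t ∈ U)
    (l : ∀ V : X.Open, V ≤ U → idealOf i V → T.Sec (⊤ ⊓ preim g V))
    (add : ∀ V hV x y, l V hV (x + y) = l V hV x + l V hV y)
    (smul : ∀ V hV (a : X.Sec V) x, l V hV (a • x) = appLE g V _ inf_le_right a * l V hV x)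
    (res : ∀ V V' hV (h : V' ≤ V) x, l V' (h.trans hV) (idealRes i h x) =
      T.res (inf_le_inf_left ⊤ ((Opens.map (lrsHom g).base).monotone h)) (l V hV x))
    (one : l U le_rfl s = 1) :
    ∃ h : T ⟶ R, h ≫ r = g ∧ (∀ t, pt h t ∈ S.D U s) ∧
      ∀ (V : X.Open) (hV : V ≤ U) (x : idealOf i V) (t : T.obj.left) (ht : t ∈ ⊤ ⊓ preim g V)
        (hD : pt h t ∈ S.D U s) (ht' : pt r (pt h t) ∈ V),
        Stk.germ t ht (l V hV x) = stk h t (S.coordGerm s (pt h t) hD hV x ht') := by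
  obtain ⟨h, ⟨hr, hD, hh⟩, -⟩ := S.universal U s T g (fun t _ => hg t)
    (SymAlgHom.ofDegreeOne l add smul res) (by rw [SymAlgHom.ofDegreeOne_hom, one])
  refine ⟨h, hr, fun t => hD trivial, fun V hV x t ht hD' ht' => ?_⟩
  rw [← SymAlgHom.ofDegreeOne_hom l add smul res, hh V hV,
    germ_appLE _ _ _ _ (mem_inf_preim hD' ht')]
  rfl

/-- Maps to `D₊(s)` over `X` are determined by the pullbacks of the functions `x / s`. -/
theorem hom_ext {U : X.Open} (s : idealOf i U) {h₁ h₂ : T ⟶ R} (hr : h₁ ≫ r = h₂ ≫ r)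
    (h₁D : ∀ t, pt h₁ t ∈ S.D U s) (h₂D : ∀ t, pt h₂ t ∈ S.D U s)
    (h : ∀ (V : X.Open) (hV : V ≤ U) (x : idealOf i V) (t : T.obj.left) (ht₁ : pt r (pt h₁ t) ∈ V)
      (ht₂ : pt r (pt h₂ t) ∈ V), stk h₁ t (S.coordGerm s (pt h₁ t) (h₁D t) hV x ht₁) =
        stk h₂ t (S.coordGerm s (pt h₂ t) (h₂D t) hV x ht₂)) : h₁ = h₂ := by
  have hV₁ : ∀ V : X.Open, ⊤ ⊓ preim (h₁ ≫ r) V ≤ preim h₁ (S.D U s ⊓ preim r V) :=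
    fun V t ht => ⟨h₁D t, ht.2⟩
  have key : ∀ (V : X.Open) (k : T ⟶ R) (_ : k ≫ r = h₁ ≫ r)
      (h' : ⊤ ⊓ preim (h₁ ≫ r) V ≤ preim k (S.D U s ⊓ preim r V)) (hV : V ≤ U) (a : X.Sec V),
      appLE k _ _ h' ((S.coord U s).hom V hV (algebraMap _ _ a)) =
        appLE (h₁ ≫ r) V _ inf_le_right a := by
    intro V k hk h' hV a
    have h'' : ⊤ ⊓ preim (h₁ ≫ r) V ≤ preim (k ≫ r) V := fun t ht => (h' ht).2
    have h3 : appLE (k ≫ r) V _ h'' a = appLE (h₁ ≫ r) V _ inf_le_right a := by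
      have : ∀ (q q' : T ⟶ X) (_ : q = q') (h1 : ⊤ ⊓ preim (h₁ ≫ r) V ≤ preim q V)
          (h2 : ⊤ ⊓ preim (h₁ ≫ r) V ≤ preim q' V), appLE q V _ h1 a = appLE q' V _ h2 a := by
        rintro q _ rfl _ _
        rfl
      exact this _ _ hk _ _
    rw [← h3, (S.coord U s).hom_algebraMap]
    refine sec_ext fun t ht => ?_
    rw [germ_appLE _ _ _ _ (mem_preim.1 (h' ht)), germ_appLE _ _ _ _ (mem_preim.1 (h'' ht))]
    refine (congrArg (stk k t) (germ_appLE _ _ _ _ (mem_preim.1 (h' ht).2))).trans ?_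
    exact (Stk.map_comp k.hom r.hom t _).symm
  let α : SymAlgHom i (h₁ ≫ r) U ⊤ :=
    { hom := fun V hV => (appLE h₁ (S.D U s ⊓ preim r V) _ (hV₁ V)).comp ((S.coord U s).hom V hV)
      hom_algebraMap := fun V hV a => key V h₁ rfl (hV₁ V) hV a
      hom_res := fun V V' hV h x => sec_ext fun t ht => by
        rw [RingHom.comp_apply, RingHom.comp_apply, (S.coord U s).hom_res V V' hV h x, germ_res,
          germ_appLE _ _ _ _ (mem_preim.1 (hV₁ V' ht)),
          germ_appLE _ _ _ _ (mem_inf_preim (h₁D t) (h ht.2)), germ_res] }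
  obtain ⟨k, -, hk⟩ := S.universal U s T (h₁ ≫ r) (fun t _ => S.D_le U s (h₁D t)) α (by
    change appLE h₁ _ _ _ ((S.coord U s).hom U le_rfl (symι i s)) = 1
    rw [S.coord_self, map_one])
  refine (hk h₁ ⟨rfl, fun t _ => h₁D t, fun V hV x => rfl⟩).trans
    (hk h₂ ⟨hr.symm, fun t _ => h₂D t, fun V hV x => ?_⟩).symm
  have hV₂ : ⊤ ⊓ preim (h₁ ≫ r) V ≤ preim h₂ (S.D U s ⊓ preim r V) :=
    fun t ht => ⟨h₂D t, (congrArg (fun q => pt q t ∈ V) hr).mp ht.2⟩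
  refine RingHom.congr_fun (symIdeal_ringHom_ext (f := α.hom V hV)
    (g := (appLE h₂ _ _ hV₂).comp ((S.coord U s).hom V hV)) (fun a => ?_) fun x => ?_) x
  · exact (key V h₁ rfl (hV₁ V) hV a).trans (key V h₂ hr.symm hV₂ hV a).symm
  · refine sec_ext fun t ht => ?_
    refine (germ_appLE (hV₁ V) _ t ht (hV₁ V ht)).trans ?_
    refine Eq.trans ?_ (germ_appLE hV₂ _ t ht (hV₂ ht)).symm
    exact h V hV x t ht.2 (hV₂ ht).2

end ResidualSpace

end

section

open ComplexSpace

variable {W X T R : ComplexSpace} {i : W ⟶ X} {r : R ⟶ X}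

/-! ### The points of a residual space with values in a fat point -/

/-- The germ of a function that vanishes on the subspace. -/
def idealGerm (i : W ⟶ X) {U : X.Open} (x : X.obj.left) (hx : x ∈ U) (s : idealOf i U) :
    stalkIdeal i x :=
  ⟨Stk.germ x hx s.1, U, hx, s.1, s.2, rfl⟩

theorem idealGerm_res {U V : X.Open} (h : V ≤ U) (x : X.obj.left) (hx : x ∈ V) (s : idealOf i U) :
    idealGerm i x hx (idealRes i h s) = idealGerm i x (h hx) s :=
  Subtype.ext (germ_res h s.1 x hx)

theorem exists_idealGerm {x : X.obj.left} (a : stalkIdeal i x) :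
    ∃ (U : X.Open) (hx : x ∈ U) (s : idealOf i U), idealGerm i x hx s = a := by
  obtain ⟨_, U, hx, s, hs, rfl⟩ := a
  exact ⟨U, hx, ⟨s, hs⟩, rfl⟩

theorem idealGerm_add {U : X.Open} (x : X.obj.left) (hx : x ∈ U) (s t : idealOf i U) :
    idealGerm i x hx (s + t) = idealGerm i x hx s + idealGerm i x hx t :=
  Subtype.ext (map_add (Stk.germ (Z := X.obj) x hx) s.1 t.1)

theorem idealGerm_smul {U : X.Open} (x : X.obj.left) (hx : x ∈ U) (a : X.Sec U) (s : idealOf i U) :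
    idealGerm i x hx (a • s) = Stk.germ x hx a • idealGerm i x hx s :=
  Subtype.ext (map_mul (Stk.germ (Z := X.obj) x hx) a s.1)

/-- The functions with the same germ agree near the point. -/
theorem exists_idealRes_eq {x : X.obj.left} {U V : X.Open} {hU : x ∈ U} {hV : x ∈ V}
    {s : idealOf i U} {t : idealOf i V} (h : idealGerm i x hU s = idealGerm i x hV t) :
    ∃ (O : X.Open) (_ : x ∈ O) (hOU : O ≤ U) (hOV : O ≤ V),
      idealRes i hOU s = idealRes i hOV t := by
  obtain ⟨O, hO, hOU, hOV, h⟩ := exists_res_eq_of_germ_eq (X := X) hU hV (congrArg Subtype.val h)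
  exact ⟨O, hO, hOU, hOV, Subtype.ext h⟩

/-- Semilinear forms on the stalk of the ideal sheaf, along a homomorphism from the stalk of the
structure sheaf. -/
abbrev IdealForm (i : W ⟶ X) {x : X.obj.left} {A : Type} [CommRing A] [Algebra ℂ A]
    (φ : Stk X.obj x →ₐ[ℂ] A) : Type :=
  stalkIdeal i x →ₛₗ[(φ : Stk X.obj x →+* A)] A

namespace ResidualSpace

variable (S : ResidualSpace i r)

/-- Division by `s`, on the stalk of the ideal at a point of `D₊(s)`. -/
theorem exists_stalkCoord {U : X.Open} (s : idealOf i U) (y : R.obj.left) (hy : y ∈ S.D U s) :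
    ∃ c : IdealForm i (stk r y), ∀ (V : X.Open) (hV : V ≤ U) (t : idealOf i V) (hyV : pt r y ∈ V),
      c (idealGerm i _ hyV t) = S.coordGerm s y hy hV t hyV := by
  have h1 : ∀ a : stalkIdeal i (pt r y), ∃ (V : X.Open) (hV : V ≤ U) (hyV : pt r y ∈ V)
      (t : idealOf i V), idealGerm i _ hyV t = a := by
    intro a
    obtain ⟨V, hyV, t, rfl⟩ := exists_idealGerm a
    exact ⟨U ⊓ V, inf_le_left, Opens.mem_inf.2 ⟨S.D_le U s hy, hyV⟩, idealRes i inf_le_right t,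
      idealGerm_res _ _ _ _⟩
  choose V hV hyV t ht using h1
  have h2 : ∀ (V₁ V₂ : X.Open) (hV₁ : V₁ ≤ U) (hV₂ : V₂ ≤ U) (t₁ : idealOf i V₁) (t₂ : idealOf i V₂)
      (h₁ : pt r y ∈ V₁) (h₂ : pt r y ∈ V₂), idealGerm i _ h₁ t₁ = idealGerm i _ h₂ t₂ →
      S.coordGerm s y hy hV₁ t₁ h₁ = S.coordGerm s y hy hV₂ t₂ h₂ := by
    intro V₁ V₂ hV₁ hV₂ t₁ t₂ h₁ h₂ h
    obtain ⟨O, hO, hO₁, hO₂, h⟩ := exists_idealRes_eq h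
    rw [← S.coordGerm_res s y hy hV₁ hO₁ t₁ hO, h, S.coordGerm_res s y hy hV₂ hO₂ t₂ hO]
  refine ⟨{ toFun := fun a => S.coordGerm s y hy (hV a) (t a) (hyV a)
            map_add' := fun a b => ?_
            map_smul' := fun f a => ?_ }, fun V' hV' t' hyV' => h2 _ _ _ _ _ _ _ _ (ht _)⟩
  · have h3 : pt r y ∈ V a ⊓ V b := Opens.mem_inf.2 ⟨hyV a, hyV b⟩
    rw [← S.coordGerm_res s y hy (hV a) inf_le_left (t a) h3,
      ← S.coordGerm_res s y hy (hV b) inf_le_right (t b) h3, ← S.coordGerm_add]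
    refine h2 _ _ _ _ _ _ _ _ ?_
    rw [ht, idealGerm_add, idealGerm_res, idealGerm_res, ht, ht]
  · obtain ⟨V', hyV', f, rfl⟩ := exists_germ _ f
    have h3 : pt r y ∈ V' ⊓ V a := Opens.mem_inf.2 ⟨hyV', hyV a⟩
    have h4 : S.coordGerm s y hy (hV (Stk.germ _ hyV' f • a)) (t (Stk.germ _ hyV' f • a)) (hyV _) =
        S.coordGerm s y hy (inf_le_right.trans (hV a))
          (X.res (inf_le_left : V' ⊓ V a ≤ V') f • idealRes i inf_le_right (t a)) h3 := by
      refine h2 _ _ _ _ _ _ _ _ ?_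
      rw [ht, idealGerm_smul, germ_res, idealGerm_res, ht]
    refine h4.trans ?_
    rw [S.coordGerm_smul, germ_res, S.coordGerm_res s y hy (hV a)]
    rfl

variable {A : Type} [CommRing A] [Algebra ℂ A] [IsFatAlg A]

/-- The map `h` from a fat point to the residual space is given by the form `α` on the ideal: the
point lies in `D₊(s)` if and only if `α s` is invertible, and then `h^* (t / s) = α t / α s`. -/
structure Rep (h : fat A ⟶ R) {x : X.obj.left} {φ : Stk X.obj x →ₐ[ℂ] A} (α : IdealForm i φ) :
    Prop where
  comm : h ≫ r = fatHom x φ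
  mem_D (U : X.Open) (s : idealOf i U) (hx : x ∈ U) :
    fpt h ∈ S.D U s ↔ IsUnit (α (idealGerm i x hx s))
  coord (U : X.Open) (s : idealOf i U) (hD : fpt h ∈ S.D U s) (V : X.Open) (hV : V ≤ U)
    (t : idealOf i V) (hx : x ∈ V) (hx' : pt r (fpt h) ∈ V) :
    fev h (S.coordGerm s (fpt h) hD hV t hx') * α (idealGerm i x (hV hx) s) =
      α (idealGerm i x hx t)

theorem isUnit_fev_iff (h : fat A ⟶ X) {a : Stk X.obj (fpt h)} : IsUnit (fev h a) ↔ IsUnit a := by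
  refine ⟨fun ha => ?_, fun ha => ha.map _⟩
  by_contra hn
  exact (IsLocalRing.mem_maximalIdeal _).1 (IsAnalyticAlg.map_mem_maximalIdeal (fev h)
    ((IsLocalRing.mem_maximalIdeal _).2 hn)) ha

theorem pt_fpt {h : fat A ⟶ R} {x : X.obj.left} {φ : Stk X.obj x →ₐ[ℂ] A}
    (hr : h ≫ r = fatHom x φ) : pt r (fpt h) = x :=
  (congrArg fpt hr).trans (fpt_fatHom x φ)

variable {S}

/-- It suffices to know `h` in terms of the coordinates on one of the pieces `D₊(s)`. -/
theorem Rep.of_mem {h : fat A ⟶ R} {x : X.obj.left} {φ : Stk X.obj x →ₐ[ℂ] A} {α : IdealForm i φ}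
    (hr : h ≫ r = fatHom x φ) {U : X.Open} (s : idealOf i U) (hx : x ∈ U) (hD : fpt h ∈ S.D U s)
    (hu : IsUnit (α (idealGerm i x hx s)))
    (H : ∀ (V : X.Open) (hV : V ≤ U) (t : idealOf i V) (hx : x ∈ V) (hx' : pt r (fpt h) ∈ V),
      fev h (S.coordGerm s (fpt h) hD hV t hx') * α (idealGerm i x (hV hx) s) =
        α (idealGerm i x hx t)) : S.Rep h α := by
  have hpt := pt_fpt hr
  refine ⟨hr, fun V t hxV => ?_, fun V t hDt V' hV' t' hxV' hx' => ?_⟩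
  · rw [S.mem_D_iff_coordGerm s t (fpt h) hD (hpt ▸ hxV), ← isUnit_fev_iff,
      ← hu.mul_right_iff, H _ _ _ (Opens.mem_inf.2 ⟨hx, hxV⟩), idealGerm_res]
  · have hm : pt r (fpt h) ∈ V' ⊓ U := Opens.mem_inf.2 ⟨hx', hpt ▸ hx⟩
    have hm' : x ∈ V' ⊓ U := Opens.mem_inf.2 ⟨hxV', hx⟩
    have h1 := congrArg (fev h) (S.coordGerm_mul s t (V' := V' ⊓ U) inf_le_right
      (inf_le_left.trans hV') (idealRes i inf_le_left t') (fpt h) hD hDt hm)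
    have h2 := congrArg (· * α (idealGerm i x hx s)) h1
    simp only [map_mul, mul_assoc] at h2
    rw [H _ _ _ hm', H _ _ _ hm', idealGerm_res, idealGerm_res,
      S.coordGerm_res t (fpt h) hDt hV' inf_le_left t' hm] at h2
    exact h2

theorem Rep.smul {h : fat A ⟶ R} {x : X.obj.left} {φ : Stk X.obj x →ₐ[ℂ] A} {α : IdealForm i φ}
    (H : S.Rep h α) {c : A} (hc : IsUnit c) : S.Rep h (c • α) := by
  refine ⟨H.comm, fun U s hx => ?_, fun U s hD V hV t hx hx' => ?_⟩
  · rw [H.mem_D U s hx, LinearMap.smul_apply, smul_eq_mul, hc.mul_left_iff]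
  · rw [LinearMap.smul_apply, LinearMap.smul_apply, smul_eq_mul, smul_eq_mul,
      ← H.coord U s hD V hV t hx hx']
    ring

variable (S) in
theorem exists_mem_D (h : fat A ⟶ R) {x : X.obj.left} {φ : Stk X.obj x →ₐ[ℂ] A}
    (hr : h ≫ r = fatHom x φ) :
    ∃ (U : X.Open) (_ : x ∈ U) (s : idealOf i U), fpt h ∈ S.D U s := by
  obtain ⟨U, s, hs⟩ := S.cover (fpt h)
  exact ⟨U, pt_fpt hr ▸ S.D_le U s hs, s, hs⟩

variable (S) in
/-- Every map from a fat point to the residual space is given by a form on the ideal. -/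
theorem exists_rep (h : fat A ⟶ R) {x : X.obj.left} {φ : Stk X.obj x →ₐ[ℂ] A}
    (hr : h ≫ r = fatHom x φ) : ∃ α : IdealForm i φ, S.Rep h α := by
  obtain ⟨U, hx, s, hs⟩ := S.exists_mem_D h hr
  obtain ⟨y, ψ, rfl⟩ := exists_eq_fatHom h
  have hr' := hr
  rw [fatHom_comp] at hr'
  obtain rfl := fatHom_pt_eq hr'
  obtain rfl := fatHom_injective hr'
  have hy : y ∈ S.D U s := by rwa [fpt_fatHom] at hs
  obtain ⟨c, hc⟩ := S.exists_stalkCoord s y hy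
  let α : IdealForm i (ψ.comp (stk r y)) :=
    { toFun := fun a => ψ (c a)
      map_add' := fun a b => by rw [map_add, map_add]
      map_smul' := fun f a => by
        rw [map_smulₛₗ, smul_eq_mul, map_mul]
        rfl }
  have h1 : α (idealGerm i _ hx s) = 1 := by
    change ψ (c _) = 1
    rw [hc U le_rfl s hx, S.coordGerm_self, map_one]
  refine ⟨α, Rep.of_mem hr s hx hs (h1 ▸ isUnit_one) fun V hV t hxV hxV' => ?_⟩
  rw [h1, mul_one]
  refine (fev_fatHom y ψ _ _ (mem_inf_preim hy hxV) _).trans ?_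
  exact congrArg ψ (hc V hV t hxV).symm

/-- The form on the ideal is unique up to a unit. -/
theorem Rep.exists_smul_eq {h : fat A ⟶ R} {x : X.obj.left} {φ : Stk X.obj x →ₐ[ℂ] A}
    {α β : IdealForm i φ} (H : S.Rep h α) (H' : S.Rep h β) : ∃ c : A, IsUnit c ∧ β = c • α := by
  obtain ⟨U, hx, s, hs⟩ := S.exists_mem_D h H.comm
  obtain ⟨u, hu⟩ := (H.mem_D U s hx).1 hs
  refine ⟨β (idealGerm i x hx s) * ↑u⁻¹, ((H'.mem_D U s hx).1 hs).mul (Units.isUnit _),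
    LinearMap.ext fun a => ?_⟩
  obtain ⟨V, hxV, t, rfl⟩ := exists_idealGerm a
  have hm : x ∈ U ⊓ V := Opens.mem_inf.2 ⟨hx, hxV⟩
  have hm' : pt r (fpt h) ∈ U ⊓ V := pt_fpt H.comm ▸ hm
  have h1 := H.coord U s hs (U ⊓ V) inf_le_left (idealRes i inf_le_right t) hm hm'
  have h2 := H'.coord U s hs (U ⊓ V) inf_le_left (idealRes i inf_le_right t) hm hm'
  rw [idealGerm_res] at h1 h2
  rw [LinearMap.smul_apply, smul_eq_mul, ← h1, ← h2, ← hu]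
  linear_combination
    (-(fev h (S.coordGerm s (fpt h) hs inf_le_left (idealRes i inf_le_right t) hm') *
    β (idealGerm i x hx s))) * u.inv_mul

theorem pt_fatHom (x : X.obj.left) (φ : Stk X.obj x →ₐ[ℂ] A) (t : (fat A).obj.left) :
    pt (fatHom x φ) t = x := (exists_fatHom x φ).choose_spec.1 t

theorem stk_fatHom_germ (x : X.obj.left) (φ : Stk X.obj x →ₐ[ℂ] A) (t : (fat A).obj.left)
    {U : X.Open} (s : X.Sec U) (hx : x ∈ U) (ht : pt (fatHom x φ) t ∈ U) :
    stk (fatHom x φ) t (Stk.germ _ ht s) = fatStalk A t (φ (Stk.germ x hx s)) :=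
  (stk_germ _ _ _ _ _).trans ((exists_fatHom x φ).choose_spec.2 U s t hx ht)

/-- Maps from a fat point that are given by proportional forms are equal. -/
theorem Rep.hom_ext {h h' : fat A ⟶ R} {x : X.obj.left} {φ : Stk X.obj x →ₐ[ℂ] A}
    {α β : IdealForm i φ} (H : S.Rep h α) (H' : S.Rep h' β)
    (hαβ : ∀ a b, α a * β b = α b * β a) : h = h' := by
  obtain ⟨U, hx, s, hs⟩ := S.exists_mem_D h H.comm
  obtain ⟨V, hxV, t, ht⟩ := S.exists_mem_D h' H'.comm
  have hα := (H.mem_D U s hx).1 hs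
  have hβ : IsUnit (β (idealGerm i x hx s)) := by
    have h1 : IsUnit (α (idealGerm i x hxV t) * β (idealGerm i x hx s)) := by
      rw [← hαβ]
      exact hα.mul ((H'.mem_D V t hxV).1 ht)
    exact isUnit_of_mul_isUnit_right h1
  have hs' := (H'.mem_D U s hx).2 hβ
  have hu : ∀ p : (fat A).obj.left, p = fatPoint A := fun p => (subsingleton_fatOver A).elim _ _
  refine S.hom_ext s (H.comm.trans H'.comm.symm) (fun p => (hu p).symm ▸ hs)
    (fun p => (hu p).symm ▸ hs') fun V' hV' t' p h₁ h₂ => ?_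
  obtain rfl := hu p
  refine (fatStalk A (fatPoint A)).symm.injective ?_
  change fev h (S.coordGerm s (fpt h) hs hV' t' h₁) = fev h' (S.coordGerm s (fpt h') hs' hV' t' h₂)
  have hxV' : x ∈ V' := pt_fpt H.comm ▸ h₁
  have h3 := H.coord U s hs V' hV' t' hxV' h₁
  have h4 := H'.coord U s hs' V' hV' t' hxV' h₂
  refine (hα.mul hβ).mul_right_cancel ?_
  rw [← mul_assoc, h3, mul_comm (α (idealGerm i x _ s)), ← mul_assoc, h4, hαβ, mul_comm]

variable (S) in
/-- A form on the ideal with an invertible value gives a map from the fat point. -/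
theorem exists_hom_of_form {x : X.obj.left} {φ : Stk X.obj x →ₐ[ℂ] A} (α : IdealForm i φ)
    {a : stalkIdeal i x} (ha : IsUnit (α a)) : ∃ h : fat A ⟶ R, S.Rep h α := by
  classical
  suffices H : ∀ β : IdealForm i φ, β a = 1 → ∃ h : fat A ⟶ R, S.Rep h β by
    obtain ⟨u, hu⟩ := ha
    obtain ⟨h, hh⟩ := H ((↑u⁻¹ : A) • α) (by
      rw [LinearMap.smul_apply, ← hu, smul_eq_mul, Units.inv_mul])
    refine ⟨h, ?_⟩
    have h1 := hh.smul u.isUnit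
    rwa [smul_smul, Units.mul_inv, one_smul] at h1
  clear ha α
  intro α ha
  obtain ⟨U, hx, s, rfl⟩ := exists_idealGerm a
  let g := fatHom x φ
  let l : ∀ V : X.Open, V ≤ U → idealOf i V → (fat A).Sec (⊤ ⊓ preim g V) := fun V _ t =>
    if hV : x ∈ V then fatSection A (⊤ ⊓ preim g V) (α (idealGerm i x hV t)) else 0
  have hl : ∀ V hV t (p : (fat A).obj.left) (hp : p ∈ ⊤ ⊓ preim g V) (hxV : x ∈ V),
      Stk.germ p hp (l V hV t) = fatStalk A p (α (idealGerm i x hxV t)) := by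
    intro V hV t p hp hxV
    have h1 : l V hV t = fatSection A (⊤ ⊓ preim g V) (α (idealGerm i x hxV t)) := dif_pos hxV
    rw [h1]
    exact germ_fatSection A _ p hp _
  have hm : ∀ (V : X.Open) (p : (fat A).obj.left), p ∈ ⊤ ⊓ preim g V → x ∈ V := by
    intro V p hp
    have h1 : pt g p ∈ V := hp.2
    rwa [pt_fatHom] at h1
  obtain ⟨h, hr, hD, hh⟩ := S.exists_hom s g (fun t => by rwa [pt_fatHom]) l
    (fun V hV t t' => sec_ext fun p hp => by
      rw [map_add, hl V hV _ _ _ (hm V p hp), hl V hV _ _ _ (hm V p hp),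
        hl V hV _ _ _ (hm V p hp), idealGerm_add, map_add, map_add])
    (fun V hV f t => sec_ext fun p hp => by
      rw [map_mul, hl V hV _ _ _ (hm V p hp), hl V hV _ _ _ (hm V p hp), idealGerm_smul, map_smulₛₗ,
        smul_eq_mul, map_mul, germ_appLE _ _ _ _ (mem_preim.1 hp.2),
        stk_fatHom_germ x φ p f (hm V p hp) (mem_preim.1 hp.2)]
      rfl)
    (fun V V' hV hV' t => sec_ext fun p hp => by
      rw [germ_res, hl V' (hV'.trans hV) _ _ _ (hm V' p hp), hl V hV _ _ _ (hV' (hm V' p hp)),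
        idealGerm_res])
    (sec_ext fun p hp => by
      rw [hl U le_rfl _ _ _ (hm U p hp), ha, map_one, map_one])
  refine ⟨h, Rep.of_mem hr s hx (hD _) (ha ▸ isUnit_one) fun V hV t hxV hxV' => ?_⟩
  have h1 : fatPoint A ∈ (⊤ : (fat A).Open) ⊓ preim g V :=
    mem_inf_preim trivial ((pt_fatHom x φ _).symm ▸ hxV)
  have h2 := hh V hV t (fatPoint A) h1 (hD _) hxV'
  rw [hl V hV _ _ _ hxV] at h2
  rw [ha, mul_one]
  exact (AlgEquiv.symm_apply_eq _).2 h2.symm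

end ResidualSpace

end

section

open ComplexSpace

variable {X Y Z : ComplexSpace}

/-! ### Gluing holomorphic maps -/

/-- Open subspaces of complex spaces. -/
def openSub (X : ComplexSpace) (U : X.Open) : ComplexSpace :=
  ⟨restrictOver X.obj U, isComplexSpace_restrictOver X.property U⟩

/-- The inclusion of an open subspace. -/
def incl (X : ComplexSpace) (U : X.Open) : openSub X U ⟶ X :=
  ObjectProperty.homMk (openIncl X.obj U)

/-- A point of `U` as a point of the open subspace. -/
def subPt {U : X.Open} (x : X.obj.left) (hx : x ∈ U) : (openSub X U).obj.left :=
  openPt ⟨x, hx⟩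

/-- The identification of the stalks of an open subspace. -/
def subStk {U : X.Open} (x : X.obj.left) (hx : x ∈ U) :
    Stk X.obj x ≃ₐ[ℂ] Stk (openSub X U).obj (subPt x hx) :=
  openStk X.obj U ⟨x, hx⟩

theorem subStk_apply {U : X.Open} (x : X.obj.left) (hx : x ∈ U) (a : Stk X.obj x) :
    subStk x hx a = stk (incl X U) (subPt x hx) a := rfl

theorem pt_incl_mem {U : X.Open} (x : (openSub X U).obj.left) : pt (incl X U) x ∈ U := x.2

section fat

variable {A : Type} [CommRing A] [Algebra ℂ A] [IsFatAlg A]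

theorem fatHom_subPt_comp_incl {U : X.Open} (x : X.obj.left) (hx : x ∈ U)
    (θ : Stk X.obj x →ₐ[ℂ] A) :
    fatHom (subPt x hx) (θ.comp ((subStk x hx).symm :
      Stk (openSub X U).obj (subPt x hx) →ₐ[ℂ] Stk X.obj x)) ≫ incl X U = fatHom x θ := by
  rw [fatHom_comp]
  refine congrArg (fatHom x) (AlgHom.ext fun a => ?_)
  exact congrArg θ ((subStk x hx).symm_apply_apply a)

theorem fatHom_germ_eq {x y : X.obj.left} {φ : Stk X.obj x →ₐ[ℂ] A} {ψ : Stk X.obj y →ₐ[ℂ] A}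
    (h : fatHom x φ = fatHom y ψ) {U : X.Open} (s : X.Sec U) (hx : x ∈ U) (hy : y ∈ U) :
    φ (Stk.germ x hx s) = ψ (Stk.germ y hy s) := by
  obtain rfl := fatHom_pt_eq h
  rw [fatHom_injective h]

end fat

/-- Germs are equal if they have equal images in the functions on all fat points. -/
theorem stk_ext {x : X.obj.left} {a b : Stk X.obj x}
    (h : ∀ (A : Type) [CommRing A] [Algebra ℂ A] [IsFatAlg A] (θ : Stk X.obj x →ₐ[ℂ] A),
      θ a = θ b) : a = b := by
  rw [← sub_eq_zero, ← Ideal.mem_bot]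
  refine mem_of_forall_fat bot_ne_top fun A _ _ _ θ _ _ => ?_
  rw [map_sub, h, sub_self]

/-- A correspondence `Q` between maps from fat points to `X` and to `Z` that is locally induced by
holomorphic maps is induced by a holomorphic map. -/
theorem exists_hom_of_local
    (Q : ∀ (A : Type) [CommRing A] [Algebra ℂ A] [IsFatAlg A], (fat A ⟶ X) → (fat A ⟶ Z) → Prop)
    (hQ : ∀ (A : Type) [CommRing A] [Algebra ℂ A] [IsFatAlg A] (g : fat A ⟶ X) (g₁ g₂ : fat A ⟶ Z),
      Q A g g₁ → Q A g g₂ → g₁ = g₂)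
    (H : ∀ x : X.obj.left, ∃ (U : X.Open) (_ : x ∈ U) (k : openSub X U ⟶ Z),
      ∀ (A : Type) [CommRing A] [Algebra ℂ A] [IsFatAlg A] (g : fat A ⟶ openSub X U),
        Q A (g ≫ incl X U) (g ≫ k)) :
    ∃ h : X ⟶ Z, ∀ (A : Type) [CommRing A] [Algebra ℂ A] [IsFatAlg A] (g : fat A ⟶ X),
      Q A g (g ≫ h) := by
  choose U hU k hk using H
  let f : X.obj.left → Z.obj.left := fun y => pt (k y) (subPt y (hU y))
  let ψ : ∀ y : X.obj.left, Stk Z.obj (f y) →ₐ[ℂ] Stk X.obj y := fun y =>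
    ((subStk y (hU y)).symm : Stk (openSub X (U y)).obj (subPt y (hU y)) →ₐ[ℂ] Stk X.obj y).comp
      (stk (k y) (subPt y (hU y)))
  have h1 : ∀ (y y' : X.obj.left) (hy' : y' ∈ U y) (A : Type) [CommRing A] [Algebra ℂ A]
      [IsFatAlg A] (θ : Stk X.obj y' →ₐ[ℂ] A),
      fatHom (pt (k y) (subPt y' hy')) ((θ.comp ((subStk y' hy').symm :
        Stk (openSub X (U y)).obj (subPt y' hy') →ₐ[ℂ] Stk X.obj y')).comp
          (stk (k y) (subPt y' hy'))) = fatHom (f y') (θ.comp (ψ y')) := by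
    intro y y' hy' A _ _ _ θ
    have h2 := hk y A (fatHom (subPt y' hy') (θ.comp ((subStk y' hy').symm :
        Stk (openSub X (U y)).obj (subPt y' hy') →ₐ[ℂ] Stk X.obj y')))
    have h3 := hk y' A (fatHom (subPt y' (hU y')) (θ.comp ((subStk y' (hU y')).symm :
        Stk (openSub X (U y')).obj (subPt y' (hU y')) →ₐ[ℂ] Stk X.obj y')))
    rw [fatHom_subPt_comp_incl] at h2 h3
    have h4 := hQ A _ _ _ h2 h3
    rw [fatHom_comp, fatHom_comp] at h4
    exact h4
  have hpt : ∀ (y y' : X.obj.left) (hy' : y' ∈ U y), pt (k y) (subPt y' hy') = f y' := by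
    intro y y' hy'
    obtain ⟨A, _, _, _, ⟨θ⟩⟩ := exists_fat_quotient (O := Stk X.obj y')
    exact fatHom_pt_eq (h1 y y' hy' A θ)
  have hst : ∀ (y y' : X.obj.left) (hy' : y' ∈ U y) (V : Z.Open) (s : Z.Sec V)
      (h₁ : pt (k y) (subPt y' hy') ∈ V) (h₂ : f y' ∈ V),
      (subStk y' hy').symm (stk (k y) (subPt y' hy') (Stk.germ _ h₁ s)) =
        ψ y' (Stk.germ _ h₂ s) :=
    fun y y' hy' V s h₁ h₂ => stk_ext fun A _ _ _ θ => fatHom_germ_eq (h1 y y' hy' A θ) s h₁ h₂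
  have hf : Continuous f := by
    refine continuous_iff_continuousAt.2 fun y => ?_
    refine ((openIncl_isOpenEmbedding X.obj (U y)).continuousAt_iff
      (x := subPt y (hU y))).1 ?_
    have h5 : f ∘ (openIncl X.obj (U y)).left.base = pt (k y) :=
      funext fun x => (hpt y _ (pt_incl_mem x)).symm
    rw [h5]
    exact (continuous_pt (k y)).continuousAt
  obtain ⟨h, hh, hh'⟩ := exists_hom_of_germs f hf ψ (by
    intro V s y hy
    obtain ⟨V', s', hV', hV'U, hs'⟩ := openIncl_exists_section X.obj (U y) (preim (k y) V)
      (app (k y) V s)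
    refine ⟨V', (hV' (subPt y (hU y))).2 hy, s', fun y' hy' => ?_⟩
    have h5 : pt (k y) (subPt y' (hV'U hy')) ∈ V := (hV' (subPt y' (hV'U hy'))).1 hy'
    refine ⟨hpt y y' (hV'U hy') ▸ h5, ?_⟩
    rw [← hst y y' (hV'U hy') V s h5]
    refine ((AlgEquiv.symm_apply_eq _).2 ?_).symm
    rw [subStk_apply, stk_germ]
    exact (hs' (subPt y' (hV'U hy')) h5 hy').symm)
  refine ⟨h, fun A _ _ _ g => ?_⟩
  obtain ⟨y, θ, rfl⟩ := exists_eq_fatHom g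
  have h2 := hk y A (fatHom (subPt y (hU y)) (θ.comp ((subStk y (hU y)).symm :
        Stk (openSub X (U y)).obj (subPt y (hU y)) →ₐ[ℂ] Stk X.obj y)))
  rw [fatHom_subPt_comp_incl] at h2
  have h3 : fatHom (subPt y (hU y)) (θ.comp ((subStk y (hU y)).symm :
        Stk (openSub X (U y)).obj (subPt y (hU y)) →ₐ[ℂ] Stk X.obj y)) ≫ k y = fatHom y θ ≫ h := by
    rw [fatHom_comp, fatHom_comp]
    refine fatHom_eq_fatHom (hh y).symm fun V s h₁ h₂ => ?_
    refine congrArg θ ?_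
    exact ((stk_germ h V s y h₂).trans (hh' V s y h₁ h₂)).symm
  rw [← h3]
  exact h2

end

section

open ComplexSpace

variable {W X R W' X' R' : ComplexSpace} {i : W ⟶ X} {r : R ⟶ X} {i' : W' ⟶ X'} {r' : R' ⟶ X'}
  {e : X ⟶ X'} {w : W ⟶ W'}

/-! ### Canonical morphisms of residual spaces -/

theorem stk_comp {X Y Z : ComplexSpace} (g : X ⟶ Y) (h : Y ⟶ Z) (x : X.obj.left)
    (a : Stk Z.obj (pt h (pt g x))) : stk (g ≫ h) x a = stk g x (stk h (pt g x) a) :=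
  Stk.map_comp g.hom h.hom x a

theorem idealPull_add (sq : i ≫ e = w ≫ i') (U : X'.Open) (s t : idealOf i' U) :
    idealPull sq U (s + t) = idealPull sq U s + idealPull sq U t :=
  Subtype.ext (map_add (app e U) s.1 t.1)

theorem idealPull_smul (sq : i ≫ e = w ≫ i') (U : X'.Open) (a : X'.Sec U) (s : idealOf i' U) :
    idealPull sq U (a • s) = app e U a • idealPull sq U s :=
  Subtype.ext (map_mul (app e U) a s.1)

theorem idealPull_res (sq : i ≫ e = w ≫ i') {U V : X'.Open} (h : V ≤ U) (s : idealOf i' U) :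
    idealPull sq V (idealRes i' h s) =
      idealRes i ((Opens.map (lrsHom e).base).monotone h) (idealPull sq U s) :=
  Subtype.ext (app_res e h s.1)

/-- Pullback of the germs of functions that vanish on the subspace. -/
def idealPullStalk (sq : i ≫ e = w ≫ i') (x : X.obj.left) (a : stalkIdeal i' (pt e x)) :
    stalkIdeal i x :=
  ⟨stk e x a.1, by
    obtain ⟨_, U, hx, s, hs, rfl⟩ := a
    rw [stk_germ]
    exact germ_mem_stalkIdeal (U := preim e U) hx (idealPull sq U ⟨s, hs⟩).2⟩

theorem idealPullStalk_idealGerm (sq : i ≫ e = w ≫ i') (x : X.obj.left) {U : X'.Open}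
    (hx : pt e x ∈ U) (s : idealOf i' U) :
    idealPullStalk sq x (idealGerm i' (pt e x) hx s) =
      idealGerm i x (mem_preim.2 hx) (idealPull sq U s) :=
  Subtype.ext (stk_germ e U s.1 x hx)

section fat

variable {A : Type} [CommRing A] [Algebra ℂ A] {x : X.obj.left} {φ : Stk X.obj x →ₐ[ℂ] A}

/-- The restriction of a form on the ideal along the pullback of functions. -/
def IdealForm.pull (sq : i ≫ e = w ≫ i') (α : IdealForm i φ) : IdealForm i' (φ.comp (stk e x)) where
  toFun a := α (idealPullStalk sq x a)
  map_add' a b := by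
    rw [← map_add]
    exact congrArg α (Subtype.ext (map_add (stk e x) a.1 b.1))
  map_smul' f a := by
    have h : idealPullStalk sq x (f • a) = stk e x f • idealPullStalk sq x a :=
      Subtype.ext (map_mul (stk e x) f a.1)
    rw [h, map_smulₛₗ]
    rfl

theorem IdealForm.pull_apply (sq : i ≫ e = w ≫ i') (α : IdealForm i φ)
    (a : stalkIdeal i' (pt e x)) : α.pull sq a = α (idealPullStalk sq x a) := rfl

theorem IdealForm.pull_idealGerm (sq : i ≫ e = w ≫ i') (α : IdealForm i φ) {U : X'.Open}
    (hx : pt e x ∈ U) (s : idealOf i' U) :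
    α.pull sq (idealGerm i' (pt e x) hx s) =
      α (idealGerm i x (mem_preim.2 hx) (idealPull sq U s)) := by
  rw [IdealForm.pull_apply, idealPullStalk_idealGerm]

theorem IdealForm.pull_smul (sq : i ≫ e = w ≫ i') (α : IdealForm i φ) (c : A) :
    (c • α).pull sq = c • α.pull sq := rfl

variable [IsFatAlg A]

theorem fev_comp_apply {X Y : ComplexSpace} (g : fat A ⟶ X) (h : X ⟶ Y)
    (a : Stk Y.obj (pt h (fpt g))) : fev (g ≫ h) a = fev g (stk h (fpt g) a) := by
  obtain ⟨U, hU, s, rfl⟩ := exists_germ _ a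
  exact (fev_comp g h U s hU).trans (congrArg (fev g) (stk_germ h U s _ hU).symm)

end fat

variable {S : ResidualSpace i r} {S' : ResidualSpace i' r'} {sq : i ≫ e = w ≫ i'}

theorem IsResidualMap.stk_coordGerm {κ : R ⟶ R'} (hκ : IsResidualMap S S' sq κ) {U V : X'.Open}
    (hV : V ≤ U) (s : idealOf i' U) (t : idealOf i' V) (y : R.obj.left)
    (hD' : pt κ y ∈ S'.D U s) (hy' : pt r' (pt κ y) ∈ V)
    (hD : y ∈ S.D (preim e U) (idealPull sq U s)) (hy : pt r y ∈ preim e V) :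
    stk κ y (S'.coordGerm s (pt κ y) hD' hV t hy') =
      S.coordGerm (idealPull sq U s) y hD ((Opens.map (lrsHom e).base).monotone hV)
        (idealPull sq V t) hy := by
  unfold ResidualSpace.coordGerm
  rw [← hκ.coord U V hV s t, germ_appLE _ _ _ _ (mem_inf_preim hD' hy')]

/-- A residual map acts on points with values in a fat point by restriction of forms. -/
theorem ResidualSpace.Rep.comp {A : Type} [CommRing A] [Algebra ℂ A] [IsFatAlg A] {h : fat A ⟶ R}
    {x : X.obj.left} {φ : Stk X.obj x →ₐ[ℂ] A} {α : IdealForm i φ} (H : S.Rep h α) {κ : R ⟶ R'}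
    (hκ : IsResidualMap S S' sq κ) : S'.Rep (h ≫ κ) (α.pull sq) := by
  have hD : ∀ (U : X'.Open) (s : idealOf i' U), fpt (h ≫ κ) ∈ S'.D U s ↔
      fpt h ∈ S.D (preim e U) (idealPull sq U s) := by
    intro U s
    rw [← hκ.preim_D]
    exact Iff.rfl
  refine ⟨?_, fun U s hx => ?_, fun U s hDs V hV t hx hx' => ?_⟩
  · rw [Category.assoc, hκ.comm, ← Category.assoc, H.comm, fatHom_comp]
  · rw [hD, IdealForm.pull_idealGerm]
    exact H.mem_D _ _ _
  · have hxV : pt r (fpt h) ∈ preim e V := by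
      rw [pt_fpt H.comm]
      exact hx
    rw [IdealForm.pull_idealGerm, IdealForm.pull_idealGerm]
    refine Eq.trans (congrArg (· * _) ?_) (H.coord (preim e U) (idealPull sq U s) ((hD U s).1 hDs)
      (preim e V) ((Opens.map (lrsHom e).base).monotone hV) (idealPull sq V t) hx hxV)
    exact (fev_comp_apply h κ _).trans
      (congrArg (fev h) (hκ.stk_coordGerm hV s t (fpt h) hDs hx' ((hD U s).1 hDs) hxV))

end

section

open ComplexSpace

/-! ### Existence and uniqueness of canonical morphisms -/

variable {W X R W' X' R' : ComplexSpace} {i : W ⟶ X} {r : R ⟶ X} {i' : W' ⟶ X'} {r' : R' ⟶ X'}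
  {e : X ⟶ X'} {w : W ⟶ W'}

namespace ResidualSpace

variable {S : ResidualSpace i r} {S' : ResidualSpace i' r'} {sq : i ≫ e = w ≫ i'}

variable (S) in
theorem exists_form {A : Type} [CommRing A] [Algebra ℂ A] [IsFatAlg A] (g : fat A ⟶ R) :
    ∃ (x : X.obj.left) (φ : Stk X.obj x →ₐ[ℂ] A) (α : IdealForm i φ), S.Rep g α := by
  obtain ⟨x, φ, h⟩ := exists_eq_fatHom (g ≫ r)
  exact ⟨x, φ, S.exists_rep g h⟩

/-- A morphism is a residual map if it acts on the points with values in fat points by restriction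
of forms. -/
theorem isResidualMap_of_fat {κ : R ⟶ R'}
    (H : ∀ (A : Type) [CommRing A] [Algebra ℂ A] [IsFatAlg A] (g : fat A ⟶ R),
      ∃ (x : X.obj.left) (φ : Stk X.obj x →ₐ[ℂ] A) (α : IdealForm i φ),
        S.Rep g α ∧ S'.Rep (g ≫ κ) (α.pull sq)) : IsResidualMap S S' sq κ := by
  have hc : κ ≫ r' = r ≫ e := by
    refine hom_ext_of_fat fun A _ _ _ g => ?_
    obtain ⟨x, φ, α, h, h'⟩ := H A g
    rw [← Category.assoc, h'.comm, ← Category.assoc, h.comm, fatHom_comp]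
  have hpt : ∀ y, pt r' (pt κ y) = pt e (pt r y) := fun y => congrArg (pt · y) hc
  have hD : ∀ (U : X'.Open) (s : idealOf i' U),
      preim κ (S'.D U s) = S.D (preim e U) (idealPull sq U s) := by
    intro U s
    refine Opens.ext (Set.ext fun y => ?_)
    change pt κ y ∈ S'.D U s ↔ y ∈ S.D (preim e U) (idealPull sq U s)
    obtain ⟨x, φ, α, h, h'⟩ := H ℂ (fatHom y (value y))
    have h1 : fpt (fatHom y (value y)) = y := fpt_fatHom _ _
    have h2 : fpt (fatHom y (value y) ≫ κ) = pt κ y := congrArg (pt κ) h1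
    have h3 : pt r y = x := by
      have := pt_fpt h.comm
      rwa [h1] at this
    by_cases hx : pt e x ∈ U
    · have h4 := h'.mem_D U s hx
      rw [IdealForm.pull_idealGerm, ← h.mem_D, h1, h2] at h4
      exact h4
    · refine iff_of_false (fun h5 => hx ?_) (fun h5 => hx ?_)
      · have h6 : pt r' (pt κ y) ∈ U := S'.D_le U s h5
        rwa [hpt, h3] at h6
      · have h6 : pt e (pt r y) ∈ U := S.D_le _ _ h5
        rwa [h3] at h6
  refine ⟨hc, hD, fun U V hV s t => sec_ext fun y hy => stk_ext fun A _ _ _ θ => ?_⟩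
  have hyD : y ∈ S.D (preim e U) (idealPull sq U s) := hy.1
  have hyV : pt e (pt r y) ∈ V := hy.2
  have hyD' : pt κ y ∈ S'.D U s := by
    rw [← hD] at hyD
    exact hyD
  have hyV' : pt r' (pt κ y) ∈ V := hpt y ▸ hyV
  obtain ⟨x, φ, α, h, h'⟩ := H A (fatHom y θ)
  have h1 : fpt (fatHom y θ) = y := fpt_fatHom _ _
  have h2 : fpt (fatHom y θ ≫ κ) = pt κ y := congrArg (pt κ) h1
  have h3 : pt r y = x := by
    have := pt_fpt h.comm
    rwa [h1] at this
  subst h3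
  have h4 := h.coord _ (idealPull sq U s) (h1.symm ▸ hyD) (preim e V)
    ((Opens.map (lrsHom e).base).monotone hV) (idealPull sq V t) hyV (h1.symm ▸ hyV)
  have h5 := h'.coord U s (h2.symm ▸ hyD') V hV t hyV (h2.symm ▸ hyV')
  rw [IdealForm.pull_idealGerm, IdealForm.pull_idealGerm, ← h4] at h5
  have h6 := ((h.mem_D _ _ (mem_preim.2 (hV hyV))).1 (h1.symm ▸ hyD)).mul_right_cancel h5
  have hyO : pt κ y ∈ S'.D U s ⊓ preim r' V := mem_inf_preim hyD' hyV'
  refine (congrArg θ (germ_appLE _ _ _ _ hyO)).trans (Eq.trans ?_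
    (h6.trans (fev_fatHom y θ _ _ hy _)))
  refine Eq.trans ?_ (fev_comp (fatHom y θ) κ _ _ (h2.symm ▸ hyO)).symm
  rw [stk_germ]
  exact (fev_fatHom y θ (preim κ (S'.D U s ⊓ preim r' V)) _ hyO _).symm

theorem isResidualMap_unique {κ₁ κ₂ : R ⟶ R'} (h₁ : IsResidualMap S S' sq κ₁)
    (h₂ : IsResidualMap S S' sq κ₂) : κ₁ = κ₂ := by
  refine hom_ext_of_fat fun A _ _ _ g => ?_
  obtain ⟨x, φ, α, h⟩ := S.exists_form g
  exact (h.comp h₁).hom_ext (h.comp h₂) fun a b => mul_comm _ _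

/-- If the pullback of functions is surjective on the stalks of the ideal sheaves, then the
canonical morphism of residual spaces exists. On `D₊(e^* t)` it is given by the universal property
of `D₊(t)`. -/
theorem exists_isResidualMap (S : ResidualSpace i r) (S' : ResidualSpace i' r')
    (hs : ∀ x, Function.Surjective (idealPullStalk sq x)) : ∃ κ, IsResidualMap S S' sq κ := by
  obtain ⟨κ, hκ⟩ := exists_hom_of_local (X := R) (Z := R') (fun A _ _ _ g g' =>
    ∃ (x : X.obj.left) (φ : Stk X.obj x →ₐ[ℂ] A) (α : IdealForm i φ),
        S.Rep g α ∧ S'.Rep g' (α.pull sq)) (by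
      rintro A _ _ _ g g₁ g₂ ⟨x, φ, α, h, h₁⟩ ⟨y, ψ, β, h', h₂⟩
      have h3 := h.comm.symm.trans h'.comm
      obtain rfl := fatHom_pt_eq h3
      obtain rfl := fatHom_injective h3
      obtain ⟨c, -, rfl⟩ := h.exists_smul_eq h'
      refine h₁.hom_ext h₂ fun a b => ?_
      rw [IdealForm.pull_smul, LinearMap.smul_apply, LinearMap.smul_apply, smul_eq_mul, smul_eq_mul]
      ring) (by
    intro y
    obtain ⟨U', t, hx, hy⟩ : ∃ (U' : X'.Open) (t : idealOf i' U') (_ : pt e (pt r y) ∈ U'),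
        y ∈ S.D (preim e U') (idealPull sq U' t) := by
      obtain ⟨U₀, s₀, hs₀⟩ := S.cover y
      have hx₀ : pt r y ∈ U₀ := S.D_le _ _ hs₀
      obtain ⟨b, hb⟩ := hs _ (idealGerm i (pt r y) hx₀ s₀)
      obtain ⟨U', hx, t, rfl⟩ := exists_idealGerm b
      rw [idealPullStalk_idealGerm] at hb
      refine ⟨U', t, hx, ?_⟩
      have h1 : fpt (fatHom y (value y)) = y := fpt_fatHom _ _
      obtain ⟨α, hα⟩ := S.exists_rep (fatHom y (value y)) (fatHom_comp _ _ _)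
      have h2 := hα.mem_D _ (idealPull sq U' t) (mem_preim.2 hx)
      rw [hb, ← hα.mem_D, h1] at h2
      exact h2.2 hs₀
    let O := S.D (preim e U') (idealPull sq U' t)
    let g := incl R O ≫ r ≫ e
    have hO : ∀ p, pt (incl R O) p ∈ O := pt_incl_mem
    have hle : ∀ V : X'.Open, ⊤ ⊓ preim g V ≤ preim (incl R O) (O ⊓ preim r (preim e V)) :=
      fun V p hp => ⟨hO p, hp.2⟩
    let l : ∀ V : X'.Open, V ≤ U' → idealOf i' V → (openSub R O).Sec (⊤ ⊓ preim g V) :=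
      fun V hV x => appLE (incl R O) _ _ (hle V) ((S.coord _ (idealPull sq U' t)).hom (preim e V)
        ((Opens.map (lrsHom e).base).monotone hV) (symι i (idealPull sq V x)))
    have hl : ∀ V hV x p (hp : p ∈ ⊤ ⊓ preim g V) (hp' : pt r (pt (incl R O) p) ∈ preim e V),
        Stk.germ p hp (l V hV x) = stk (incl R O) p (S.coordGerm (idealPull sq U' t)
          (pt (incl R O) p) (hO p) ((Opens.map (lrsHom e).base).monotone hV) (idealPull sq V x)
            hp') :=
      fun V hV x p hp hp' => germ_appLE _ _ _ _ (mem_inf_preim (hO p) hp')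
    obtain ⟨k, hk, hkD, hkl⟩ := S'.exists_hom t g (fun p => S.D_le _ _ (hO p)) l
      (fun V hV a b => sec_ext fun p hp => by
        have hp' : pt r (pt (incl R O) p) ∈ preim e V := hp.2
        rw [map_add, hl V hV _ _ _ hp', hl V hV _ _ _ hp', hl V hV _ _ _ hp', idealPull_add,
          S.coordGerm_add, map_add])
      (fun V hV f a => sec_ext fun p hp => by
        have hp' : pt r (pt (incl R O) p) ∈ preim e V := hp.2
        have hp'' : pt g p ∈ V := hp.2
        rw [map_mul, hl V hV _ _ _ hp', hl V hV _ _ _ hp', idealPull_smul, S.coordGerm_smul,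
          map_mul, germ_appLE _ _ _ _ hp'']
        refine congrArg (· * _) ?_
        refine Eq.trans ?_ (stk_comp (incl R O) (r ≫ e) p _).symm
        refine congrArg _ (Eq.trans (congrArg _ ?_) (stk_comp r e _ _).symm)
        exact (stk_germ e V f _ hp').symm)
      (fun V V' hV hV' a => sec_ext fun p hp => by
        have hp' : pt r (pt (incl R O) p) ∈ preim e V' := hp.2
        rw [germ_res, hl V' (hV'.trans hV) _ _ _ hp', hl V hV _ _ _ (hV' hp'), idealPull_res,
          S.coordGerm_res _ _ _ ((Opens.map (lrsHom e).base).monotone hV)])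
      (sec_ext fun p hp => by
        rw [hl U' le_rfl _ _ _ (S.D_le _ _ (hO p)), S.coordGerm_self, map_one, map_one])
    refine ⟨O, hy, k, fun A _ _ _ q => ?_⟩
    obtain ⟨x, φ, α, hα⟩ := S.exists_form (q ≫ incl R O)
    have hpx : pt r (pt (incl R O) (fpt q)) = x := pt_fpt hα.comm
    have hqO : fpt (q ≫ incl R O) ∈ O := hO (fpt q)
    have hxU : pt e x ∈ U' := hpx ▸ S.D_le _ _ (hO (fpt q))
    refine ⟨x, φ, α, hα, Rep.of_mem ?_ t hxU (hkD (fpt q)) ?_ fun V hV a hxV hxV' => ?_⟩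
    · rw [Category.assoc, hk, ← fatHom_comp, ← hα.comm]
      simp only [g, Category.assoc]
    · rw [IdealForm.pull_idealGerm]
      exact (hα.mem_D _ _ _).1 hqO
    · rw [IdealForm.pull_idealGerm, IdealForm.pull_idealGerm]
      have hxV'' : pt r (fpt (q ≫ incl R O)) ∈ preim e V := by
        rw [pt_fpt hα.comm]
        exact hxV
      refine Eq.trans (congrArg (· * _) ?_) (hα.coord _ (idealPull sq U' t) hqO (preim e V)
        ((Opens.map (lrsHom e).base).monotone hV) (idealPull sq V a) hxV hxV'')
      refine (fev_comp_apply q k _).trans (Eq.trans (congrArg (fev q) ?_)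
        (fev_comp_apply q (incl R O) _).symm)
      have h7 : fpt q ∈ ⊤ ⊓ preim g V := mem_inf_preim trivial hxV''
      exact (hkl V hV a (fpt q) h7 (hkD _) hxV').symm.trans (hl V hV a (fpt q) h7 hxV''))
  exact ⟨κ, isResidualMap_of_fat hκ⟩

/-- A form that annihilates the kernel of the pullback of functions comes from a form on the ideal
of the subspace. -/
theorem _root_.IteratedMultiplePoints.IdealForm.exists_pull_eq {sq : i ≫ e = w ≫ i'} {A : Type}
    [CommRing A] [Algebra ℂ A] {x : X.obj.left} {φ : Stk X.obj x →ₐ[ℂ] A}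
    (β : IdealForm i' (φ.comp (stk e x))) (he : ComplexSpace.IsClosedEmbedding e)
    (hs : Function.Surjective (idealPullStalk sq x))
    (hker : ∀ b, idealPullStalk sq x b = 0 → β b = 0) : ∃ α : IdealForm i φ, α.pull sq = β := by
  choose σ hσ using hs
  have hβσ : ∀ b, β (σ (idealPullStalk sq x b)) = β b := by
    intro b
    rw [← sub_eq_zero, ← map_sub]
    refine hker _ (Subtype.ext ?_)
    have h3 : stk e x (σ (idealPullStalk sq x b)).1 = stk e x b.1 :=
      congrArg Subtype.val (hσ (idealPullStalk sq x b))
    change stk e x ((σ (idealPullStalk sq x b)).1 - b.1) = 0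
    rw [map_sub, h3, sub_self]
  refine ⟨{ toFun := fun a => β (σ a)
            map_add' := fun a b => ?_
            map_smul' := fun f a => ?_ }, LinearMap.ext hβσ⟩
  · rw [← map_add, ← hβσ (σ a + σ b)]
    refine congrArg (fun c => β (σ c)) (Subtype.ext ?_)
    refine Eq.trans ?_ (map_add (stk e x) (σ a).1 (σ b).1).symm
    exact (congrArg₂ (· + ·) (congrArg Subtype.val (hσ a)) (congrArg Subtype.val (hσ b))).symm
  · obtain ⟨f', rfl⟩ := stk_surjective he x f
    refine Eq.trans ?_ (map_smulₛₗ β f' (σ a))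
    rw [← hβσ (f' • σ a)]
    refine congrArg (fun c => β (σ c)) (Subtype.ext ?_)
    refine Eq.trans ?_ (map_mul (stk e x) f' (σ a).1).symm
    exact (congrArg (stk e x f' * ·) (congrArg Subtype.val (hσ a))).symm

/-- The canonical morphism of residual spaces over a closed embedding is a closed embedding. -/
theorem isClosedEmbedding_of_isResidualMap {κ : R ⟶ R'} (hκ : IsResidualMap S S' sq κ)
    (he : ComplexSpace.IsClosedEmbedding e)
    (hs : ∀ x, Function.Surjective (idealPullStalk sq x)) :
    ComplexSpace.IsClosedEmbedding κ := by
  refine isClosedEmbedding_of_fat (fun A _ _ _ g₁ g₂ h => ?_) fun A _ _ _ g hg => ?_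
  · have h1 : g₁ ≫ r = g₂ ≫ r := by
      refine fatMono_of_isClosedEmbedding he A _ _ ?_
      rw [Category.assoc, ← hκ.comm, Category.assoc, ← hκ.comm, ← Category.assoc, h,
        Category.assoc]
    obtain ⟨x, φ, α, hα⟩ := S.exists_form g₁
    obtain ⟨β, hβ⟩ := S.exists_rep g₂ (h1.symm.trans hα.comm)
    have hβ' := hβ.comp hκ
    rw [← h] at hβ'
    obtain ⟨c, -, hc⟩ := (hα.comp hκ).exists_smul_eq hβ'
    refine hα.hom_ext hβ fun a b => ?_
    have h2 : ∀ a, β a = c * α a := by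
      intro a
      obtain ⟨a, rfl⟩ := hs x a
      exact LinearMap.congr_fun hc a
    rw [h2, h2]
    ring
  · -- the image in `X'` annihilates the functions vanishing on `X`
    have h1 : Kills (g ≫ r') e := by
      intro U s h0 hU
      refine (fev_comp g r' U s hU).trans (hg (preim r' U) (app r' U s) ?_ hU)
      have h2 : ∀ k : R ⟶ X', k = r ≫ e → app k U s = 0 := by
        rintro _ rfl
        change app r (preim e U) (app e U s) = 0
        rw [h0, map_zero]
      exact h2 _ hκ.comm
    obtain ⟨g₀, hg₀⟩ := fatLift_of_isClosedEmbedding he A _ h1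
    obtain ⟨x, φ, rfl⟩ := exists_eq_fatHom g₀
    rw [fatHom_comp] at hg₀
    obtain ⟨β, hβ⟩ := S'.exists_rep g hg₀.symm
    obtain ⟨U, hxU, s, hsD⟩ := S'.exists_mem_D g hβ.comm
    have hker : ∀ b, idealPullStalk sq x b = 0 → β b = 0 := by
      intro b hb
      obtain ⟨U₁, hxU₁, t, rfl⟩ := exists_idealGerm b
      obtain ⟨V, hxV, hVU, h2⟩ := exists_app_res_eq_zero he x hxU₁ (congrArg Subtype.val hb)
      have hx : pt e x ∈ V ⊓ U := Opens.mem_inf.2 ⟨hxV, hxU⟩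
      have hx' : pt r' (fpt g) ∈ V ⊓ U := by
        rw [pt_fpt hβ.comm]
        exact hx
      let t' := idealRes i' (inf_le_left : V ⊓ U ≤ V) (idealRes i' hVU t)
      have ht' : idealPull sq (V ⊓ U) t' = 0 := by
        have h3 : idealPull sq V (idealRes i' hVU t) = 0 := Subtype.ext h2
        refine (idealPull_res sq _ _).trans ?_
        rw [h3]
        exact Subtype.ext (map_zero (X.res _))
      have h4 := hβ.coord U s hsD (V ⊓ U) inf_le_right t' hx hx'
      have h5 : idealGerm i' (pt e x) hx t' = idealGerm i' (pt e x) hxU₁ t :=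
        (idealGerm_res _ _ _ _).trans (idealGerm_res _ _ _ _)
      have h6 : fev g (S'.coordGerm s (fpt g) hsD inf_le_right t' hx') = 0 := by
        refine hg (S'.D U s ⊓ preim r' (V ⊓ U)) _ (sec_ext fun y hy => ?_) (mem_inf_preim hsD hx')
        have hy₁ : pt κ y ∈ S'.D U s := hy.1
        have hy₂ : pt r' (pt κ y) ∈ V ⊓ U := hy.2
        have hy₃ : y ∈ S.D (preim e U) (idealPull sq U s) := by
          rw [← hκ.preim_D]
          exact hy₁
        have hy₄ : pt e (pt r y) ∈ V ⊓ U := by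
          have h7 : pt r' (pt κ y) = pt e (pt r y) := congrArg (pt · y) hκ.comm
          exact h7 ▸ hy₂
        refine (stk_germ κ _ _ y hy).symm.trans
          ((hκ.stk_coordGerm inf_le_right s t' y hy₁ hy₂ hy₃ hy₄).trans ?_)
        rw [ht', map_zero]
        unfold coordGerm symι
        rw [map_zero, map_zero, map_zero]
      rw [h6, zero_mul, h5] at h4
      exact h4.symm
    -- hence the form factors through the ideal of the subspace
    obtain ⟨α, hα⟩ := β.exists_pull_eq he (hs x) hker
    obtain ⟨h, hh⟩ := S.exists_hom_of_form α
      (a := idealPullStalk sq x (idealGerm i' (pt e x) hxU s)) (by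
        rw [← IdealForm.pull_apply, hα]
        exact (hβ.mem_D U s hxU).1 hsD)
    have hh' := hh.comp hκ
    rw [hα] at hh'
    exact ⟨h, hh'.hom_ext hβ fun a b => mul_comm _ _⟩

end ResidualSpace

end

section

open ComplexSpace

variable {X Y Z W X' W' : ComplexSpace}

/-! ### The ideal of a retract -/

theorem germ_app_congr {g h : X ⟶ Y} (H : g = h) {U : Y.Open} (s : Y.Sec U) (x : X.obj.left)
    (hg : x ∈ preim g U) (hh : x ∈ preim h U) :
    Stk.germ x hg (app g U s) = Stk.germ x hh (app h U s) := by
  subst H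
  rfl

theorem app_eq_zero_congr {g h : X ⟶ Y} (H : g = h) {U : Y.Open} {s : Y.Sec U}
    (hs : app g U s = 0) : app h U s = 0 := by
  subst H
  exact hs

/-- The action of an endomorphism on the stalk at a fixed point. -/
def fixStk (d : X ⟶ X) (x : X.obj.left) (hx : pt d x = x) : Stk X.obj x →+* Stk X.obj x :=
  ((stk d x : Stk X.obj (pt d x) →+* Stk X.obj x)).comp
    (hx.symm.rec (motive := fun y _ => Stk X.obj x →+* Stk X.obj y) (RingHom.id _))

theorem fixStk_germ (d : X ⟶ X) (x : X.obj.left) (hx : pt d x = x) {U : X.Open} (s : X.Sec U)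
    (hU : x ∈ U) (hU' : x ∈ preim d U) :
    fixStk d x hx (Stk.germ x hU s) = Stk.germ x hU' (app d U s) := by
  have h : ∀ (y : X.obj.left) (hy : x = y) (hyU : y ∈ U),
      hy.rec (motive := fun y _ => Stk X.obj x →+* Stk X.obj y) (RingHom.id _) (Stk.germ x hU s) =
        Stk.germ y hyU s := by
    rintro _ rfl _
    rfl
  exact (congrArg (stk d x) (h _ hx.symm hU')).trans (stk_germ d U s x hU')

theorem stk_fixStk {e : X ⟶ X'} {d : X ⟶ X} {d' : X' ⟶ X'} (h : e ≫ d' = d ≫ e) (x : X.obj.left)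
    (hx : pt d x = x) (hx' : pt d' (pt e x) = pt e x) (a : Stk X'.obj (pt e x)) :
    stk e x (fixStk d' (pt e x) hx' a) = fixStk d x hx (stk e x a) := by
  obtain ⟨U, hU, s, rfl⟩ := exists_germ _ a
  have h1 : pt e x ∈ preim d' U := by
    rw [mem_preim, hx']
    exact hU
  have h2 : x ∈ preim d (preim e U) := by
    rw [mem_preim, hx]
    exact hU
  rw [fixStk_germ d' _ hx' s hU h1, stk_germ, stk_germ]
  refine Eq.trans ?_ (fixStk_germ d x hx (U := preim e U) (app e U s) hU h2).symm
  exact germ_app_congr h s x h1 h2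

theorem fixStk_mem_stalkIdeal {e : X ⟶ X'} {d : X ⟶ X} {d' : X' ⟶ X'} (h : e ≫ d' = d ≫ e)
    (y : X'.obj.left) (hy : pt d' y = y) {a : Stk X'.obj y} (ha : a ∈ stalkIdeal e y) :
    fixStk d' y hy a ∈ stalkIdeal e y := by
  obtain ⟨U, hU, s, hs, rfl⟩ := ha
  have h1 : y ∈ preim d' U := by
    rw [mem_preim, hy]
    exact hU
  rw [fixStk_germ d' y hy s hU h1]
  refine germ_mem_stalkIdeal h1 (app_eq_zero_congr h.symm ?_)
  change app d (preim e U) (app e U s) = 0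
  rw [hs, map_zero]

variable {i : W ⟶ X} {p : X ⟶ W}

theorem sub_fixStk_mem (hp : i ≫ p = 𝟙 W) (x : X.obj.left) (hx : pt (p ≫ i) x = x)
    (a : Stk X.obj x) : a - fixStk (p ≫ i) x hx a ∈ stalkIdeal i x := by
  obtain ⟨U, hU, s, rfl⟩ := exists_germ _ a
  have h1 : x ∈ preim (p ≫ i) U := by
    rw [mem_preim, hx]
    exact hU
  rw [fixStk_germ _ x hx s hU h1]
  refine ⟨U ⊓ preim (p ≫ i) U, Opens.mem_inf.2 ⟨hU, h1⟩, X.res inf_le_left s -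
    X.res inf_le_right (app (p ≫ i) U s), ?_, by rw [map_sub, germ_res, germ_res]⟩
  rw [map_sub, app_res, app_res, sub_eq_zero]
  refine sec_ext fun w hw => ?_
  rw [germ_res, germ_res]
  refine germ_app_congr (g := i) (h := i ≫ p ≫ i) ?_ s w hw.1 hw.2
  rw [← Category.assoc, hp, Category.id_comp]

theorem fixStk_eq_zero (x : X.obj.left) (hx : pt (p ≫ i) x = x) {a : Stk X.obj x}
    (ha : a ∈ stalkIdeal i x) : fixStk (p ≫ i) x hx a = 0 := by
  obtain ⟨U, hU, s, hs, rfl⟩ := ha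
  have h1 : x ∈ preim (p ≫ i) U := by
    rw [mem_preim, hx]
    exact hU
  rw [fixStk_germ _ x hx s hU h1]
  have h2 : app (p ≫ i) U s = 0 := by
    change app p (preim i U) (app i U s) = 0
    rw [hs, map_zero]
  rw [h2, map_zero]

theorem pt_comp_eq_iff (hp : i ≫ p = 𝟙 W) (w : W.obj.left) : pt (p ≫ i) (pt i w) = pt i w := by
  have h : i ≫ p ≫ i = i := by rw [← Category.assoc, hp, Category.id_comp]
  exact congrArg (pt · w) h

/-- Away from a retract, the ideal is the unit ideal: the points of the retract are the fixed points
of the retraction, and form a closed set. -/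
theorem stalkIdeal_eq_top (hp : i ≫ p = 𝟙 W) {x : X.obj.left} (hx : pt (p ≫ i) x ≠ x) :
    stalkIdeal i x = ⊤ := by
  have : T2Space X.obj.left := X.property.1
  have h1 : IsClosed {x | pt (p ≫ i) x = x} := isClosed_eq (continuous_pt (p ≫ i)) continuous_id
  let U : X.Open := ⟨{x | pt (p ≫ i) x = x}ᶜ, h1.isOpen_compl⟩
  refine (Ideal.eq_top_iff_one _).2 ⟨U, hx, 1, sec_ext fun w hw => ?_, map_one _⟩
  exact absurd (pt_comp_eq_iff hp w) hw

/-- The projection `a ↦ a - p^* i^* a` of the stalk of the structure sheaf onto the ideal of a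
retract; it preserves the ideals of the subspaces that are compatible with the retraction. Away from
the retract the ideal is the unit ideal, and the identity is used. -/
theorem exists_projection (hp : i ≫ p = 𝟙 W) (x : X.obj.left) :
    ∃ π : Stk X.obj x →+ Stk X.obj x, (∀ a, π a ∈ stalkIdeal i x) ∧
      (∀ a ∈ stalkIdeal i x, π a = a) ∧
      ∀ (Z : ComplexSpace) (e : Z ⟶ X) (d : Z ⟶ Z), e ≫ p ≫ i = d ≫ e →
        ∀ a ∈ stalkIdeal e x, π a ∈ stalkIdeal e x := by
  by_cases hx : pt (p ≫ i) x = x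
  · refine ⟨AddMonoidHom.id _ - (fixStk (p ≫ i) x hx).toAddMonoidHom, sub_fixStk_mem hp x hx,
      fun a ha => ?_, fun Z e d h a ha => ?_⟩
    · exact (congrArg (a - ·) (fixStk_eq_zero x hx ha)).trans (sub_zero a)
    · exact sub_mem ha (fixStk_mem_stalkIdeal h x hx ha)
  · refine ⟨AddMonoidHom.id _, fun a => ?_, fun a _ => rfl, fun _ _ _ _ a ha => ha⟩
    rw [stalkIdeal_eq_top hp hx]
    trivial

/-- The pullback of functions between the ideals of retracts is surjective over closed
embeddings: a lift of a function `a` that vanishes on the retract `W` is corrected to a function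
that vanishes on `W'` by subtracting `p'^* i'^*` of it, which vanishes on `X`. -/
theorem idealPullStalk_surjective {i' : W' ⟶ X'} {p' : X' ⟶ W'} {e : X ⟶ X'} {w : W ⟶ W'}
    (sq : i ≫ e = w ≫ i') (he : ComplexSpace.IsClosedEmbedding e) (hp' : i' ≫ p' = 𝟙 W')
    (hpe : e ≫ p' = p ≫ w) (x : X.obj.left) : Function.Surjective (idealPullStalk sq x) := by
  intro a
  obtain ⟨b, hb⟩ := stk_surjective he x a.1
  have hd : e ≫ p' ≫ i' = (p ≫ i) ≫ e := by
    rw [← Category.assoc, hpe, Category.assoc, Category.assoc, sq]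
  by_cases hx' : pt (p' ≫ i') (pt e x) = pt e x
  · have hx : pt (p ≫ i) x = x := by
      refine (pt_isClosedEmbedding he).injective (Eq.trans ?_ hx')
      exact (congrArg (pt · x) hd).symm
    refine ⟨⟨_, sub_fixStk_mem hp' _ hx' b⟩, Subtype.ext ?_⟩
    change stk e x (b - _) = a.1
    rw [map_sub, stk_fixStk hd x hx hx', hb, fixStk_eq_zero x hx a.2, sub_zero]
  · exact ⟨⟨b, by rw [stalkIdeal_eq_top hp' hx']; trivial⟩, Subtype.ext hb⟩

/-! ### Fibred products and closed embeddings -/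

/-- Functions on a closed subspace locally extend to the ambient space. -/
theorem exists_app_eq_res {h : X ⟶ Y} (H : ComplexSpace.IsClosedEmbedding h) (x : X.obj.left)
    {V : X.Open} (hx : x ∈ V) (s : X.Sec V) : ∃ (O : Y.Open) (_ : pt h x ∈ O)
      (hO : preim h O ≤ V) (σ : Y.Sec O), app h O σ = X.res hO s := by
  obtain ⟨b, hb⟩ := stk_surjective H x (Stk.germ x hx s)
  obtain ⟨O, hO, σ, rfl⟩ := exists_germ _ b
  rw [stk_germ] at hb
  obtain ⟨U, hxU, hUO, hUV, hU⟩ := exists_res_eq_of_germ_eq (X := X) (U := preim h O) _ _ hb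
  obtain ⟨t, ht, hUt⟩ := (pt_isClosedEmbedding H).isInducing.isOpen_iff.1 U.isOpen
  have hsub : ∀ x', x' ∈ preim h (⟨t, ht⟩ ⊓ O) → x' ∈ U := by
    intro x' hx'
    have h1 : x' ∈ pt h ⁻¹' t := hx'.1
    rw [hUt] at h1
    exact h1
  refine ⟨⟨t, ht⟩ ⊓ O, ⟨?_, hO⟩, fun x' hx' => hUV (hsub x' hx'), Y.res inf_le_right σ,
    sec_ext fun x' hx' => ?_⟩
  · have : x ∈ pt h ⁻¹' t := hUt ▸ hxU
    exact this
  · have h2 := congrArg (Stk.germ (Z := X.obj) x' (hsub x' hx')) hU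
    rw [germ_res, germ_res] at h2
    rw [app_res, germ_res, germ_res]
    exact h2

theorem Kills.comp {A : Type} [CommRing A] [Algebra ℂ A] [IsFatAlg A] {E : X ⟶ X'} {g : fat A ⟶ X'}
    (hg : Kills g E) {p : X ⟶ Y} {p' : X' ⟶ Z} {a : Y ⟶ Z} (h : E ≫ p' = p ≫ a) :
    Kills (g ≫ p') a := by
  intro U s hs hU
  refine (fev_comp g p' U s hU).trans (hg (preim p' U) (app p' U s) ?_ hU)
  refine app_eq_zero_congr (g := p ≫ a) h.symm ?_
  change app p (preim a U) (app a U s) = 0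
  rw [hs, map_zero]

end

section

open ComplexSpace

variable {K L P K' L' P' : ComplexSpace} {π : K ⟶ L} {p₁ p₂ : P ⟶ K} {π' : K' ⟶ L'}
  {p₁' p₂' : P' ⟶ K'} {a : K ⟶ K'} {E : P ⟶ P'}

/-- A point of `P' = K' ×_{L'} K'` with values in a fat point that annihilates the functions
vanishing on `P = K ×_L K` has components in `K` that agree over `L`, although `L ⟶ L'` need not be
a closed embedding: for a function `s` on `L`, local extensions `σ` of `π^* s` from `K` to `K'` give
a function `p₁'^* σ₁ - p₂'^* σ₂` on `P'` that vanishes on `P`. -/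
theorem Kills.comp_eq_comp (hP : p₁ ≫ π = p₂ ≫ π) (ha : ComplexSpace.IsClosedEmbedding a)
    (h₁ : E ≫ p₁' = p₁ ≫ a) (h₂ : E ≫ p₂' = p₂ ≫ a) {A : Type} [CommRing A] [Algebra ℂ A]
    [IsFatAlg A] {g : fat A ⟶ P'} (hg : Kills g E) {x₁ x₂ : fat A ⟶ K} (hx₁ : x₁ ≫ a = g ≫ p₁')
    (hx₂ : x₂ ≫ a = g ≫ p₂') : x₁ ≫ π = x₂ ≫ π := by
  have : T2Space L.obj.left := L.property.1
  have hpt₁ : pt a (fpt x₁) = pt p₁' (fpt g) := congrArg fpt hx₁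
  have hpt₂ : pt a (fpt x₂) = pt p₂' (fpt g) := congrArg fpt hx₂
  have hb₁ : ∀ y, pt p₁' (pt E y) = pt a (pt p₁ y) := fun y => congrArg (pt · y) h₁
  have hb₂ : ∀ y, pt p₂' (pt E y) = pt a (pt p₂ y) := fun y => congrArg (pt · y) h₂
  refine fat_hom_ext ?_ fun V s hV₁ hV₂ => ?_
  · -- points of `L` that differ have disjoint neighbourhoods, and then `1` vanishes on `K ×_L K`
    by_contra hne
    obtain ⟨V₁, V₂, hV₁, hV₂, hm₁, hm₂, hd⟩ := t2_separation hne
    obtain ⟨O₁, hO₁, hO₁V, -⟩ := exists_app_eq_res ha (fpt x₁) (V := preim π ⟨V₁, hV₁⟩) hm₁ 0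
    obtain ⟨O₂, hO₂, hO₂V, -⟩ := exists_app_eq_res ha (fpt x₂) (V := preim π ⟨V₂, hV₂⟩) hm₂ 0
    have h3 := hg (preim p₁' O₁ ⊓ preim p₂' O₂) 1 (sec_ext fun y hy => by
      have hy₁ : pt p₁ y ∈ preim a O₁ := by
        rw [mem_preim, ← hb₁]
        exact hy.1
      have hy₂ : pt p₂ y ∈ preim a O₂ := by
        rw [mem_preim, ← hb₂]
        exact hy.2
      have h4 : pt π (pt p₁ y) ∈ V₁ := hO₁V hy₁
      have h5 : pt π (pt p₁ y) ∈ V₂ := by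
        have h6 : pt π (pt p₁ y) = pt π (pt p₂ y) := congrArg (pt · y) hP
        rw [h6]
        exact hO₂V hy₂
      exact absurd h5 (Set.disjoint_left.1 hd h4))
        ⟨mem_preim.2 (hpt₁ ▸ hO₁), mem_preim.2 (hpt₂ ▸ hO₂)⟩
    rw [map_one, map_one] at h3
    exact one_ne_zero h3
  · -- the germ of `p^* π^* s` extends to `P'`, with the value of `s` at the fat point `x ≫ π`
    have key : ∀ (x : fat A ⟶ K) (p : P ⟶ K) (p' : P' ⟶ K') (hx : x ≫ a = g ≫ p')
        (h : E ≫ p' = p ≫ a) (hV : fpt (x ≫ π) ∈ V), ∃ (O : P'.Open) (hO : fpt g ∈ O)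
        (τ : P'.Sec O), fev g (Stk.germ _ hO τ) = fev (x ≫ π) (Stk.germ _ hV s) ∧
          ∀ (y : P.obj.left) (hy : y ∈ preim E O), ∃ hy' : y ∈ preim (p ≫ π) V,
            Stk.germ y hy (app E O τ) = Stk.germ y hy' (app (p ≫ π) V s) := by
      intro x p p' hx h hV
      obtain ⟨O, hO, hOV, σ, hσ⟩ := exists_app_eq_res ha (fpt x) (V := preim π V) hV (app π V s)
      have hpt : pt a (fpt x) = pt p' (fpt g) := congrArg fpt hx
      have hgO : pt p' (fpt g) ∈ O := hpt ▸ hO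
      refine ⟨preim p' O, hgO, app p' O σ, ?_, fun y hy => ?_⟩
      · refine (fev_comp g p' O σ hgO).symm.trans ((fev_congr hx.symm σ hgO hO).trans ?_)
        refine (fev_comp x a O σ hO).trans (Eq.trans ?_ (fev_comp x π V s hV).symm)
        rw [hσ]
        exact congrArg (fev x) (germ_res hOV (app π V s) (fpt x) hO)
      · have hya : y ∈ preim (p ≫ a) O := by
          rw [← h]
          exact hy
        have hya' : pt p y ∈ preim a O := hya
        refine ⟨hOV hya', (germ_app_congr (g := E ≫ p') h σ y hy hya).trans ?_⟩
        refine (stk_germ p (preim a O) (app a O σ) y hya').symm.trans ?_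
        rw [hσ, germ_res]
        exact stk_germ p (preim π V) (app π V s) y (hOV hya')
    obtain ⟨O₁, hO₁, τ₁, hτ₁, hτ₁'⟩ := key x₁ p₁ p₁' hx₁ h₁ hV₁
    obtain ⟨O₂, hO₂, τ₂, hτ₂, hτ₂'⟩ := key x₂ p₂ p₂' hx₂ h₂ hV₂
    have h3 := hg (O₁ ⊓ O₂) (P'.res inf_le_left τ₁ - P'.res inf_le_right τ₂) (by
      rw [map_sub, app_res, app_res, sub_eq_zero]
      refine sec_ext fun y hy => ?_
      obtain ⟨hy₁, h4⟩ := hτ₁' y hy.1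
      obtain ⟨hy₂, h5⟩ := hτ₂' y hy.2
      rw [germ_res, germ_res]
      exact h4.trans ((germ_app_congr hP s y hy₁ hy₂).trans h5.symm)) (Opens.mem_inf.2 ⟨hO₁, hO₂⟩)
    rw [map_sub, map_sub, germ_res, germ_res, sub_eq_zero] at h3
    exact hτ₁.symm.trans (h3.trans hτ₂)

/-- The morphism between fibred products that is induced by a closed embedding of the factors is a
closed embedding. -/
theorem isClosedEmbedding_of_isPullback (hP : IsPullback p₁ p₂ π π) (hP' : IsPullback p₁' p₂' π' π')
    (ha : ComplexSpace.IsClosedEmbedding a) (h₁ : E ≫ p₁' = p₁ ≫ a) (h₂ : E ≫ p₂' = p₂ ≫ a) :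
    ComplexSpace.IsClosedEmbedding E := by
  have hm := fatMono_of_isClosedEmbedding ha
  have hl := fatLift_of_isClosedEmbedding ha
  refine isClosedEmbedding_of_fat (fun A _ _ _ g₁ g₂ h => ?_) fun A _ _ _ g hg => ?_
  · refine hP.hom_ext (hm A _ _ ?_) (hm A _ _ ?_)
    · rw [Category.assoc, ← h₁, Category.assoc, ← h₁, ← Category.assoc, h, Category.assoc]
    · rw [Category.assoc, ← h₂, Category.assoc, ← h₂, ← Category.assoc, h, Category.assoc]
  · obtain ⟨x₁, hx₁⟩ := hl A _ (hg.comp h₁)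
    obtain ⟨x₂, hx₂⟩ := hl A _ (hg.comp h₂)
    have hx := hg.comp_eq_comp hP.w ha h₁ h₂ hx₁ hx₂
    refine ⟨hP.lift x₁ x₂ hx, hP'.hom_ext ?_ ?_⟩
    · rw [Category.assoc, h₁, ← Category.assoc, hP.lift_fst, hx₁]
    · rw [Category.assoc, h₂, ← Category.assoc, hP.lift_snd, hx₂]

/-! ### Canonical morphisms of iterated multiple point spaces -/

namespace MultiplePoints

variable {X Y X' Y' : ComplexSpace} {f : X ⟶ Y} {f' : X' ⟶ Y'} (M : MultiplePoints f)
  (M' : MultiplePoints f')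

theorem diag_p₁ (r : ℕ) : M.diag r ≫ M.p₁ r = 𝟙 _ := (M.isPullback r).lift_fst _ _ _

/-- The morphism between the fibred products at one stage, for arbitrary compatible morphisms at the
two preceding stages. -/
def fibLift {r : ℕ} (κ : M.K r ⟶ M'.K r) (κ' : M.K (r + 1) ⟶ M'.K (r + 1))
    (h : κ' ≫ M'.π r = M.π r ≫ κ) : M.fib r ⟶ M'.fib r :=
  (M'.isPullback r).lift (M.p₁ r ≫ κ') (M.p₂ r ≫ κ') (by
    rw [Category.assoc, Category.assoc, h]
    exact (M.isPullback r).w_assoc _)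

variable {M M'} {r : ℕ} {κ : M.K r ⟶ M'.K r} {κ' : M.K (r + 1) ⟶ M'.K (r + 1)}
  (h : κ' ≫ M'.π r = M.π r ≫ κ)

theorem fibLift_p₁ : fibLift M M' κ κ' h ≫ M'.p₁ r = M.p₁ r ≫ κ' :=
  (M'.isPullback r).lift_fst _ _ _

theorem fibLift_p₂ : fibLift M M' κ κ' h ≫ M'.p₂ r = M.p₂ r ≫ κ' :=
  (M'.isPullback r).lift_snd _ _ _

theorem diag_fibLift : M.diag r ≫ fibLift M M' κ κ' h = κ' ≫ M'.diag r := by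
  apply (M'.isPullback r).hom_ext
  · simp [diag, fibLift]
  · simp [diag, fibLift]

theorem isClosedEmbedding_fibLift (hκ' : ComplexSpace.IsClosedEmbedding κ') :
    ComplexSpace.IsClosedEmbedding (fibLift M M' κ κ' h) :=
  isClosedEmbedding_of_isPullback (M.isPullback r) (M'.isPullback r) hκ' (fibLift_p₁ h)
    (fibLift_p₂ h)

theorem idealPullStalk_fibLift_surjective (hκ' : ComplexSpace.IsClosedEmbedding κ')
    (x : (M.fib r).obj.left) : Function.Surjective (idealPullStalk (diag_fibLift h) x) :=
  idealPullStalk_surjective _ (isClosedEmbedding_fibLift h hκ') (M'.diag_p₁ r) (fibLift_p₁ h) x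

theorem exists_next (hκ' : ComplexSpace.IsClosedEmbedding κ') :
    ∃ κ'' : M.K (r + 2) ⟶ M'.K (r + 2),
      IsResidualMap (M.residual r) (M'.residual r) (diag_fibLift h) κ'' :=
  ResidualSpace.exists_isResidualMap _ _ (idealPullStalk_fibLift_surjective h hκ')

variable {h} in
theorem isClosedEmbedding_next (hκ' : ComplexSpace.IsClosedEmbedding κ')
    {κ'' : M.K (r + 2) ⟶ M'.K (r + 2)}
    (H : IsResidualMap (M.residual r) (M'.residual r) (diag_fibLift h) κ'') :
    ComplexSpace.IsClosedEmbedding κ'' :=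
  ResidualSpace.isClosedEmbedding_of_isResidualMap H (isClosedEmbedding_fibLift h hκ')
    (idealPullStalk_fibLift_surjective h hκ')

variable {h} in
theorem comm_next {κ'' : M.K (r + 2) ⟶ M'.K (r + 2)}
    (H : IsResidualMap (M.residual r) (M'.residual r) (diag_fibLift h) κ'') :
    κ'' ≫ M'.π (r + 1) = M.π (r + 1) ≫ κ' := by
  refine (congrArg (κ'' ≫ ·) (M'.π_succ r)).trans ((Category.assoc κ'' (M'.q r) _).symm.trans ?_)
  refine (congrArg (· ≫ M'.p₁ r) H.comm).trans ((Category.assoc _ _ _).trans ?_)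
  refine (congrArg (M.q r ≫ ·) (fibLift_p₁ h)).trans ((Category.assoc _ _ _).symm.trans ?_)
  exact congrArg (· ≫ κ') (M.π_succ r).symm

namespace IsCanonical

variable {e : X ⟶ X'} {g : Y ⟶ Y'} {k : ∀ r, M.K r ⟶ M'.K r}

theorem isClosedEmbedding (H : M.IsCanonical M' e g k) (he : ComplexSpace.IsClosedEmbedding e)
    (r : ℕ) : ComplexSpace.IsClosedEmbedding (k (r + 1)) := by
  induction r with
  | zero =>
    have h := H.one
    change ComplexSpace.IsClosedEmbedding (k 1)
    exact h ▸ he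
  | succ r ih => exact isClosedEmbedding_next (h := H.comm r) ih (H.residual r)

theorem unique {l : ∀ r, M.K r ⟶ M'.K r} (H : M.IsCanonical M' e g k)
    (H' : M.IsCanonical M' e g l) : k = l := by
  have key : ∀ r, k r = l r ∧ k (r + 1) = l (r + 1) := by
    intro r
    induction r with
    | zero => exact ⟨H.zero.trans H'.zero.symm, H.one.trans H'.one.symm⟩
    | succ r ih =>
      refine ⟨ih.2, ?_⟩
      have aux : ∀ (a a' : M.K r ⟶ M'.K r) (b b' : M.K (r + 1) ⟶ M'.K (r + 1))
          (h : b ≫ M'.π r = M.π r ≫ a) (h' : b' ≫ M'.π r = M.π r ≫ a')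
          (c c' : M.K (r + 2) ⟶ M'.K (r + 2)), a = a' → b = b' →
          IsResidualMap (M.residual r) (M'.residual r) (diag_fibLift h) c →
          IsResidualMap (M.residual r) (M'.residual r) (diag_fibLift h') c' → c = c' := by
        rintro a _ b _ h h' c c' rfl rfl h₁ h₂
        exact ResidualSpace.isResidualMap_unique h₁ h₂
      exact aux _ _ _ _ (H.comm r) (H'.comm r) _ _ ih.1 ih.2 (H.residual r) (H'.residual r)
  exact funext fun r => (key r).1

end IsCanonical

variable (M M')

/-- A commutative square with a closed embedding `X ⟶ X'` induces canonical morphisms. -/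
theorem exists_isCanonical (e : X ⟶ X') (g : Y ⟶ Y') (he : ComplexSpace.IsClosedEmbedding e)
    (sq : f ≫ g = e ≫ f') : ∃ k, M.IsCanonical M' e g k := by
  -- pairs of consecutive morphisms, constructed by recursion
  let St : ℕ → Type := fun r => { p : (M.K r ⟶ M'.K r) × (M.K (r + 1) ⟶ M'.K (r + 1)) //
    p.2 ≫ M'.π r = M.π r ≫ p.1 ∧ ComplexSpace.IsClosedEmbedding p.2 }
  let next : ∀ r, St r → St (r + 1) := fun r p =>
    ⟨(p.1.2, (exists_next p.2.1 p.2.2).choose),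
      comm_next (exists_next p.2.1 p.2.2).choose_spec,
      isClosedEmbedding_next p.2.2 (exists_next p.2.1 p.2.2).choose_spec⟩
  let s₀ : St 0 := ⟨(g, e), by
    rw [M.π_zero, M'.π_zero]
    exact sq.symm, he⟩
  let st : ∀ r, St r := fun r => Nat.rec s₀ next r
  exact ⟨fun r => (st r).1.1, rfl, rfl, fun r => (st r).2.1,
    fun r => (exists_next (st r).2.1 (st r).2.2).choose_spec⟩

end MultiplePoints

end

section

open ComplexSpace

/-! ### Squares of residual spaces -/

namespace ResidualSpace

section

variable {W X R : ComplexSpace} {i : W ⟶ X} {r : R ⟶ X} {S : ResidualSpace i r} {A : Type}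
  [CommRing A] [Algebra ℂ A] [IsFatAlg A] {x y : X.obj.left} {φ : Stk X.obj x →ₐ[ℂ] A}
  {ψ : Stk X.obj y →ₐ[ℂ] A} {α : IdealForm i φ} {β : IdealForm i ψ}

theorem Rep.hom_ext_of_sections {h h' : fat A ⟶ R} (H : S.Rep h α) (H' : S.Rep h' β)
    (hr : h ≫ r = h' ≫ r) (hαβ : ∀ (U : X.Open) (s : idealOf i U) (hx : x ∈ U) (hy : y ∈ U),
      α (idealGerm i x hx s) = β (idealGerm i y hy s)) : h = h' := by
  have h3 := (H.comm.symm.trans hr).trans H'.comm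
  obtain rfl := fatHom_pt_eq h3
  obtain rfl := fatHom_injective h3
  obtain rfl : α = β := LinearMap.ext fun a => by
    obtain ⟨U, hx, s, rfl⟩ := exists_idealGerm a
    exact hαβ U s hx hx
  exact H.hom_ext H' fun a b => mul_comm _ _

theorem Rep.exists_mul_eq_of_sections {h : fat A ⟶ R} (H : S.Rep h α) (H' : S.Rep h β) :
    ∃ c : A, IsUnit c ∧ ∀ (U : X.Open) (s : idealOf i U) (hx : x ∈ U) (hy : y ∈ U),
      β (idealGerm i y hy s) = c * α (idealGerm i x hx s) := by
  have h3 := H.comm.symm.trans H'.comm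
  obtain rfl := fatHom_pt_eq h3
  obtain rfl := fatHom_injective h3
  obtain ⟨c, hc, rfl⟩ := H.exists_smul_eq H'
  exact ⟨c, hc, fun U s hx hy => rfl⟩

end

theorem exists_idealGerm_app_eq_zero {W X Z : ComplexSpace} {i : W ⟶ X} {e : Z ⟶ X}
    {x : X.obj.left} (a : stalkIdeal i x) (ha : a.1 ∈ stalkIdeal e x) :
    ∃ (U : X.Open) (hx : x ∈ U) (s : idealOf i U), app e U s.1 = 0 ∧ idealGerm i x hx s = a := by
  obtain ⟨U, hU, s, rfl⟩ := exists_idealGerm a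
  obtain ⟨V, hV, t, ht, hst⟩ := ha
  obtain ⟨O, hO, hOV, hOU, h⟩ := exists_res_eq_of_germ_eq (X := X) hV hU hst
  refine ⟨O, hO, idealRes i hOU s, ?_, idealGerm_res _ _ _ _⟩
  change app e O (X.res hOU s.1) = 0
  rw [← h, app_res, ht, map_zero]

variable {W X R W₁ X₁ R₁ W₂ X₂ R₂ W₃ X₃ R₃ : ComplexSpace} {i : W ⟶ X} {r : R ⟶ X} {i₁ : W₁ ⟶ X₁}
  {r₁ : R₁ ⟶ X₁} {i₂ : W₂ ⟶ X₂} {r₂ : R₂ ⟶ X₂} {i₃ : W₃ ⟶ X₃} {r₃ : R₃ ⟶ X₃}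
  {S : ResidualSpace i r} {S₁ : ResidualSpace i₁ r₁} {S₂ : ResidualSpace i₂ r₂}
  {S₃ : ResidualSpace i₃ r₃} {e₁ : X ⟶ X₁} {w₁ : W ⟶ W₁} {e₂ : X ⟶ X₂} {w₂ : W ⟶ W₂}
  {e₁₃ : X₁ ⟶ X₃} {w₁₃ : W₁ ⟶ W₃} {e₂₃ : X₂ ⟶ X₃} {w₂₃ : W₂ ⟶ W₃} {sq₁ : i ≫ e₁ = w₁ ≫ i₁}
  {sq₂ : i ≫ e₂ = w₂ ≫ i₂} {sq₁₃ : i₁ ≫ e₁₃ = w₁₃ ≫ i₃} {sq₂₃ : i₂ ≫ e₂₃ = w₂₃ ≫ i₃}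
  {κ₁ : R ⟶ R₁} {κ₂ : R ⟶ R₂} {κ₁₃ : R₁ ⟶ R₃} {κ₂₃ : R₂ ⟶ R₃}

/-- The canonical morphisms over a commutative square form a commutative square. -/
theorem comp_eq_comp_of_isResidualMap (he : e₁ ≫ e₁₃ = e₂ ≫ e₂₃) (h₁ : IsResidualMap S S₁ sq₁ κ₁)
    (h₂ : IsResidualMap S S₂ sq₂ κ₂) (h₁₃ : IsResidualMap S₁ S₃ sq₁₃ κ₁₃)
    (h₂₃ : IsResidualMap S₂ S₃ sq₂₃ κ₂₃) : κ₁ ≫ κ₁₃ = κ₂ ≫ κ₂₃ := by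
  refine hom_ext_of_fat fun A _ _ _ g => ?_
  obtain ⟨x, φ, α, hα⟩ := S.exists_form g
  have h := (hα.comp h₁).comp h₁₃
  have h' := (hα.comp h₂).comp h₂₃
  rw [Category.assoc] at h h'
  refine h.hom_ext_of_sections h' ?_ fun U s hx hy => ?_
  · simp only [Category.assoc, h₁₃.comm, h₂₃.comm]
    rw [← Category.assoc κ₁, h₁.comm, ← Category.assoc κ₂, h₂.comm, Category.assoc, Category.assoc,
      he]
  · refine ((α.pull sq₁).pull_idealGerm sq₁₃ hx s).trans
      (Eq.trans ?_ ((α.pull sq₂).pull_idealGerm sq₂₃ hy s).symm)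
    refine (α.pull_idealGerm sq₁ hx (idealPull sq₁₃ U s)).trans
      (Eq.trans ?_ (α.pull_idealGerm sq₂ hy (idealPull sq₂₃ U s)).symm)
    exact congrArg α (Subtype.ext (germ_app_congr he s.1 x hx hy))

theorem stalkIdeal_ne_top (h : X ⟶ X₁) (x : X.obj.left) : stalkIdeal h (pt h x) ≠ ⊤ := by
  intro h1
  have h2 := stalkIdeal_le_ker h x (h1 ▸ trivial : (1 : Stk X₁.obj (pt h x)) ∈ _)
  rw [RingHom.mem_ker, map_one] at h2
  exact one_ne_zero h2

theorem stalkIdeal_le_maximalIdeal (h : X ⟶ X₁) (x : X.obj.left) {y : X₁.obj.left}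
    (hy : pt h x = y) : stalkIdeal h y ≤ IsLocalRing.maximalIdeal (Stk X₁.obj y) := by
  subst hy
  exact IsLocalRing.le_maximalIdeal (stalkIdeal_ne_top h x)

/-- For a cartesian square of closed embeddings, a germ that vanishes on the intersection `X` is the
sum of germs that vanish on `X₁` and on `X₂`. -/
theorem mem_sup_stalkIdeal (he : e₁ ≫ e₁₃ = e₂ ≫ e₂₃) (he₁ : ComplexSpace.IsClosedEmbedding e₁)
    (he₁₃ : ComplexSpace.IsClosedEmbedding e₁₃) (he₂₃ : ComplexSpace.IsClosedEmbedding e₂₃)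
    (hcart : ∀ (A : Type) [CommRing A] [Algebra ℂ A] [IsFatAlg A] (g₁ : fat A ⟶ X₁)
      (g₂ : fat A ⟶ X₂), g₁ ≫ e₁₃ = g₂ ≫ e₂₃ → ∃ g : fat A ⟶ X, g ≫ e₁ = g₁) (x : X.obj.left)
    {y : Stk X₃.obj (pt e₁₃ (pt e₁ x))} (hy : stk e₁ x (stk e₁₃ (pt e₁ x) y) = 0) :
    y ∈ stalkIdeal e₁₃ (pt e₁₃ (pt e₁ x)) ⊔ stalkIdeal e₂₃ (pt e₁₃ (pt e₁ x)) := by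
  have hpt : pt e₂₃ (pt e₂ x) = pt e₁₃ (pt e₁ x) := congrArg (pt · x) he.symm
  refine mem_of_forall_fat (fun h => ?_) fun A _ _ _ θ _ hθ => ?_
  · have h1 := sup_le (stalkIdeal_le_maximalIdeal e₁₃ (pt e₁ x) rfl)
      (stalkIdeal_le_maximalIdeal e₂₃ (pt e₂ x) hpt)
    rw [h, top_le_iff] at h1
    exact Ideal.IsPrime.ne_top inferInstance h1
  · obtain ⟨g₁, hg₁⟩ := fatLift_of_isClosedEmbedding he₁₃ A (fatHom _ θ)
      (kills_fatHom_iff.2 fun a ha => hθ a (Ideal.mem_sup_left ha))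
    obtain ⟨g₂, hg₂⟩ := fatLift_of_isClosedEmbedding he₂₃ A (fatHom _ θ)
      (kills_fatHom_iff.2 fun a ha => hθ a (Ideal.mem_sup_right ha))
    obtain ⟨g, rfl⟩ := hcart A g₁ g₂ (hg₁.trans hg₂.symm)
    obtain ⟨x', ψ, rfl⟩ := exists_eq_fatHom g
    rw [fatHom_comp, fatHom_comp] at hg₁
    obtain rfl := (pt_isClosedEmbedding he₁).injective
      ((pt_isClosedEmbedding he₁₃).injective (fatHom_pt_eq hg₁))
    rw [← fatHom_injective hg₁]
    change ψ (stk e₁ x' (stk e₁₃ (pt e₁ x') y)) = 0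
    rw [hy, map_zero]

/-- The canonical morphisms of residual spaces along retracts over a cartesian square of closed
embeddings form a cartesian square, on points with values in fat points. -/
theorem exists_lift_of_cartesian (he : e₁ ≫ e₁₃ = e₂ ≫ e₂₃)
    (he₁ : ComplexSpace.IsClosedEmbedding e₁)
    (he₁₃ : ComplexSpace.IsClosedEmbedding e₁₃) (he₂₃ : ComplexSpace.IsClosedEmbedding e₂₃)
    (hcart : ∀ (A : Type) [CommRing A] [Algebra ℂ A] [IsFatAlg A] (g₁ : fat A ⟶ X₁)
      (g₂ : fat A ⟶ X₂), g₁ ≫ e₁₃ = g₂ ≫ e₂₃ → ∃ g : fat A ⟶ X, g ≫ e₁ = g₁)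
    {p₁ : X₁ ⟶ W₁} {p₂ : X₂ ⟶ W₂} {p₃ : X₃ ⟶ W₃} (hp₃ : i₃ ≫ p₃ = 𝟙 W₃)
    (hp₁₃ : e₁₃ ≫ p₃ = p₁ ≫ w₁₃) (hp₂₃ : e₂₃ ≫ p₃ = p₂ ≫ w₂₃)
    (hs₁ : ∀ x, Function.Surjective (idealPullStalk sq₁ x))
    (hs₁₃ : ∀ x, Function.Surjective (idealPullStalk sq₁₃ x))
    (h₁ : IsResidualMap S S₁ sq₁ κ₁) (h₁₃ : IsResidualMap S₁ S₃ sq₁₃ κ₁₃)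
    (h₂₃ : IsResidualMap S₂ S₃ sq₂₃ κ₂₃) {A : Type} [CommRing A] [Algebra ℂ A] [IsFatAlg A]
    (a : fat A ⟶ R₁) (c : fat A ⟶ R₂) (hac : a ≫ κ₁₃ = c ≫ κ₂₃) : ∃ l : fat A ⟶ R, l ≫ κ₁ = a := by
  have hac' : (a ≫ r₁) ≫ e₁₃ = (c ≫ r₂) ≫ e₂₃ := by
    rw [Category.assoc, Category.assoc, ← h₁₃.comm, ← h₂₃.comm, ← Category.assoc, hac,
      Category.assoc]
  obtain ⟨g, hg⟩ := hcart A _ _ hac'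
  have hg' : g ≫ e₂ = c ≫ r₂ := by
    refine fatMono_of_isClosedEmbedding he₂₃ A _ _ ?_
    rw [← hac', ← hg, Category.assoc, Category.assoc, he]
  obtain ⟨x, φ, rfl⟩ := exists_eq_fatHom g
  rw [fatHom_comp] at hg hg'
  obtain ⟨α, hα⟩ := S₁.exists_rep a hg.symm
  obtain ⟨β, hβ⟩ := S₂.exists_rep c hg'.symm
  have hα₃ := hα.comp h₁₃
  rw [hac] at hα₃
  obtain ⟨u, hu, huαβ⟩ := hα₃.exists_mul_eq_of_sections (hβ.comp h₂₃)
  have hpt : pt e₂₃ (pt e₂ x) = pt e₁₃ (pt e₁ x) := congrArg (pt · x) he.symm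
  have hker : ∀ b, idealPullStalk sq₁ x b = 0 → α b = 0 := by
    intro b hb
    obtain ⟨y, rfl⟩ := hs₁₃ _ b
    obtain ⟨y₁, hy₁, y₂, hy₂, hy⟩ := Submodule.mem_sup.1
      (mem_sup_stalkIdeal he he₁ he₁₃ he₂₃ hcart x (y := y.1) (congrArg Subtype.val hb))
    obtain ⟨π, hπ, hπ', hπe⟩ := exists_projection hp₃ (pt e₁₃ (pt e₁ x))
    -- the components of the projection of `y₁ + y₂` lie in the ideal of `W₃`
    have hz₁ := hπe X₁ e₁₃ (p₁ ≫ i₁) (by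
      rw [← Category.assoc, hp₁₃, Category.assoc, Category.assoc, sq₁₃]) y₁ hy₁
    have hz₂ := hπe X₂ e₂₃ (p₂ ≫ i₂) (by
      rw [← Category.assoc, hp₂₃, Category.assoc, Category.assoc, sq₂₃]) y₂ hy₂
    have hyz : y = ⟨π y₁, hπ y₁⟩ + ⟨π y₂, hπ y₂⟩ := by
      refine Subtype.ext ?_
      rw [← hπ' y.1 y.2, ← hy, map_add]
      rfl
    rw [← IdealForm.pull_apply, hyz, map_add]
    have h4 : α.pull sq₁₃ ⟨π y₁, hπ y₁⟩ = 0 := by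
      have h5 : idealPullStalk sq₁₃ (pt e₁ x) ⟨π y₁, hπ y₁⟩ = 0 :=
        Subtype.ext (RingHom.mem_ker.1 (stalkIdeal_le_ker e₁₃ _ hz₁))
      rw [IdealForm.pull_apply, h5, map_zero]
    have h6 : α.pull sq₁₃ ⟨π y₂, hπ y₂⟩ = 0 := by
      obtain ⟨U, hU, s, hs, hsz⟩ := exists_idealGerm_app_eq_zero ⟨π y₂, hπ y₂⟩ hz₂
      have hU' : pt e₂₃ (pt e₂ x) ∈ U := hpt ▸ hU
      have h7 := huαβ U s hU hU'
      have h8 : idealPull sq₂₃ U s = 0 := Subtype.ext hs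
      have h9 : idealGerm i₂ (pt e₂ x) (mem_preim.2 hU') (0 : idealOf i₂ (preim e₂₃ U)) = 0 :=
        Subtype.ext (map_zero (Stk.germ (Z := X₂.obj) (U := preim e₂₃ U) (pt e₂ x) hU'))
      rw [IdealForm.pull_idealGerm, h8, h9, map_zero] at h7
      rw [← hsz]
      exact (hu.mul_right_eq_zero).1 h7.symm
    rw [h4, h6, add_zero]
  obtain ⟨γ, hγ⟩ := α.exists_pull_eq he₁ (hs₁ x) hker
  obtain ⟨U, hxU, s, hsD⟩ := S₁.exists_mem_D a hα.comm
  obtain ⟨l, hl⟩ := S.exists_hom_of_form γ (a := idealPullStalk sq₁ x (idealGerm i₁ _ hxU s)) (by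
    rw [← IdealForm.pull_apply, hγ]
    exact (hα.mem_D U s hxU).1 hsD)
  have hl' := hl.comp h₁
  rw [hγ] at hl'
  exact ⟨l, hl'.hom_ext hα fun a b => mul_comm _ _⟩

end ResidualSpace

end

section

open ComplexSpace

/-! ### The cartesian square of iterated multiple point spaces -/

theorem isClosedEmbedding_id (X : ComplexSpace) : ComplexSpace.IsClosedEmbedding (𝟙 X) :=
  isClosedEmbedding_of_fat fatMono_id fun _ _ _ _ g _ => ⟨g, Category.comp_id g⟩

theorem fatMono_comp_cancel {Z X Y : ComplexSpace} {h : X ⟶ Y}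
    (H : ComplexSpace.IsClosedEmbedding h) {a b : Z ⟶ X} (hab : a ≫ h = b ≫ h) : a = b := by
  have := (fatMono_of_isClosedEmbedding H).mono
  exact (cancel_mono h).1 hab

namespace MultiplePoints.IsCanonical

variable {X Y X' Y' : ComplexSpace} {f : X ⟶ Y} {f' : X' ⟶ Y'} {e : X ⟶ X'} {j : Y ⟶ Y'}
  {K : MultiplePoints f} {K' : MultiplePoints f'}
  {B : MultiplePoints (toPoint X)} {B' : MultiplePoints (toPoint X')}
  {k : ∀ r, K.K r ⟶ K'.K r} {b : ∀ r, B.K r ⟶ B'.K r} {u : ∀ r, K.K r ⟶ B.K r}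
  {u' : ∀ r, K'.K r ⟶ B'.K r}

theorem fibLift_comp (hk : K.IsCanonical K' e j k) (hb : B.IsCanonical B' e (𝟙 point) b)
    (hu : K.IsCanonical B (𝟙 X) (toPoint Y) u) (hu' : K'.IsCanonical B' (𝟙 X') (toPoint Y') u')
    {r : ℕ} (h : k (r + 1) ≫ u' (r + 1) = u (r + 1) ≫ b (r + 1)) :
    fibLift K K' _ _ (hk.comm r) ≫ fibLift K' B' _ _ (hu'.comm r) =
      fibLift K B _ _ (hu.comm r) ≫ fibLift B B' _ _ (hb.comm r) := by
  apply (B'.isPullback r).hom_ext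
  · rw [Category.assoc, Category.assoc, fibLift_p₁, fibLift_p₁, ← Category.assoc, ← Category.assoc,
      fibLift_p₁, fibLift_p₁, Category.assoc, Category.assoc, h]
  · rw [Category.assoc, Category.assoc, fibLift_p₂, fibLift_p₂, ← Category.assoc, ← Category.assoc,
      fibLift_p₂, fibLift_p₂, Category.assoc, Category.assoc, h]

theorem comp_eq_comp (hk : K.IsCanonical K' e j k) (hb : B.IsCanonical B' e (𝟙 point) b)
    (hu : K.IsCanonical B (𝟙 X) (toPoint Y) u) (hu' : K'.IsCanonical B' (𝟙 X') (toPoint Y') u')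
    (r : ℕ) : k (r + 1) ≫ u' (r + 1) = u (r + 1) ≫ b (r + 1) := by
  induction r with
  | zero =>
    have h1 : k (0 + 1) = e := hk.one
    have h2 : u' (0 + 1) = 𝟙 X' := hu'.one
    have h3 : u (0 + 1) = 𝟙 X := hu.one
    have h4 : b (0 + 1) = e := hb.one
    rw [h1, h2, h3, h4]
    exact (Category.comp_id e).trans (Category.id_comp e).symm
  | succ r ih =>
    exact ResidualSpace.comp_eq_comp_of_isResidualMap (fibLift_comp hk hb hu hu' ih)
      (hk.residual r) (hu.residual r) (hu'.residual r) (hb.residual r)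

/-- On points with values in fat points, the canonical square is cartesian. A pair of points of
`K'_r` and `B_r` with the same image in `B'_r` has components in `K_{r-1}` by induction; these agree
in `K_{r-2}` because `K_{r-2}` embeds into `K'_{r-2}`. -/
theorem exists_fat_lift (hj : ComplexSpace.IsClosedEmbedding j)
    (he : ComplexSpace.IsClosedEmbedding e)
    (hk : K.IsCanonical K' e j k) (hb : B.IsCanonical B' e (𝟙 point) b)
    (hu : K.IsCanonical B (𝟙 X) (toPoint Y) u) (hu' : K'.IsCanonical B' (𝟙 X') (toPoint Y') u')
    (r : ℕ) (A : Type) [CommRing A] [Algebra ℂ A] [IsFatAlg A] (a : fat A ⟶ K'.K (r + 1))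
    (c : fat A ⟶ B.K (r + 1)) (hac : a ≫ u' (r + 1) = c ≫ b (r + 1)) :
    ∃ l : fat A ⟶ K.K (r + 1), l ≫ k (r + 1) = a := by
  induction r generalizing A with
  | zero =>
    have h1 : k (0 + 1) = e := hk.one
    have h2 : u' (0 + 1) = 𝟙 X' := hu'.one
    have h4 : b (0 + 1) = e := hb.one
    rw [h2, h4] at hac
    rw [h1]
    exact ⟨c, hac.symm.trans (Category.comp_id a)⟩
  | succ r ih =>
    have hk₀ : ComplexSpace.IsClosedEmbedding (k r) := by
      cases r with
      | zero =>
        have h0 : k 0 = j := hk.zero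
        rw [h0]
        exact hj
      | succ r => exact hk.isClosedEmbedding he r
    have hk₁ := hk.isClosedEmbedding he r
    have hb₁ := hb.isClosedEmbedding he r
    have hu₁ := hu'.isClosedEmbedding (isClosedEmbedding_id X') r
    refine ResidualSpace.exists_lift_of_cartesian
      (fibLift_comp hk hb hu hu' (comp_eq_comp hk hb hu hu' r))
      (isClosedEmbedding_fibLift (hk.comm r) hk₁) (isClosedEmbedding_fibLift (hu'.comm r) hu₁)
      (isClosedEmbedding_fibLift (hb.comm r) hb₁) ?_ (B'.diag_p₁ r) (fibLift_p₁ (hu'.comm r))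
      (fibLift_p₁ (hb.comm r)) (idealPullStalk_fibLift_surjective (hk.comm r) hk₁)
      (idealPullStalk_fibLift_surjective (hu'.comm r) hu₁) (hk.residual r) (hu'.residual r)
      (hb.residual r) a c hac
    intro A' _ _ _ g₁ g₂ hg
    obtain ⟨x₁, hx₁⟩ := ih A' (g₁ ≫ K'.p₁ r) (g₂ ≫ B.p₁ r) (by
      rw [Category.assoc, Category.assoc, ← fibLift_p₁ (hu'.comm r), ← fibLift_p₁ (hb.comm r),
        ← Category.assoc, hg, Category.assoc])
    obtain ⟨x₂, hx₂⟩ := ih A' (g₁ ≫ K'.p₂ r) (g₂ ≫ B.p₂ r) (by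
      rw [Category.assoc, Category.assoc, ← fibLift_p₂ (hu'.comm r), ← fibLift_p₂ (hb.comm r),
        ← Category.assoc, hg, Category.assoc])
    have hx : x₁ ≫ K.π r = x₂ ≫ K.π r := by
      refine fatMono_comp_cancel hk₀ ?_
      rw [Category.assoc, Category.assoc, ← hk.comm r, ← Category.assoc, ← Category.assoc, hx₁,
        hx₂, Category.assoc, Category.assoc, (K'.isPullback r).w]
    refine ⟨(K.isPullback r).lift x₁ x₂ hx, (K'.isPullback r).hom_ext ?_ ?_⟩
    · rw [Category.assoc, fibLift_p₁, ← Category.assoc, (K.isPullback r).lift_fst, hx₁]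
    · rw [Category.assoc, fibLift_p₂, ← Category.assoc, (K.isPullback r).lift_snd, hx₂]

theorem isPullback (hj : ComplexSpace.IsClosedEmbedding j) (he : ComplexSpace.IsClosedEmbedding e)
    (hk : K.IsCanonical K' e j k) (hb : B.IsCanonical B' e (𝟙 point) b)
    (hu : K.IsCanonical B (𝟙 X) (toPoint Y) u) (hu' : K'.IsCanonical B' (𝟙 X') (toPoint Y') u')
    (r : ℕ) : IsPullback (k (r + 1)) (u (r + 1)) (u' (r + 1)) (b (r + 1)) := by
  have hkr := hk.isClosedEmbedding he r
  have h := comp_eq_comp hk hb hu hu' r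
  have hl : ∀ s : Limits.PullbackCone (u' (r + 1)) (b (r + 1)),
      ∃ l : s.pt ⟶ K.K (r + 1), l ≫ k (r + 1) = s.fst := fun s =>
    exists_lift_of_fat hkr s.fst fun A _ _ _ g =>
      exists_fat_lift hj he hk hb hu hu' r A (g ≫ s.fst) (g ≫ s.snd) (by
        rw [Category.assoc, Category.assoc, s.condition])
  choose l hl using hl
  refine ⟨⟨h⟩, ⟨Limits.PullbackCone.IsLimit.mk h l hl (fun s => ?_) fun s m hm _ => ?_⟩⟩
  · refine fatMono_comp_cancel (hb.isClosedEmbedding he r) ?_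
    rw [Category.assoc, ← h, ← Category.assoc, hl, s.condition]
  · exact fatMono_comp_cancel hkr (hm.trans (hl s).symm)

end MultiplePoints.IsCanonical

end

end

end IteratedMultiplePoints

theorem mainTheorem4 {X Y X' Y' : ComplexSpace} (f : X ⟶ Y) (f' : X' ⟶ Y') (e : X ⟶ X')
    (j : Y ⟶ Y') (he : ComplexSpace.IsClosedEmbedding e) (hj : ComplexSpace.IsClosedEmbedding j)
    (sq : f ≫ j = e ≫ f')
    (K : MultiplePoints f) (K' : MultiplePoints f')
    (B : MultiplePoints (toPoint X)) (B' : MultiplePoints (toPoint X')) :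
    (∃! k, K.IsCanonical K' e j k) ∧
    (∃! b, B.IsCanonical B' e (𝟙 point) b) ∧
    (∃! u, K.IsCanonical B (𝟙 X) (toPoint Y) u) ∧
    (∃! u', K'.IsCanonical B' (𝟙 X') (toPoint Y') u') ∧
    ∀ k b u u', K.IsCanonical K' e j k → B.IsCanonical B' e (𝟙 point) b →
      K.IsCanonical B (𝟙 X) (toPoint Y) u → K'.IsCanonical B' (𝟙 X') (toPoint Y') u' →
      ∀ r : ℕ, 1 ≤ r →
        ComplexSpace.IsClosedEmbedding (k r) ∧ ComplexSpace.IsClosedEmbedding (b r) ∧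
        ComplexSpace.IsClosedEmbedding (u r) ∧ ComplexSpace.IsClosedEmbedding (u' r) ∧
        IsPullback (k r) (u r) (u' r) (b r) := by
  have key : ∀ {X Y X' Y' : ComplexSpace} {f : X ⟶ Y} {f' : X' ⟶ Y'} (M : MultiplePoints f)
      (M' : MultiplePoints f') (e : X ⟶ X') (g : Y ⟶ Y'), ComplexSpace.IsClosedEmbedding e →
      f ≫ g = e ≫ f' → ∃! k, M.IsCanonical M' e g k := fun M M' e g he sq => by
    obtain ⟨k, hk⟩ := MultiplePoints.exists_isCanonical M M' e g he sq
    exact ⟨k, hk, fun l hl => hl.unique hk⟩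
  have hpt : ∀ {Z : ComplexSpace} (a b : Z ⟶ point), a = b := fun a b =>
    (toPoint_unique a).trans (toPoint_unique b).symm
  refine ⟨key K K' e j he sq, key B B' e (𝟙 point) he (hpt _ _),
    key K B (𝟙 X) (toPoint Y) (isClosedEmbedding_id X) (hpt _ _),
    key K' B' (𝟙 X') (toPoint Y') (isClosedEmbedding_id X') (hpt _ _), ?_⟩
  intro k b u u' hk hb hu hu' r hr
  obtain ⟨r, rfl⟩ := Nat.exists_eq_add_of_le' hr
  exact ⟨hk.isClosedEmbedding he r, hb.isClosedEmbedding he r,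
    hu.isClosedEmbedding (isClosedEmbedding_id X) r,
    hu'.isClosedEmbedding (isClosedEmbedding_id X') r,
    MultiplePoints.IsCanonical.isPullback hj he hk hb hu hu' r⟩
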